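/- A budgeting scenario $E=(A,V,c,\ell)$ consists of a finite set $A=\{a_1,\dots,a_m\}$ of items, a cost function $c\colon A\to\mathbb{N}$, a finite set $V=\{v_1,\dots,v_n\}$ of voters, each voter $v$ having an approval set $A_v\subseteq A$, and a budget limit $\ell\in\mathbb{N}$. A set $B\subseteq A$ is a feasible budget if $\sum_{b\in B}c(b)\le\ell$. A voter $v$ has satisfaction $\mathbb{1}_{|B_v|>0}$ from $B$, where $B_v=A_v\cap B$; that is, satisfaction $1$ if $B$ contains an item she approves of, and $0$ otherwise. A winning budget under the Max rule $\mathcal{R}^m_{\mathbb{1}_{|B_v|>0}}$ is a feasible budget that maximizes $\sum_{v\in V}\mathbb{1}_{|B_v|>0}$ among all feasible budgets. Scenarios are encoded as strings with $c$ and $\ell$ written in binary. **Proposition.** $\mathcal{R}^m_{\mathbb{1}_{|B_v|>0}}$ is fixed-parameter tractable with respect to the number $n$ of voters. That is: 1. there are a (multi-stack) Turing machine, a computable function $f\colon\mathbb{N}\to\mathbb{N}$ and a polynomial $p$ such that, given any budgeting scenario $E$ with $n$ voters, the machine outputs a winning budget for $E$ within $f(n)\cdot p(|E|)$ steps, where $|E|$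 is the length of the encoding of $E$; 2. the problem of deciding, given a budgeting scenario $E$ with $n$ voters and a bound $s\in\mathbb{N}$, whether there is a feasible budget $B$ with $\sum_{v\in V}\mathbb{1}_{|B_v|>0}\ge s$, is likewise solvable by such a machine within $f(n)\cdot p(|(E,s)|)$ steps, for some computable $f$ and some polynomial $p$. -/

import Mathlib

/-- A budgeting scenario `(A, V, c, ℓ)` with items `A = {a₁, …, a_m}`, voters
`V = {v₁, …, v_n}`, approval sets `A_v ⊆ A`, costs `c : A → ℕ` and budget limit `ℓ`. -/
structure BudgetScenario where
  numItems : ℕ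
  numVoters : ℕ
  cost : Fin numItems → ℕ
  approval : Fin numVoters → Finset (Fin numItems)
  limit : ℕ

namespace BudgetScenario

/-- `B` is a feasible budget: its total cost respects the budget limit. -/
def IsFeasible (E : BudgetScenario) (B : Finset (Fin E.numItems)) : Prop :=
  ∑ a ∈ B, E.cost a ≤ E.limit

/-- The total satisfaction `∑ v, f (A_v, B)` of the voters from `B`, for the satisfaction
function `f : 2^A × 2^A → ℕ`. -/
def totalSat (E : BudgetScenario)
    (f : Finset (Fin E.numItems) → Finset (Fin E.numItems) → ℕ)
    (B : Finset (Fin E.numItems)) : ℕ :=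
  ∑ v, f (E.approval v) B

/-- `B` is a winning budget under the Max rule for `f`: it is feasible and has the largest total
satisfaction among all feasible budgets. -/
def IsMaxWinning (E : BudgetScenario)
    (f : Finset (Fin E.numItems) → Finset (Fin E.numItems) → ℕ)
    (B : Finset (Fin E.numItems)) : Prop :=
  E.IsFeasible B ∧ ∀ B', E.IsFeasible B' → E.totalSat f B' ≤ E.totalSat f B

end BudgetScenario

/-- The satisfaction function `1_{|B_v| > 0}`, where `B_v = A_v ∩ B`. -/
def coverSat {A : Type} [DecidableEq A] (Av B : Finset A) : ℕ :=
  if 0 < (Av ∩ B).card then 1 else 0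

/-! ### Encodings of instances and solutions as strings -/

section Encodings

open Computability

/-- Binary representation of a natural number, over the Turing machine alphabet `Γ'`. -/
def natBits (k : ℕ) : List Γ' :=
  (encodeNat k).map Γ'.bit

/-- The string of an item: its cost in binary, then its column of the approval matrix. -/
def itemString (x : ℕ × List Bool) : List Γ' :=
  natBits x.1 ++ Γ'.bra :: (x.2.map Γ'.bit ++ [Γ'.ket])

/-- For each item its cost and its column of the `n × m` binary approval matrix. -/
def BudgetScenario.columns (E : BudgetScenario) : List (ℕ × List Bool) :=
  List.ofFn fun a => (E.cost a, List.ofFn fun v => decide (a ∈ E.approval v))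

/-- A scenario as a string: a mark for each voter, the budget limit in binary, and the items. -/
def scenarioString (E : BudgetScenario) : List Γ' :=
  List.replicate E.numVoters (Γ'.bit true) ++
    Γ'.comma :: (natBits E.limit ++ Γ'.comma :: E.columns.flatMap itemString)

theorem split_at_sep {sep : Γ'} {u u' r r' : List Γ'} (hu : sep ∉ u) (hu' : sep ∉ u')
    (h : u ++ sep :: r = u' ++ sep :: r') : u = u' ∧ r = r' := by
  induction u generalizing u' with
  | nil =>
    cases u' with
    | nil => simpa using h
    | cons y t =>
      simp only [List.nil_append, List.cons_append, List.cons.injEq] at h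
      exact absurd (by simp [h.1]) hu'
  | cons x s ih =>
    cases u' with
    | nil =>
      simp only [List.nil_append, List.cons_append, List.cons.injEq] at h
      exact absurd (by simp [h.1]) hu
    | cons y t =>
      simp only [List.cons_append, List.cons.injEq] at h
      simp only [List.mem_cons, not_or] at hu hu'
      obtain ⟨h1, h2⟩ := ih hu.2 hu'.2 h.2
      exact ⟨by rw [h.1, h1], h2⟩

theorem map_bit_injective : Function.Injective (List.map Γ'.bit) :=
  List.map_injective_iff.2 fun _ _ h => by simpa using h

theorem natBits_injective : Function.Injective natBits := fun a b h => by
  have h' := map_bit_injective h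
  rw [← decode_encodeNat a, ← decode_encodeNat b, h']

theorem flatMap_itemString_injective :
    Function.Injective fun l : List (ℕ × List Bool) => l.flatMap itemString := by
  intro l
  induction l with
  | nil =>
    intro l' h
    cases l' with
    | nil => rfl
    | cons y t => simp [itemString] at h
  | cons x s ih =>
    intro l' h
    cases l' with
    | nil => simp [itemString] at h
    | cons y t =>
      simp only [List.flatMap_cons, itemString, List.append_assoc, List.cons_append,
        List.nil_append] at h
      obtain ⟨h1, h2⟩ := split_at_sep (by simp [natBits]) (by simp [natBits]) h
      obtain ⟨h3, h4⟩ := split_at_sep (by simp) (by simp) h2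
      rw [ih h4, Prod.ext (natBits_injective h1) (map_bit_injective h3)]

theorem scenarioString_injective : Function.Injective scenarioString := by
  rintro ⟨m, n, c, A, l⟩ ⟨m', n', c', A', l'⟩ h
  simp only [scenarioString] at h
  obtain ⟨h1, h2⟩ := split_at_sep (by simp [List.mem_replicate]) (by simp [List.mem_replicate]) h
  obtain ⟨h3, h4⟩ := split_at_sep (by simp [natBits]) (by simp [natBits]) h2
  have hn : n = n' := by simpa using congrArg List.length h1
  have hl : l = l' := natBits_injective h3
  have hc := flatMap_itemString_injective h4
  simp only [BudgetScenario.columns] at hc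
  have hm : m = m' := by simpa using congrArg List.length hc
  subst hn hl hm
  have hf := List.ofFn_injective hc
  have hcost : c = c' := funext fun a => (Prod.ext_iff.1 (congrFun hf a)).1
  have hA : A = A' := by
    funext v
    ext a
    have := congrFun (List.ofFn_injective (Prod.ext_iff.1 (congrFun hf a)).2) v
    simpa using this
  rw [hcost, hA]

theorem boundString_injective : Function.Injective fun x : BudgetScenario × ℕ =>
    natBits x.2 ++ Γ'.comma :: scenarioString x.1 := by
  rintro ⟨E, s⟩ ⟨E', s'⟩ h
  obtain ⟨h1, h2⟩ := split_at_sep (by simp [natBits]) (by simp [natBits]) h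
  exact Prod.ext (scenarioString_injective h2) (natBits_injective h1)

open Classical in
/-- The encoding of budgeting scenarios, all numbers being in binary. -/
noncomputable def scenarioEncoding : Encoding BudgetScenario Γ' where
  encode := scenarioString
  decode := Function.partialInv scenarioString
  decode_encode := Function.partialInv_left scenarioString_injective

open Classical in
/-- The encoding of pairs of a budgeting scenario and a bound on the total satisfaction. -/
noncomputable def scenarioBoundEncoding : Encoding (BudgetScenario × ℕ) Γ' where
  encode x := natBits x.2 ++ Γ'.comma :: scenarioString x.1
  decode := Function.partialInv fun x : BudgetScenario × ℕ =>
    natBits x.2 ++ Γ'.comma :: scenarioString x.1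
  decode_encode := Function.partialInv_left boundString_injective

/-- A set of items as its string of `m` indicator bits. -/
def budgetString {m : ℕ} (B : Finset (Fin m)) : List Bool :=
  List.ofFn fun a => decide (a ∈ B)

end Encodings

/-! ### Fixed-parameter tractability -/

/-- The search problem "given `x`, output a string `w` with `R x w`" is fixed-parameter tractable
for the parameter `κ`: some multi-stack Turing machine solves every instance `x` within
`f (κ x) * p (|x|)` steps, where `f` is computable, `p` is a polynomial and `|x|` is the length of
the encoding of `x`. -/
def FPTSearch {α Γ₀ Γ₁ : Type} (e : Computability.Encoding α Γ₀) (κ : α → ℕ)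
    (R : α → List Γ₁ → Prop) : Prop :=
  ∃ (M : Turing.TM2ComputableAux Γ₀ Γ₁) (f : ℕ → ℕ) (p : Polynomial ℕ),
    (∀ k, Finite (M.tm.Γ k)) ∧ Computable f ∧
      ∀ x, ∃ w, R x w ∧
        Nonempty (Turing.TM2OutputsInTime M.tm ((e.encode x).map M.inputAlphabet.symm)
          (some (w.map M.outputAlphabet.symm)) (f (κ x) * p.eval (e.encode x).length))

/-- The decision problem `P` is fixed-parameter tractable for the parameter `κ`. -/
def FPTDecision {α Γ₀ : Type} (e : Computability.Encoding α Γ₀) (κ : α → ℕ)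
    (P : α → Prop) : Prop :=
  FPTSearch e κ fun x w => ∃ b : Bool, w = Computability.encodeBool b ∧ (b = true ↔ P x)

/-! The algorithm is a dynamic program over the items. A selection of the items seen so far matters
for the rest of the computation only through the set of voters it covers and the budget it leaves.
Among selections that cover the same voters, one with the largest remaining budget can replace any
other, whatever is selected later. So a table with at most one candidate per set of voters, hence
with at most `2 ^ n` candidates, represents all feasible selections.

Processing an item replaces each candidate by itself and, if the item is affordable, by its
extension. The at most `2 * 2 ^ n` results are inserted one after the other into a fresh table, each
being compared with at most `2 ^ n` entries. After the last item, a candidate covering the most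
voters is a winning budget, and comparing its count with `s` settles the decision problem. Every
elementary step is a linear scan of words no longer than the input. This gives a bound `(2 ^ n + 1)
^ 2` times a polynomial.

The exchange argument is `Represents.stepItem`, supported by `exists_mem_foldl_insertCand`; the size
bound is `IsTable.length_le`; `choice_spec` and `choiceOf_spec` turn these into optimality of the
computed budget.

The rest realizes the algorithm on a machine with an explicit step count. Structured programs are
compiled to `TM2` code (`Exec.iterate_step`). On top of them stand operations on stacks of binary
words, the central one running a two-state transducer over two words in lockstep
(`execIn_zipWords`); subtraction, comparison, union and increment are all such transducers. Hoare
triples with time bounds lift this to loops over tables, ending in `triple_searchProg` and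
`triple_decideProg`. `machine_outputs` adds the reading of the input, and `time_le` factors the
total time. -/

namespace StackProgram

open Turing Function

/-! ### Structured programs and their compilation to multi-stack machines -/

section Compile

variable {K : Type} {Γ : K → Type} {σ : Type}

/-- An elementary action of a machine with registers in `σ` and stacks over the alphabets `Γ`. -/
inductive Act (Γ : K → Type) (σ : Type) : Type
  | push (k : K) (f : σ → Γ k)
  | peek (k : K) (f : σ → Option (Γ k) → σ)
  | pop (k : K) (f : σ → Option (Γ k) → σ)
  | load (f : σ → σ)

/-- Structured programs over the elementary actions. -/
inductive Prog (Γ : K → Type) (σ : Type) : Type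
  | act (a : Act Γ σ)
  | seq (p q : Prog Γ σ)
  | ite (b : σ → Bool) (p q : Prog Γ σ)
  | loop (b : σ → Bool) (p : Prog Γ σ)

/-- The labels needed to compile a program. -/
def Prog.Lab : Prog Γ σ → Type
  | .act _ => Unit
  | .seq p q => p.Lab ⊕ q.Lab
  | .ite _ p q => Option (p.Lab ⊕ q.Lab)
  | .loop _ p => Option p.Lab

/-- The label at which a program starts. -/
def Prog.entry : (p : Prog Γ σ) → p.Lab
  | .act _ => ()
  | .seq p _ => .inl p.entry
  | .ite _ _ _ => none
  | .loop _ _ => none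

theorem Prog.finite_lab : ∀ p : Prog Γ σ, Finite p.Lab
  | .act _ => inferInstanceAs (Finite Unit)
  | .seq p q =>
    have := p.finite_lab
    have := q.finite_lab
    inferInstanceAs (Finite (p.Lab ⊕ q.Lab))
  | .ite _ p q =>
    have := p.finite_lab
    have := q.finite_lab
    inferInstanceAs (Finite (Option (p.Lab ⊕ q.Lab)))
  | .loop _ p =>
    have := p.finite_lab
    inferInstanceAs (Finite (Option p.Lab))

variable [DecidableEq K]

/-- The effect of an action on the registers and the stacks. -/
def Act.run : Act Γ σ → σ × (∀ k, List (Γ k)) → σ × (∀ k, List (Γ k))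
  | .push k f, c => (c.1, update c.2 k (f c.1 :: c.2 k))
  | .peek k f, c => (f c.1 (c.2 k).head?, c.2)
  | .pop k f, c => (f c.1 (c.2 k).head?, update c.2 k (c.2 k).tail)
  | .load f, c => (f c.1, c.2)

/-- The statement that performs an action and goes on with another statement. -/
def Act.stmt {Λ : Type} : Act Γ σ → TM2.Stmt Γ Λ σ → TM2.Stmt Γ Λ σ
  | .push k f => .push k f
  | .peek k f => .peek k f
  | .pop k f => .pop k f
  | .load f => .load f

theorem Act.stepAux_stmt {Λ : Type} (a : Act Γ σ) (q : TM2.Stmt Γ Λ σ)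
    (c : σ × (∀ k, List (Γ k))) :
    TM2.stepAux (a.stmt q) c.1 c.2 = TM2.stepAux q (a.run c).1 (a.run c).2 := by
  cases a <;> simp [stmt, run]

/-- Big-step semantics: the program takes the first configuration to the second in exactly the
given number of machine steps. -/
inductive Exec : Prog Γ σ → σ × (∀ k, List (Γ k)) → σ × (∀ k, List (Γ k)) → ℕ → Prop
  | act (a c) : Exec (.act a) c (a.run c) 1
  | seq {p q c c' c'' t t'} : Exec p c c' t → Exec q c' c'' t' → Exec (.seq p q) c c'' (t + t')
  | ite_true {b p q c c' t} : b c.1 = true → Exec p c c' t → Exec (.ite b p q) c c' (1 + t)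
  | ite_false {b p q c c' t} : b c.1 = false → Exec q c c' t → Exec (.ite b p q) c c' (1 + t)
  | loop_false {b p c} : b c.1 = false → Exec (.loop b p) c c 1
  | loop_true {b p c c' c'' t t'} : b c.1 = true → Exec p c c' t →
      Exec (.loop b p) c' c'' t' → Exec (.loop b p) c c'' (1 + t + t')

/-- The machine code of a program whose labels are embedded by `e` and which ends at `x`. -/
def Prog.code {Λ : Type} : (p : Prog Γ σ) → (p.Lab → Λ) → Λ → p.Lab → TM2.Stmt Γ Λ σ
  | .act a, _, x, _ => a.stmt (.goto fun _ => x)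
  | .seq p q, e, x, l =>
    Sum.casesOn (motive := fun _ => TM2.Stmt Γ Λ σ) l
      (p.code (fun l => e (Sum.inl l)) (e (Sum.inr q.entry)))
      (q.code (fun l => e (Sum.inr l)) x)
  | .ite b p q, e, x, l =>
    Option.casesOn (motive := fun _ => TM2.Stmt Γ Λ σ) l
      (.branch b (.goto fun _ => e (some (Sum.inl p.entry)))
        (.goto fun _ => e (some (Sum.inr q.entry))))
      fun l => Sum.casesOn (motive := fun _ => TM2.Stmt Γ Λ σ) l
        (p.code (fun l => e (some (Sum.inl l))) x)
        (q.code (fun l => e (some (Sum.inr l))) x)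
  | .loop b p, e, x, l =>
    Option.casesOn (motive := fun _ => TM2.Stmt Γ Λ σ) l
      (.branch b (.goto fun _ => e (some p.entry)) (.goto fun _ => x))
      (p.code (fun l => e (some l)) (e none))

/-- Induction on the execution. The embedding `e` of the labels and the exit `x` stay universally
quantified, because each subprogram is compiled with its own: the first part of a sequence exits to
the entry of the second, a loop body exits to the test of its loop. An action with its jump, and a
test with its jump, each take one machine step. -/
theorem Exec.iterate_step {Λ : Type} {M : Λ → TM2.Stmt Γ Λ σ} {p : Prog Γ σ}
    {c c' : σ × (∀ k, List (Γ k))} {t : ℕ} (h : Exec p c c' t) :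
    ∀ {e : p.Lab → Λ} {x : Λ}, (∀ l, M (e l) = p.code e x l) →
      (flip bind (TM2.step M))^[t] (some ⟨some (e p.entry), c.1, c.2⟩) =
        some ⟨some x, c'.1, c'.2⟩ := by
  induction h with
  | act a c =>
    intro e x hM
    change some (TM2.stepAux (M (e ())) c.1 c.2) = _
    rw [hM ()]
    simp [Prog.code, Act.stepAux_stmt]
  | @seq p q c c' c'' t t' _ _ ih₁ ih₂ =>
    intro e x hM
    rw [Nat.add_comm, iterate_add_apply]
    have h₁ := ih₁ (e := fun l => e (Sum.inl l)) (x := e (Sum.inr q.entry))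
      fun l => hM (Sum.inl l)
    have h₂ := ih₂ (e := fun l => e (Sum.inr l)) (x := x) fun l => hM (Sum.inr l)
    exact (congrArg _ h₁).trans h₂
  | @ite_true b p q c c' t hb _ ih =>
    intro e x hM
    rw [Nat.add_comm, iterate_succ_apply]
    have h₁ := ih (e := fun l => e (some (Sum.inl l))) (x := x) fun l => hM (some (Sum.inl l))
    refine Eq.trans (congrArg _ ?_) h₁
    change some (TM2.stepAux (M (e none)) c.1 c.2) = _
    rw [hM none]
    simp [Prog.code, hb]
  | @ite_false b p q c c' t hb _ ih =>
    intro e x hM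
    rw [Nat.add_comm, iterate_succ_apply]
    have h₁ := ih (e := fun l => e (some (Sum.inr l))) (x := x) fun l => hM (some (Sum.inr l))
    refine Eq.trans (congrArg _ ?_) h₁
    change some (TM2.stepAux (M (e none)) c.1 c.2) = _
    rw [hM none]
    simp [Prog.code, hb]
  | @loop_false b p c hb =>
    intro e x hM
    change some (TM2.stepAux (M (e none)) c.1 c.2) = _
    rw [hM none]
    simp [Prog.code, hb]
  | @loop_true b p c c' c'' t t' hb _ _ ih₁ ih₂ =>
    intro e x hM
    -- Iterates apply the innermost step first: the test, then the body, then the remaining rounds.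
    rw [show 1 + t + t' = t' + (t + 1) by omega, iterate_add_apply, iterate_succ_apply]
    have h₁ := ih₁ (e := fun l => e (some l)) (x := e none) fun l => hM (some l)
    have h₂ := ih₂ (e := e) (x := x) hM
    refine Eq.trans (congrArg _ ?_) h₂
    refine Eq.trans (congrArg _ ?_) h₁
    change some (TM2.stepAux (M (e none)) c.1 c.2) = _
    rw [hM none]
    simp [Prog.code, hb]

/-- The machine that runs a program and then halts. -/
noncomputable def Prog.toFinTM2 [Fintype K] [Fintype σ] [∀ k, Fintype (Γ k)] (p : Prog Γ σ)
    (i o : K) (s : σ) : FinTM2 where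
  K := K
  k₀ := i
  k₁ := o
  Γ := Γ
  Λ := Option p.Lab
  main := some p.entry
  ΛFin := @Fintype.ofFinite _ (@instFiniteOption _ p.finite_lab)
  σ := σ
  initialState := s
  m l := Option.casesOn (motive := fun _ => TM2.Stmt Γ (Option p.Lab) σ) l .halt
    (p.code some none)

/-- The program takes the first configuration to the second in at most the given number of
machine steps. -/
def ExecIn (p : Prog Γ σ) (c c' : σ × (∀ k, List (Γ k))) (T : ℕ) : Prop :=
  ∃ t ≤ T, Exec p c c' t

/-- The additional step executes `halt` at the exit label. Both configurations have the same
registers `s` because `haltList` demands the initial register contents. -/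
theorem ExecIn.outputs [Fintype K] [Fintype σ] [∀ k, Fintype (Γ k)] {p : Prog Γ σ}
    {i o : K} {s : σ} {S S' : ∀ k, List (Γ k)} {T : ℕ} (h : ExecIn p (s, S) (s, S') T)
    {u : List (Γ i)} {v : List (Γ o)}
    (hS : initList (p.toFinTM2 i o s) u = ⟨some (some p.entry), s, S⟩)
    (hS' : haltList (p.toFinTM2 i o s) v = ⟨none, s, S'⟩) :
    Nonempty (TM2OutputsInTime (p.toFinTM2 i o s) u (some v) (T + 1)) := by
  obtain ⟨t, ht, h⟩ := h
  refine ⟨⟨⟨t + 1, ?_⟩, Nat.succ_le_succ ht⟩⟩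
  have := h.iterate_step (M := (p.toFinTM2 i o s).m) (e := some) (x := none) fun l => rfl
  rw [hS, Nat.add_comm, iterate_add_apply]
  refine (congrArg _ this).trans ?_
  exact congrArg some hS'.symm

theorem ExecIn.mono {p : Prog Γ σ} {c c' : σ × (∀ k, List (Γ k))} {T T' : ℕ}
    (h : ExecIn p c c' T) (hT : T ≤ T') : ExecIn p c c' T' :=
  let ⟨t, ht, h⟩ := h
  ⟨t, ht.trans hT, h⟩

theorem ExecIn.act (a : Act Γ σ) (c : σ × (∀ k, List (Γ k))) : ExecIn (.act a) c (a.run c) 1 :=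
  ⟨1, le_rfl, .act a c⟩

theorem ExecIn.seq {p q : Prog Γ σ} {c c' c'' : σ × (∀ k, List (Γ k))} {T T' : ℕ}
    (h : ExecIn p c c' T) (h' : ExecIn q c' c'' T') : ExecIn (p.seq q) c c'' (T + T') :=
  let ⟨_, ht, h⟩ := h
  let ⟨_, ht', h'⟩ := h'
  ⟨_, add_le_add ht ht', h.seq h'⟩

theorem ExecIn.ite {b : σ → Bool} {p q : Prog Γ σ} {c c' : σ × (∀ k, List (Γ k))} {T : ℕ}
    (h : ExecIn (if b c.1 then p else q) c c' T) : ExecIn (.ite b p q) c c' (T + 1) := by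
  obtain ⟨t, ht, h⟩ := h
  refine ⟨1 + t, by omega, ?_⟩
  by_cases hb : b c.1 = true
  · rw [if_pos hb] at h
    exact .ite_true hb h
  · rw [if_neg hb] at h
    exact .ite_false (by simpa using hb) h

theorem ExecIn.loop_false {b : σ → Bool} {p : Prog Γ σ} {c : σ × (∀ k, List (Γ k))}
    (hb : b c.1 = false) : ExecIn (.loop b p) c c 1 :=
  ⟨1, le_rfl, .loop_false hb⟩

theorem ExecIn.loop_true {b : σ → Bool} {p : Prog Γ σ} {c c' c'' : σ × (∀ k, List (Γ k))}
    {T T' : ℕ} (hb : b c.1 = true) (h : ExecIn p c c' T) (h' : ExecIn (.loop b p) c' c'' T') :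
    ExecIn (.loop b p) c c'' (1 + T + T') :=
  let ⟨_, ht, h⟩ := h
  let ⟨_, ht', h'⟩ := h'
  ⟨_, by omega, .loop_true hb h h'⟩

end Compile

/-! ### Stacks, registers and elementary programs -/

/-- The names of the stacks that hold words. -/
inductive Tape
  | inp | bnd | voters | cost | col
  | lrem | lcov | lsel | mrem | mcov | msel | nrem | ncov | nsel
  | bcnt | bsel | aux | tmp | nil
  deriving DecidableEq

instance : Fintype Tape where
  elems := {.inp, .bnd, .voters, .cost, .col, .lrem, .lcov, .lsel, .mrem, .mcov, .msel,
    .nrem, .ncov, .nsel, .bcnt, .bsel, .aux, .tmp, .nil}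
  complete k := by cases k <;> decide

/-- The stacks: the input, the output, three scratch stacks of bits, and stacks of words. -/
inductive Stk
  | raw
  | out
  | scratch (t : Fin 3)
  | word (k : Tape)
  deriving DecidableEq, Fintype

/-- The stack alphabets; on a stack of words `none` marks the end of a word. -/
abbrev Alpha : Stk → Type
  | .raw => Computability.Γ'
  | .out => Bool
  | .scratch _ => Bool
  | .word _ => Option Bool

instance : ∀ k, Fintype (Alpha k)
  | .raw => inferInstanceAs (Fintype Computability.Γ')
  | .out => inferInstanceAs (Fintype Bool)
  | .scratch _ => inferInstanceAs (Fintype Bool)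
  | .word _ => inferInstanceAs (Fintype (Option Bool))

/-- The Boolean registers that persist between word operations. -/
structure Flags where
  q : Bool
  h : Bool
  e : Bool
  d : Bool
  deriving Fintype

/-- The registers: the flags and two symbols read from stacks. -/
abbrev Regs := Flags × Option Bool × Option Bool

/-- Assembling the contents of all stacks. -/
def stackFn (raw : List Computability.Γ') (out : List Bool) (g : Fin 3 → List Bool)
    (f : Tape → List (Option Bool)) : ∀ k, List (Alpha k)
  | .raw => raw
  | .out => out
  | .scratch t => g t
  | .word k => f k

section Stacks

variable (raw : List Computability.Γ') (out : List Bool) (g : Fin 3 → List Bool)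
  (f : Tape → List (Option Bool))

theorem update_stackFn_raw (v : List Computability.Γ') :
    update (stackFn raw out g f) .raw v = stackFn v out g f := by
  funext k
  cases k <;> rfl

theorem update_stackFn_out (v : List Bool) :
    update (stackFn raw out g f) .out v = stackFn raw v g f := by
  funext k
  cases k <;> rfl

theorem update_stackFn_scratch (t : Fin 3) (v : List Bool) :
    update (stackFn raw out g f) (.scratch t) v = stackFn raw out (update g t v) f := by
  funext k
  rcases eq_or_ne k (.scratch t) with rfl | h
  · rw [update_self]
    exact (update_self (β := fun _ => List Bool) t v g).symm
  · rw [update_of_ne h]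
    cases k with
    | scratch t' =>
      exact (update_of_ne (β := fun _ => List Bool) (fun h' => h (by rw [h'])) v g).symm
    | _ => rfl

theorem update_stackFn_word (k : Tape) (v : List (Option Bool)) :
    update (stackFn raw out g f) (.word k) v = stackFn raw out g (update f k v) := by
  funext k'
  rcases eq_or_ne k' (.word k) with rfl | h
  · rw [update_self]
    exact (update_self (β := fun _ => List (Option Bool)) k v f).symm
  · rw [update_of_ne h]
    cases k' with
    | word k' =>
      exact (update_of_ne (β := fun _ => List (Option Bool)) (fun h' => h (by rw [h'])) v f).symm
    | _ => rfl

end Stacks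

/-- Programs on these stacks. -/
abbrev WProg := Prog Alpha Regs

/-- Configurations on these stacks. -/
abbrev WCfg := Regs × (∀ k, List (Alpha k))

def load (f : Regs → Regs) : WProg := .act (.load f)

def pushWord (k : Tape) (f : Regs → Option Bool) : WProg := .act (.push (.word k) f)

def peekWord (k : Tape) (f : Regs → Option (Option Bool) → Regs) : WProg :=
  .act (.peek (.word k) f)

def popWord (k : Tape) (f : Regs → Option (Option Bool) → Regs) : WProg :=
  .act (.pop (.word k) f)

def pushScratch (t : Fin 3) (f : Regs → Bool) : WProg := .act (.push (.scratch t) f)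

def popScratch (t : Fin 3) (f : Regs → Option Bool → Regs) : WProg := .act (.pop (.scratch t) f)

def pushOut (f : Regs → Bool) : WProg := .act (.push .out f)

def popRaw (f : Regs → Option Computability.Γ' → Regs) : WProg := .act (.pop .raw f)

section Act

variable {raw : List Computability.Γ'} {out : List Bool} {g : Fin 3 → List Bool}
  {f : Tape → List (Option Bool)} (r : Regs)

theorem execIn_load (φ : Regs → Regs) (S : ∀ k, List (Alpha k)) :
    ExecIn (load φ) (r, S) (φ r, S) 1 :=
  ExecIn.act _ _

theorem execIn_pushWord (k : Tape) (φ : Regs → Option Bool) :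
    ExecIn (pushWord k φ) (r, stackFn raw out g f)
      (r, stackFn raw out g (update f k (φ r :: f k))) 1 := by
  rw [← update_stackFn_word]
  exact ExecIn.act _ _

theorem execIn_peekWord (k : Tape) (φ : Regs → Option (Option Bool) → Regs) :
    ExecIn (peekWord k φ) (r, stackFn raw out g f)
      (φ r (f k).head?, stackFn raw out g f) 1 :=
  ExecIn.act _ _

theorem execIn_popWord (k : Tape) (φ : Regs → Option (Option Bool) → Regs) :
    ExecIn (popWord k φ) (r, stackFn raw out g f)
      (φ r (f k).head?, stackFn raw out g (update f k (f k).tail)) 1 := by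
  rw [← update_stackFn_word]
  exact ExecIn.act _ _

theorem execIn_pushScratch (t : Fin 3) (φ : Regs → Bool) :
    ExecIn (pushScratch t φ) (r, stackFn raw out g f)
      (r, stackFn raw out (update g t (φ r :: g t)) f) 1 := by
  rw [← update_stackFn_scratch]
  exact ExecIn.act _ _

theorem execIn_popScratch (t : Fin 3) (φ : Regs → Option Bool → Regs) :
    ExecIn (popScratch t φ) (r, stackFn raw out g f)
      (φ r (g t).head?, stackFn raw out (update g t (g t).tail) f) 1 := by
  rw [← update_stackFn_scratch]
  exact ExecIn.act _ _

theorem execIn_pushOut (φ : Regs → Bool) :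
    ExecIn (pushOut φ) (r, stackFn raw out g f) (r, stackFn raw (φ r :: out) g f) 1 := by
  rw [← update_stackFn_out raw out g f (φ r :: out)]
  exact ExecIn.act _ _

theorem execIn_popRaw (φ : Regs → Option Computability.Γ' → Regs) :
    ExecIn (popRaw φ) (r, stackFn raw out g f)
      (φ r raw.head?, stackFn raw.tail out g f) 1 := by
  rw [← update_stackFn_raw raw out g f raw.tail]
  exact ExecIn.act _ _

end Act

/-- The bit on top of a stack of words goes to the first symbol register. -/
def readFst (k : Tape) : WProg :=
  .seq (peekWord k fun r o => (r.1, o.join, r.2.2))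
    (.ite (fun r => r.2.1.isSome) (popWord k fun r _ => r) (load id))

/-- The bit on top of a stack of words goes to the second symbol register. -/
def readSnd (k : Tape) : WProg :=
  .seq (peekWord k fun r o => (r.1, r.2.1, o.join))
    (.ite (fun r => r.2.2.isSome) (popWord k fun r _ => r) (load id))

/-- Moves a scratch stack onto a stack of words, bit by bit. -/
def flush (t : Fin 3) (k : Tape) : WProg :=
  .seq (popScratch t fun r o => (r.1, o, r.2.2))
    (.loop (fun r => r.2.1.isSome)
      (.seq (pushWord k fun r => r.2.1) (popScratch t fun r o => (r.1, o, r.2.2))))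

section Char

variable {raw : List Computability.Γ'} {out : List Bool} {g : Fin 3 → List Bool}
  {f : Tape → List (Option Bool)}

/-- The `join` sends both an empty stack and an end marker to `none`, and only a genuine bit is
popped. So the marker is never consumed, and a missing word behaves like an empty one; `hR` covers
both situations. -/
theorem execIn_readFst {k : Tape} {xs : List Bool} {R : List (Option Bool)}
    (hR : R.head?.join = none) (hf : f k = xs.map some ++ R) (fl : Flags) (a b : Option Bool) :
    ExecIn (readFst k) ((fl, a, b), stackFn raw out g f)
      ((fl, xs.head?, b), stackFn raw out g (update f k (xs.tail.map some ++ R))) 3 := by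
  refine (execIn_peekWord _ _ _).seq (T' := 2) (ExecIn.ite ?_)
  cases xs with
  | nil =>
    have h : f k = R := by simpa using hf
    have h2 : update f k R = f := by rw [← h, update_eq_self]
    simpa [h, hR, h2] using execIn_load (fl, none, b) id (stackFn raw out g f)
  | cons x xs =>
    simpa [hf] using execIn_popWord (f := f) (fl, some x, b) k fun r _ => r

theorem execIn_readSnd {k : Tape} {xs : List Bool} {R : List (Option Bool)}
    (hR : R.head?.join = none) (hf : f k = xs.map some ++ R) (fl : Flags) (a b : Option Bool) :
    ExecIn (readSnd k) ((fl, a, b), stackFn raw out g f)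
      ((fl, a, xs.head?), stackFn raw out g (update f k (xs.tail.map some ++ R))) 3 := by
  refine (execIn_peekWord _ _ _).seq (T' := 2) (ExecIn.ite ?_)
  cases xs with
  | nil =>
    have h : f k = R := by simpa using hf
    have h2 : update f k R = f := by rw [← h, update_eq_self]
    simpa [h, hR, h2] using execIn_load (fl, a, none) id (stackFn raw out g f)
  | cons x xs =>
    simpa [hf] using execIn_popWord (f := f) (fl, a, some x) k fun r _ => r

/-- Each bit costs a test, a push and a pop; the first pop and the last test account for the 2.
Scratch stacks collect words in reverse, so the reversal here restores them. -/
theorem execIn_flush (t : Fin 3) (k : Tape) (fl : Flags) :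
    ExecIn (flush t k) ((fl, none, none), stackFn raw out g f)
      ((fl, none, none),
        stackFn raw out (update g t []) (update f k ((g t).reverse.map some ++ f k)))
      (3 * (g t).length + 2) := by
  -- Inside the loop the head of the scratch word is in the register and only its tail is on the
  -- stack.
  have key : ∀ (A : List Bool) (f : Tape → List (Option Bool)),
      ExecIn (.loop (fun r => r.2.1.isSome)
        (.seq (pushWord k fun r => r.2.1) (popScratch t fun r o => (r.1, o, r.2.2))))
        ((fl, A.head?, none), stackFn raw out (update g t A.tail) f)
        ((fl, none, none), stackFn raw out (update g t [])
          (update f k (A.reverse.map some ++ f k))) (3 * A.length + 1) := by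
    intro A
    induction A with
    | nil =>
      intro f
      simpa using ExecIn.loop_false (Γ := Alpha)
        (c := ((fl, none, none), stackFn raw out (update g t []) f)) rfl
    | cons x A ih =>
      intro f
      have h1 := execIn_pushWord (raw := raw) (out := out) (g := update g t A) (f := f)
        (fl, some x, none) k fun r => r.2.1
      have h2 := execIn_popScratch (raw := raw) (out := out) (g := update g t A)
        (f := update f k (some x :: f k)) (fl, some x, none) t fun r o => (r.1, o, r.2.2)
      have h3 := ih (update f k (some x :: f k))
      simp only [update_self, update_idem] at h2 h3
      have h := (h1.seq h2).loop_true (b := fun r : Regs => r.2.1.isSome) rfl h3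
      simp only [List.length_cons, List.reverse_cons, List.map_append, List.map_cons, List.map_nil,
        List.append_assoc, List.cons_append, List.nil_append] at h ⊢
      exact h.mono (by omega)
  exact ((execIn_popScratch _ t fun r o => (r.1, o, r.2.2)).seq (key (g t) f)).mono (by omega)

end Char

/-! ### Transducers reading two words in lockstep -/

/-- The output and the final state of the transducer `φ` started in `q` on two words that are read
in lockstep, the shorter one being followed by blanks. -/
def transduce (φ : Bool → Option Bool → Option Bool → Bool × Bool) :
    Bool → List Bool → List Bool → List Bool × Bool
  | q, [], [] => ([], q)
  | q, x :: xs, [] =>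
    let r := transduce φ (φ q (some x) none).2 xs []
    ((φ q (some x) none).1 :: r.1, r.2)
  | q, [], y :: ys =>
    let r := transduce φ (φ q none (some y)).2 [] ys
    ((φ q none (some y)).1 :: r.1, r.2)
  | q, x :: xs, y :: ys =>
    let r := transduce φ (φ q (some x) (some y)).2 xs ys
    ((φ q (some x) (some y)).1 :: r.1, r.2)

/-- Merges the three recursive cases into the form the machine sees: heads in the registers, tails
on the stacks. -/
theorem transduce_of_ne (φ : Bool → Option Bool → Option Bool → Bool × Bool) (q : Bool)
    {xs ys : List Bool} (h : ¬(xs = [] ∧ ys = [])) :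
    transduce φ q xs ys =
      ((φ q xs.head? ys.head?).1 :: (transduce φ (φ q xs.head? ys.head?).2 xs.tail ys.tail).1,
        (transduce φ (φ q xs.head? ys.head?).2 xs.tail ys.tail).2) := by
  cases xs <;> cases ys <;> simp_all [transduce]

theorem length_transduce (φ : Bool → Option Bool → Option Bool → Bool × Bool) (q : Bool)
    (xs ys : List Bool) : (transduce φ q xs ys).1.length = max xs.length ys.length := by
  fun_induction transduce φ q xs ys <;> simp_all +zetaDelta

/-- One step of a transducer that keeps its inputs and its output on the scratch stacks. -/
def zipStep (i j : Tape) (φ : Bool → Option Bool → Option Bool → Bool × Bool) : WProg :=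
  .seq (.ite (fun r => r.2.1.isSome) (pushScratch 0 fun r => r.2.1.getD false) (load id))
    (.seq (.ite (fun r => r.2.2.isSome) (pushScratch 1 fun r => r.2.2.getD false) (load id))
      (.seq (pushScratch 2 fun r => (φ r.1.q r.2.1 r.2.2).1)
        (.seq (load fun r => ({ r.1 with q := (φ r.1.q r.2.1 r.2.2).2 }, r.2))
          (.seq (readFst i) (readSnd j)))))

/-- Runs a transducer on the two words on top of `i` and `j`, and pushes its output with a
header onto `k`. -/
def zipWords (i j k : Tape) (q₀ : Flags → Bool)
    (φ : Bool → Option Bool → Option Bool → Bool × Bool) (pre : List Bool) : WProg :=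
  .seq (pushWord k fun _ => none)
    (.seq (load fun r => ({ r.1 with q := q₀ r.1 }, r.2))
      (.seq (readFst i)
        (.seq (readSnd j)
          (.seq (.loop (fun r => r.2.1.isSome || r.2.2.isSome) (zipStep i j φ))
            (.seq (flush 0 i) (.seq (flush 1 j) (.seq (flush 2 k)
              (pre.reverse.foldr (fun b p => .seq (pushWord k fun _ => some b) p) (load id)))))))))

section Zip

variable {raw : List Computability.Γ'} {out : List Bool}

/-- The contents of the three scratch stacks. -/
def tri (A B Z : List Bool) : Fin 3 → List Bool := ![A, B, Z]

theorem tri_update_zero (A B Z v : List Bool) : update (tri A B Z) 0 v = tri v B Z := by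
  ext t; fin_cases t <;> rfl

theorem tri_update_one (A B Z v : List Bool) : update (tri A B Z) 1 v = tri A v Z := by
  ext t; fin_cases t <;> rfl

theorem tri_update_two (A B Z v : List Bool) : update (tri A B Z) 2 v = tri A B v := by
  ext t; fin_cases t <;> rfl

/-- The symbols read are saved on the first two scratch stacks so that the inputs can be restored
afterwards; the third collects the output. The 12 steps are 2 + 2 for the two conditional saves, 1 +
1 for output and state, and 3 + 3 for reading the next symbols. -/
theorem execIn_zipStep {i j : Tape} (hij : i ≠ j)
    (φ : Bool → Option Bool → Option Bool → Bool × Bool) {f : Tape → List (Option Bool)}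
    {xs ys : List Bool} {R R' : List (Option Bool)} (hR : R.head?.join = none)
    (hR' : R'.head?.join = none) (fl : Flags) (A B Z : List Bool) :
    ExecIn (zipStep i j φ)
      ((fl, xs.head?, ys.head?), stackFn raw out (tri A B Z)
        (update (update f i (xs.tail.map some ++ R)) j (ys.tail.map some ++ R')))
      (({ fl with q := (φ fl.q xs.head? ys.head?).2 }, xs.tail.head?, ys.tail.head?),
        stackFn raw out (tri (xs.head?.toList ++ A) (ys.head?.toList ++ B)
          ((φ fl.q xs.head? ys.head?).1 :: Z))
        (update (update f i (xs.tail.tail.map some ++ R)) j (ys.tail.tail.map some ++ R'))) 12 := by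
  set F := update (update f i (xs.tail.map some ++ R)) j (ys.tail.map some ++ R') with hF
  have hFi : F i = xs.tail.map some ++ R := by rw [hF, update_of_ne hij, update_self]
  have hFj : F j = ys.tail.map some ++ R' := by rw [hF, update_self]
  have h1 : ExecIn (.ite (fun r => r.2.1.isSome) (pushScratch 0 fun r => r.2.1.getD false)
      (load id)) ((fl, xs.head?, ys.head?), stackFn raw out (tri A B Z) F)
      ((fl, xs.head?, ys.head?), stackFn raw out (tri (xs.head?.toList ++ A) B Z) F) 2 := by
    refine ExecIn.ite (T := 1) ?_
    cases xs with
    | nil => exact execIn_load _ _ _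
    | cons x xs =>
      have h := execIn_pushScratch (raw := raw) (out := out) (g := tri A B Z) (f := F)
        (fl, some x, ys.head?) 0 fun r => r.2.1.getD false
      rwa [tri_update_zero] at h
  have h2 : ExecIn (.ite (fun r => r.2.2.isSome) (pushScratch 1 fun r => r.2.2.getD false)
      (load id))
      ((fl, xs.head?, ys.head?), stackFn raw out (tri (xs.head?.toList ++ A) B Z) F)
      ((fl, xs.head?, ys.head?),
        stackFn raw out (tri (xs.head?.toList ++ A) (ys.head?.toList ++ B) Z) F) 2 := by
    refine ExecIn.ite (T := 1) ?_
    cases ys with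
    | nil => exact execIn_load _ _ _
    | cons y ys =>
      have h := execIn_pushScratch (raw := raw) (out := out)
        (g := tri (xs.head?.toList ++ A) B Z) (f := F)
        (fl, xs.head?, some y) 1 fun r => r.2.2.getD false
      rwa [tri_update_one] at h
  have h3 : ExecIn (pushScratch 2 fun r => (φ r.1.q r.2.1 r.2.2).1)
      ((fl, xs.head?, ys.head?),
        stackFn raw out (tri (xs.head?.toList ++ A) (ys.head?.toList ++ B) Z) F)
      ((fl, xs.head?, ys.head?), stackFn raw out (tri (xs.head?.toList ++ A)
        (ys.head?.toList ++ B) ((φ fl.q xs.head? ys.head?).1 :: Z)) F) 1 := by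
    have h := execIn_pushScratch (raw := raw) (out := out)
      (g := tri (xs.head?.toList ++ A) (ys.head?.toList ++ B) Z) (f := F)
      (fl, xs.head?, ys.head?) 2 fun r => (φ r.1.q r.2.1 r.2.2).1
    rwa [tri_update_two] at h
  have h5 := execIn_readFst (raw := raw) (out := out) (f := F) (g := tri (xs.head?.toList ++ A)
    (ys.head?.toList ++ B) ((φ fl.q xs.head? ys.head?).1 :: Z)) hR hFi
    { fl with q := (φ fl.q xs.head? ys.head?).2 } xs.head? ys.head?
  have h6 := execIn_readSnd (raw := raw) (out := out)
    (f := update F i (xs.tail.tail.map some ++ R)) (g := tri (xs.head?.toList ++ A)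
    (ys.head?.toList ++ B) ((φ fl.q xs.head? ys.head?).1 :: Z)) hR'
    ((update_of_ne hij.symm _ _).trans hFj)
    { fl with q := (φ fl.q xs.head? ys.head?).2 } xs.tail.head? ys.head?
  have hF' : update (update F i (xs.tail.tail.map some ++ R)) j (ys.tail.tail.map some ++ R') =
      update (update f i (xs.tail.tail.map some ++ R)) j (ys.tail.tail.map some ++ R') := by
    rw [hF, update_comm hij.symm, update_idem, update_idem]
  rw [hF'] at h6
  exact h1.seq (h2.seq (h3.seq ((execIn_load (fl, xs.head?, ys.head?)
    (fun r => ({ r.1 with q := (φ r.1.q r.2.1 r.2.2).2 }, r.2)) _).seq (h5.seq h6))))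

/-- Induction on the number of rounds, which is the length of the longer word; a round is a test and
a `zipStep`. -/
theorem execIn_zipLoop {i j : Tape} (hij : i ≠ j)
    (φ : Bool → Option Bool → Option Bool → Bool × Bool) {f : Tape → List (Option Bool)}
    {R R' : List (Option Bool)} (hR : R.head?.join = none)
    (hR' : R'.head?.join = none) (n : ℕ) : ∀ (xs ys : List Bool) (fl : Flags) (A B Z : List Bool),
    max xs.length ys.length = n →
    ExecIn (.loop (fun r => r.2.1.isSome || r.2.2.isSome) (zipStep i j φ))
      ((fl, xs.head?, ys.head?), stackFn raw out (tri A B Z)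
        (update (update f i (xs.tail.map some ++ R)) j (ys.tail.map some ++ R')))
      (({ fl with q := (transduce φ fl.q xs ys).2 }, none, none),
        stackFn raw out (tri (xs.reverse ++ A) (ys.reverse ++ B)
          ((transduce φ fl.q xs ys).1.reverse ++ Z))
        (update (update f i R) j R')) (13 * n + 1) := by
  induction n with
  | zero =>
    intro xs ys fl A B Z h
    obtain rfl : xs = [] := List.length_eq_zero_iff.1 (by omega)
    obtain rfl : ys = [] := List.length_eq_zero_iff.1 (by omega)
    simpa [transduce] using ExecIn.loop_false (Γ := Alpha) rfl
  | succ n ih =>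
    intro xs ys fl A B Z h
    have hne : ¬(xs = [] ∧ ys = []) := by
      rintro ⟨rfl, rfl⟩
      simp at h
    rw [transduce_of_ne φ _ hne]
    have h1 := execIn_zipStep (raw := raw) (out := out) hij φ (f := f) (xs := xs) (ys := ys)
      hR hR' fl A B Z
    have h2 := ih xs.tail ys.tail { fl with q := (φ fl.q xs.head? ys.head?).2 }
      (xs.head?.toList ++ A) (ys.head?.toList ++ B) ((φ fl.q xs.head? ys.head?).1 :: Z)
      (by simp only [List.length_tail]; omega)
    have h3 := h1.loop_true (b := fun r : Regs => r.2.1.isSome || r.2.2.isSome)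
      (by cases xs <;> cases ys <;> simp_all) h2
    have hx : ∀ (l A : List Bool), l.tail.reverse ++ (l.head?.toList ++ A) = l.reverse ++ A := by
      intro l A
      cases l <;> simp
    simp only [hx] at h3
    simpa using h3.mono (by omega)

end Zip

/-! ### Stacks of words and operations on them -/

/-- The encoding of a list of words on a stack of words. -/
def enc (ws : List (List Bool)) : List (Option Bool) :=
  ws.flatMap fun w => w.map some ++ [none]

/-- What lies below the first word on a stack of words. -/
def encTail : List (List Bool) → List (Option Bool)
  | [] => []
  | _ :: ws => none :: enc ws

theorem enc_eq (ws : List (List Bool)) : enc ws = (ws.headD []).map some ++ encTail ws := by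
  cases ws <;> simp [enc, encTail]

theorem encTail_terminated (ws : List (List Bool)) : (encTail ws).head?.join = none := by
  cases ws <;> rfl

theorem enc_cons (w : List Bool) (ws : List (List Bool)) :
    enc (w :: ws) = w.map some ++ none :: enc ws := by
  simp [enc]

theorem update_enc (ω : Tape → List (List Bool)) (k : Tape) (ws : List (List Bool)) :
    update (fun k => enc (ω k)) k (enc ws) = fun k' => enc (update ω k ws k') := by
  funext k'
  rcases eq_or_ne k' k with rfl | h <;> simp [*]

/-- A state at the level of words. -/
structure WState where
  fl : Flags
  ω : Tape → List (List Bool)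
  out : List Bool

/-- The configuration that represents a state. -/
def WState.cfg (s : WState) : WCfg :=
  ((s.fl, none, none), stackFn [] s.out (tri [] [] []) fun k => enc (s.ω k))

/-- All words of the state have length at most `N`. -/
def WState.Bounded (s : WState) (N : ℕ) : Prop :=
  ∀ k, ∀ w ∈ s.ω k, w.length ≤ N

/-- Operations on states. -/
inductive Op
  | zip (i j k : Tape) (q₀ : Flags → Bool) (φ : Bool → Option Bool → Option Bool → Bool × Bool)
      (pre : List Bool)
  | drop (i : Tape)
  | new (i : Tape)
  | uncons (i : Tape)
  | test (i : Tape)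
  | flags (u : Flags → Flags)
  | emit (u : Flags → Bool)

/-- The effect of an operation. -/
def Op.run : Op → WState → WState
  | .zip i j k q₀ φ pre, s =>
    let r := transduce φ (q₀ s.fl) ((s.ω i).headD []) ((s.ω j).headD [])
    ⟨{ s.fl with q := r.2 }, update s.ω k ((pre ++ r.1) :: s.ω k), s.out⟩
  | .drop i, s => ⟨s.fl, update s.ω i (s.ω i).tail, s.out⟩
  | .new i, s => ⟨s.fl, update s.ω i ([] :: s.ω i), s.out⟩
  | .uncons i, s =>
    ⟨{ s.fl with h := ((s.ω i).headD []).head?.isSome, e := ((s.ω i).headD []).headD false },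
      update s.ω i ((s.ω i).modifyHead List.tail), s.out⟩
  | .test i, s => ⟨{ s.fl with h := !(s.ω i).isEmpty }, s.ω, s.out⟩
  | .flags u, s => ⟨u s.fl, s.ω, s.out⟩
  | .emit u, s => ⟨s.fl, s.ω, u s.fl :: s.out⟩

/-- Removes the word on top of a stack of words. -/
def dropWord (i : Tape) : WProg :=
  .seq (popWord i fun r o => (r.1, o.join, none))
    (.loop (fun r => r.2.1.isSome) (popWord i fun r o => (r.1, o.join, none)))

/-- The program of an operation. -/
def Op.prog : Op → WProg
  | .zip i j k q₀ φ pre => zipWords i j k q₀ φ pre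
  | .drop i => dropWord i
  | .new i => pushWord i fun _ => none
  | .uncons i => .seq (readFst i)
      (load fun r => ({ r.1 with h := r.2.1.isSome, e := r.2.1.getD false }, none, none))
  | .test i => peekWord i fun r o => ({ r.1 with h := o.isSome }, none, none)
  | .flags u => load fun r => (u r.1, r.2)
  | .emit u => pushOut fun r => u r.1

/-- The stacks of an operation are distinct and its header is short. -/
def Op.Ok : Op → Prop
  | .zip i j k _ _ pre => i ≠ j ∧ i ≠ k ∧ j ≠ k ∧ pre.length ≤ 1
  | _ => True

theorem execIn_dropWord {raw : List Computability.Γ'} {out : List Bool} {g : Fin 3 → List Bool}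
    (i : Tape) (fl : Flags) (ws : List (List Bool)) (f : Tape → List (Option Bool))
    (hf : f i = enc ws) : ExecIn (dropWord i) ((fl, none, none), stackFn raw out g f)
      ((fl, none, none), stackFn raw out g (update f i (enc ws.tail)))
      (2 * (ws.headD []).length + 2) := by
  -- After the first pop the program is inside its loop with a bit in the register, so the induction
  -- has to treat that situation alongside the whole program.
  have key : ∀ (xs : List Bool) (f : Tape → List (Option Bool)),
      f i = xs.map some ++ encTail ws →
      ExecIn (dropWord i) ((fl, none, none), stackFn raw out g f)
        ((fl, none, none), stackFn raw out g (update f i (enc ws.tail))) (2 * xs.length + 2) ∧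
      ∀ b, ExecIn (.loop (fun r => r.2.1.isSome) (popWord i fun r o => (r.1, o.join, none)))
        ((fl, some b, none), stackFn raw out g f)
        ((fl, none, none), stackFn raw out g (update f i (enc ws.tail))) (2 * xs.length + 3) := by
    intro xs
    induction xs with
    | nil =>
      intro f hf
      have h1 : ∀ b, ExecIn (popWord i fun r o => (r.1, o.join, none))
          ((fl, b, none), stackFn raw out g f)
          ((fl, none, none), stackFn raw out g (update f i (enc ws.tail))) 1 := by
        intro b
        have h := execIn_popWord (raw := raw) (out := out) (g := g) (f := f) (fl, b, none) i
          fun r o => (r.1, o.join, none)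
        simp only [hf, List.map_nil, List.nil_append, encTail_terminated] at h
        convert h using 5
        cases ws <;> rfl
      exact ⟨(h1 none).seq (.loop_false rfl),
        fun b => ((h1 _).loop_true (b := fun r : Regs => r.2.1.isSome) rfl (.loop_false rfl))⟩
    | cons x xs ih =>
      intro f hf
      have h1 : ∀ b, ExecIn (popWord i fun r o => (r.1, o.join, none))
          ((fl, b, none), stackFn raw out g f)
          ((fl, some x, none), stackFn raw out g
            (update f i (xs.map some ++ encTail ws))) 1 := by
        intro b
        simpa [hf] using execIn_popWord (raw := raw) (out := out) (g := g) (f := f)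
          (fl, b, none) i fun r o => (r.1, o.join, none)
      have h2 := (ih (update f i (xs.map some ++ encTail ws)) (update_self ..)).2 x
      rw [update_idem] at h2
      exact ⟨((h1 none).seq h2).mono (by simp only [List.length_cons]; omega), fun b =>
        ((h1 _).loop_true (b := fun r : Regs => r.2.1.isSome) rfl h2).mono
          (by simp only [List.length_cons]; omega)⟩
  exact (key (ws.headD []) f (hf.trans (enc_eq ws))).1

theorem execIn_pushPrefix {raw : List Computability.Γ'} {out : List Bool} {g : Fin 3 → List Bool}
    (k : Tape) (r : Regs) (f : Tape → List (Option Bool)) (pre : List Bool) :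
    ExecIn (pre.reverse.foldr (fun b p => .seq (pushWord k fun _ => some b) p) (load id))
      (r, stackFn raw out g f) (r, stackFn raw out g (update f k (pre.map some ++ f k)))
      (pre.length + 1) := by
  induction pre using List.reverseRecOn generalizing f with
  | nil => simpa using execIn_load r id (stackFn raw out g f)
  | append_singleton pre b ih =>
    have h := (execIn_pushWord (raw := raw) (out := out) (g := g) (f := f) r k
      fun _ => some b).seq (ih _)
    simp only [update_idem, update_self] at h
    simpa using h.mono (by omega)

/-- The end marker goes onto `k` first, and the output is flushed onto it only after both inputs
have been restored. The coefficient 22 is 13 for the loop and 3 for each of the three flushes. -/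
theorem execIn_zipWords {out : List Bool} {i j k : Tape} (hij : i ≠ j) (hik : i ≠ k) (hjk : j ≠ k)
    (q₀ : Flags → Bool) (φ : Bool → Option Bool → Option Bool → Bool × Bool) (pre : List Bool)
    (fl : Flags) (ω : Tape → List (List Bool)) {N : ℕ}
    (hi : ((ω i).headD []).length ≤ N) (hj : ((ω j).headD []).length ≤ N) :
    ExecIn (zipWords i j k q₀ φ pre)
      ((fl, none, none), stackFn [] out (tri [] [] []) fun k => enc (ω k))
      (({ fl with q := (transduce φ (q₀ fl) ((ω i).headD []) ((ω j).headD [])).2 }, none, none),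
        stackFn [] out (tri [] [] []) fun k' => enc (update ω k
          ((pre ++ (transduce φ (q₀ fl) ((ω i).headD []) ((ω j).headD [])).1) :: ω k) k'))
      (22 * N + pre.length + 16) := by
  set xs := (ω i).headD [] with hxs
  set ys := (ω j).headD [] with hys
  set r := transduce φ (q₀ fl) xs ys with hr
  set F : Tape → List (Option Bool) := fun k => enc (ω k) with hF
  have hlen : r.1.length ≤ N := by rw [hr, length_transduce]; omega
  have e1 := execIn_pushWord (raw := []) (out := out) (g := tri [] [] []) (f := F)
    (fl, none, none) k fun _ => none
  set F1 := update F k (none :: F k) with hF1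
  have e2 := execIn_load (fl, none, none) (fun r => ({ r.1 with q := q₀ r.1 }, r.2))
    (stackFn [] out (tri [] [] []) F1)
  have hFi : F1 i = xs.map some ++ encTail (ω i) := by
    rw [hF1, update_of_ne hik]; exact enc_eq _
  have hFj : F1 j = ys.map some ++ encTail (ω j) := by
    rw [hF1, update_of_ne hjk]; exact enc_eq _
  have e3 := execIn_readFst (raw := []) (out := out) (g := tri [] [] []) (f := F1)
    (encTail_terminated (ω i)) hFi { fl with q := q₀ fl } none none
  have e4 := execIn_readSnd (raw := []) (out := out) (g := tri [] [] [])
    (f := update F1 i (xs.tail.map some ++ encTail (ω i)))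
    (encTail_terminated (ω j)) ((update_of_ne hij.symm _ _).trans hFj)
    { fl with q := q₀ fl } xs.head? none
  have e5 := execIn_zipLoop (raw := []) (out := out) (f := F1) hij φ (encTail_terminated (ω i))
    (encTail_terminated (ω j)) (max xs.length ys.length) xs ys { fl with q := q₀ fl } [] [] [] rfl
  simp only [List.append_nil, ← hr] at e5
  set F2 := update (update F1 i (encTail (ω i))) j (encTail (ω j)) with hF2
  have e6 := execIn_flush (raw := []) (out := out)
    (g := tri xs.reverse ys.reverse r.1.reverse) (f := F2) 0 i { fl with q := r.2 }
  have e7 := execIn_flush (raw := []) (out := out) (g := tri [] ys.reverse r.1.reverse)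
    (f := update F2 i (xs.map some ++ F2 i)) 1 j { fl with q := r.2 }
  have e8 := execIn_flush (raw := []) (out := out) (g := tri [] [] r.1.reverse)
    (f := update (update F2 i (xs.map some ++ F2 i)) j (ys.map some ++ F2 j)) 2 k
    { fl with q := r.2 }
  have h0 : ∀ A B Z, tri A B Z 0 = A := fun _ _ _ => rfl
  have h1 : ∀ A B Z, tri A B Z 1 = B := fun _ _ _ => rfl
  have h2 : ∀ A B Z, tri A B Z 2 = Z := fun _ _ _ => rfl
  have hF2i : F2 i = encTail (ω i) := by rw [hF2, update_of_ne hij, update_self]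
  have hF2j : F2 j = encTail (ω j) := by rw [hF2, update_self]
  have hF3 : update (update F2 i (xs.map some ++ F2 i)) j (ys.map some ++ F2 j) = F1 := by
    rw [hF2i, hF2j, ← hFi, ← hFj, hF2, update_comm hij.symm, update_idem, update_idem,
      update_eq_self, update_eq_self]
  simp only [h0, h1, h2, tri_update_zero, tri_update_one, tri_update_two, List.reverse_reverse,
    hF3, update_of_ne hij.symm] at e6 e7 e8
  have e9 := execIn_pushPrefix (raw := []) (out := out) (g := tri [] [] [])
    k ({ fl with q := r.2 }, none, none) (update F1 k (r.1.map some ++ F1 k)) pre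
  have hend : update (update F1 k (r.1.map some ++ F1 k)) k
      (pre.map some ++ update F1 k (r.1.map some ++ F1 k) k) =
      fun k' => enc (update ω k ((pre ++ r.1) :: ω k) k') := by
    rw [← update_enc, update_idem, update_self, hF1, update_idem, update_self, enc_cons]
    simp [hF]
  rw [hend] at e9
  refine (e1.seq (e2.seq (e3.seq (e4.seq (e5.seq (e6.seq (e7.seq (e8.seq e9)))))))).mono ?_
  simp only [List.length_reverse]
  omega

/-- One bound for all operations: the dearest is `zip`, whose 22 * N + 16 steps grow by its header
of length at most 1. -/
theorem Op.execIn_prog (o : Op) (ho : o.Ok) (s : WState) {N : ℕ} (hs : s.Bounded N) :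
    ExecIn o.prog s.cfg (o.run s).cfg (22 * N + 17) := by
  have hd : ∀ k, ((s.ω k).headD []).length ≤ N := by
    intro k
    cases h : s.ω k with
    | nil => simp
    | cons w ws => exact hs k w (by simp [h])
  cases o with
  | zip i j k q₀ φ pre =>
    obtain ⟨hij, hik, hjk, hp⟩ := ho
    exact (execIn_zipWords hij hik hjk q₀ φ pre s.fl s.ω (hd i) (hd j)).mono (by omega)
  | drop i =>
    have h := execIn_dropWord (raw := []) (out := s.out) (g := tri [] [] []) i s.fl (s.ω i)
      (fun k => enc (s.ω k)) rfl
    rw [update_enc] at h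
    exact h.mono (by have := hd i; omega)
  | new i =>
    have h := execIn_pushWord (raw := []) (out := s.out) (g := tri [] [] [])
      (f := fun k => enc (s.ω k)) (s.fl, none, none) i fun _ => none
    rw [show none :: enc (s.ω i) = enc ([] :: s.ω i) from rfl, update_enc] at h
    exact h.mono (by omega)
  | uncons i =>
    have h1 := execIn_readFst (raw := []) (out := s.out) (g := tri [] [] [])
      (f := fun k => enc (s.ω k)) (encTail_terminated _) (enc_eq (s.ω i)) s.fl none none
    have h2 := execIn_load (s.fl, ((s.ω i).headD []).head?, none) (fun r =>
      ({ r.1 with h := r.2.1.isSome, e := r.2.1.getD false }, none, none))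
      (stackFn [] s.out (tri [] [] [])
        (update (fun k => enc (s.ω k)) i (((s.ω i).headD []).tail.map some ++ encTail (s.ω i))))
    have h3 : ((s.ω i).headD []).tail.map some ++ encTail (s.ω i) =
        enc ((s.ω i).modifyHead List.tail) := by
      cases s.ω i <;> simp [enc, encTail]
    have h4 : ((s.ω i).headD []).head?.getD false = ((s.ω i).headD []).headD false := by
      simp
    have h := h1.seq h2
    simp only [h3, update_enc, h4] at h
    exact h.mono (by omega)
  | test i =>
    have h := execIn_peekWord (raw := []) (out := s.out) (g := tri [] [] [])
      (f := fun k => enc (s.ω k)) (s.fl, none, none) i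
      fun r o => ({ r.1 with h := o.isSome }, none, none)
    have h3 : (enc (s.ω i)).head?.isSome = !(s.ω i).isEmpty := by
      cases s.ω i with
      | nil => rfl
      | cons w ws => cases w <;> simp [enc]
    simp only [h3] at h
    exact h.mono (by omega)
  | flags u => exact (execIn_load (s.fl, none, none) (fun r => (u r.1, r.2)) _).mono (by omega)
  | emit u => exact (execIn_pushOut (s.fl, none, none) fun r => u r.1).mono (by omega)

/-- Only the header of a `zip` can make a word longer than all present ones, and it has at most one
bit. -/
theorem Op.bounded_run (o : Op) (ho : o.Ok) (s : WState) {N : ℕ} (hs : s.Bounded N) :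
    (o.run s).Bounded (N + 1) := by
  have hd : ∀ k, ((s.ω k).headD []).length ≤ N := by
    intro k
    cases h : s.ω k with
    | nil => simp
    | cons w ws => exact hs k w (by simp [h])
  have key : ∀ k (ws : List (List Bool)), (∀ w ∈ ws, w.length ≤ N + 1) →
      ∀ k', ∀ w ∈ update s.ω k ws k', w.length ≤ N + 1 := by
    intro k ws hws k' w hw
    rcases eq_or_ne k' k with rfl | h
    · rw [update_self] at hw
      exact hws w hw
    · rw [update_of_ne h] at hw
      exact (hs k' w hw).trans (Nat.le_succ N)
  cases o with
  | zip i j k q₀ φ pre =>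
    refine key k _ fun w hw => ?_
    rcases List.mem_cons.1 hw with rfl | hw
    · have := ho.2.2.2
      have := hd i
      have := hd j
      rw [List.length_append, length_transduce]
      omega
    · exact (hs k w hw).trans (Nat.le_succ N)
  | drop i => exact key i _ fun w hw => (hs i w (List.mem_of_mem_tail hw)).trans (Nat.le_succ N)
  | new i =>
    refine key i _ fun w hw => ?_
    rcases List.mem_cons.1 hw with rfl | hw
    · simp
    · exact (hs i w hw).trans (Nat.le_succ N)
  | uncons i =>
    refine key i _ fun w hw => ?_
    have := hs i
    cases h : s.ω i with
    | nil => simp [h] at hw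
    | cons x ws =>
      simp only [h, List.modifyHead_cons, List.mem_cons] at hw this
      rcases hw with rfl | hw
      · have := this x (.inl rfl)
        simp only [List.length_tail]
        omega
      · exact (this w (.inr hw)).trans (Nat.le_succ N)
  | test i => exact fun k w hw => (hs k w hw).trans (Nat.le_succ N)
  | flags u => exact fun k w hw => (hs k w hw).trans (Nat.le_succ N)
  | emit u => exact fun k w hw => (hs k w hw).trans (Nat.le_succ N)

/-- A sequence of operations. -/
def block : List Op → WProg
  | [] => load id
  | o :: os => .seq o.prog (block os)

/-- The effect of a sequence of operations. -/
def runs : List Op → WState → WState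
  | [], s => s
  | o :: os, s => runs os (o.run s)

/-- Words gain at most one bit per operation, so all of them stay within `N + os.length`. The extra
1 in the first factor pays for the final `load id`. -/
theorem execIn_block {os : List Op} (hos : ∀ o ∈ os, o.Ok) {s : WState} {N : ℕ}
    (hs : s.Bounded N) : ExecIn (block os) s.cfg (runs os s).cfg
      ((os.length + 1) * (22 * (N + os.length) + 17)) := by
  induction os generalizing s N with
  | nil => exact (execIn_load _ _ _).mono (by simp)
  | cons o os ih =>
    have ho := hos o (by simp)
    refine ((o.execIn_prog ho s hs).seq
      (ih (fun o h => hos o (by simp [h])) (o.bounded_run ho s hs))).mono ?_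
    simp only [List.length_cons]
    nlinarith

/-! ### Hoare triples with time bounds -/

/-- From every state with `P` the program reaches a state with `Q` in at most `t` steps. -/
def Triple (P : WState → Prop) (p : WProg) (Q : WState → Prop) (t : ℕ) : Prop :=
  ∀ s, P s → ∃ s', Q s' ∧ ExecIn p s.cfg s'.cfg t

theorem Triple.seq {P Q R : WState → Prop} {p q : WProg} {t t' : ℕ} (h : Triple P p Q t)
    (h' : Triple Q q R t') : Triple P (.seq p q) R (t + t') := fun s hs =>
  let ⟨_, h1, h2⟩ := h s hs
  let ⟨s'', h3, h4⟩ := h' _ h1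
  ⟨s'', h3, h2.seq h4⟩

theorem Triple.mono {P Q : WState → Prop} {p : WProg} {t t' : ℕ} (h : Triple P p Q t)
    (ht : t ≤ t') : Triple P p Q t' := fun s hs =>
  let ⟨s', h1, h2⟩ := h s hs
  ⟨s', h1, h2.mono ht⟩

theorem Triple.block {P Q : WState → Prop} {os : List Op} {N : ℕ} (hos : ∀ o ∈ os, o.Ok)
    (hb : ∀ s, P s → s.Bounded N) (h : ∀ s, P s → Q (runs os s)) :
    Triple P (block os) Q ((os.length + 1) * (22 * (N + os.length) + 17)) := fun s hs =>
  ⟨_, h s hs, execIn_block hos (hb s hs)⟩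

theorem Triple.ite {P Q : WState → Prop} {p q : WProg} {b : Flags → Bool} {t : ℕ}
    (h : Triple (fun s => P s ∧ b s.fl = true) p Q t)
    (h' : Triple (fun s => P s ∧ b s.fl = false) q Q t) :
    Triple P (.ite (fun r => b r.1) p q) Q (t + 1) := by
  intro s hs
  by_cases hb : b s.fl = true
  · obtain ⟨s', h1, h2⟩ := h s ⟨hs, hb⟩
    exact ⟨s', h1, .ite (by simpa [WState.cfg, hb] using h2)⟩
  · obtain ⟨s', h1, h2⟩ := h' s ⟨hs, by simpa using hb⟩
    exact ⟨s', h1, .ite (by simpa [WState.cfg, hb] using h2)⟩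

/-- A loop that runs while the flag `h` is set. -/
def whileH (p : WProg) : WProg := .loop (fun r => r.1.h) p

/-- The loop rule for a loop with a fixed number of rounds. -/
theorem Triple.whileH {P : ℕ → WState → Prop} {p : WProg} {t : ℕ}
    (hP : ∀ n s, P n s → s.fl.h = decide (n ≠ 0))
    (h : ∀ n, Triple (P (n + 1)) p (P n) t) (n : ℕ) :
    Triple (P n) (whileH p) (P 0) (n * (t + 1) + 1) := by
  induction n with
  | zero =>
    exact fun s hs =>
      ⟨s, hs, (ExecIn.loop_false (by simpa [WState.cfg] using hP 0 s hs)).mono (by simp)⟩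
  | succ n ih =>
    intro s hs
    obtain ⟨s', h1, h2⟩ := h n s hs
    obtain ⟨s'', h3, h4⟩ := ih s' h1
    refine ⟨s'', h3, (ExecIn.loop_true (by simpa [WState.cfg] using hP _ s hs) h2 h4).mono ?_⟩
    rw [Nat.succ_mul]
    omega

/-- Repeats a program while a stack of words is not empty. -/
def forEach (i : Tape) (p : WProg) : WProg :=
  .seq (Op.test i).prog (whileH (.seq p (Op.test i).prog))

/-- The emptiness test overwrites the flag `h`, so `P` must not depend on it; this is `hfl`. Per
round, the 2 are the loop branch and the emptiness test; the final 2 are the first emptiness test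
and the last branch. -/
theorem Triple.forEach {P : ℕ → WState → Prop} {p : WProg} {t : ℕ} {i : Tape}
    (hne : ∀ n s, P n s → (s.ω i = [] ↔ n = 0))
    (hfl : ∀ n s b, P n s → P n ⟨{ s.fl with h := b }, s.ω, s.out⟩)
    (h : ∀ n, Triple (P (n + 1)) p (P n) t) (n : ℕ) :
    Triple (P n) (forEach i p) (P 0) (n * (t + 2) + 2) := by
  have htest : ∀ n, Triple (P n) (Op.test i).prog
      (fun s => P n s ∧ s.fl.h = decide (n ≠ 0)) 1 := by
    intro n s hs
    refine ⟨(Op.test i).run s, ⟨hfl n s _ hs, ?_⟩, ?_⟩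
    · have := hne n s hs
      cases h : s.ω i <;> simp_all [Op.run]
    · have h := execIn_peekWord (raw := []) (out := s.out) (g := tri [] [] [])
        (f := fun k => enc (s.ω k)) (s.fl, none, none) i
        fun r o => ({ r.1 with h := o.isSome }, none, none)
      have h3 : (enc (s.ω i)).head?.isSome = !(s.ω i).isEmpty := by
        cases s.ω i with
        | nil => rfl
        | cons w ws => cases w <;> simp [enc]
      simp only [h3] at h
      exact h
  have hbody : ∀ n, Triple (fun s => P (n + 1) s ∧ s.fl.h = decide (n + 1 ≠ 0))
      (.seq p (Op.test i).prog) (fun s => P n s ∧ s.fl.h = decide (n ≠ 0)) (t + 1) :=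
    fun n => Triple.seq (fun s hs => h n s hs.1) (htest n)
  have := (htest n).seq (Triple.whileH (P := fun n s => P n s ∧ s.fl.h = decide (n ≠ 0))
    (fun n s hs => hs.2) hbody n)
  intro s hs
  obtain ⟨s', h1, h2⟩ := this s hs
  exact ⟨s', h1.1, h2.mono (le_of_eq (by ring))⟩

/-! ### Arithmetic and comparison by transducers -/

/-- Binary subtraction: the state is the borrow. -/
def subT (q : Bool) (a b : Option Bool) : Bool × Bool :=
  (a.getD false ^^ b.getD false ^^ q,
    (!a.getD false && b.getD false) || ((!a.getD false || b.getD false) && q))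

/-- Disjunction. -/
def orT (q : Bool) (a b : Option Bool) : Bool × Bool := (a.getD false || b.getD false, q)

/-- Projection to the first word. -/
def fstT (q : Bool) (a _ : Option Bool) : Bool × Bool := (a.getD false, q)

/-- Comparison: the state tells whether the words agree so far. -/
def eqT (q : Bool) (a b : Option Bool) : Bool × Bool := (false, q && a == b)

/-- The zero word. -/
def zeroT (q : Bool) (_ _ : Option Bool) : Bool × Bool := (false, q)

/-- Addition of a carry. -/
def incT (q : Bool) (a _ : Option Bool) : Bool × Bool := (a.getD false ^^ q, a.getD false && q)

/-- The difference of two binary numbers. -/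
def wsub (x y : List Bool) : List Bool := (transduce subT false x y).1

/-- Whether a binary number is less than another one. -/
def wlt (x y : List Bool) : Bool := (transduce subT false x y).2

/-- The bitwise disjunction of two words. -/
def wor (x y : List Bool) : List Bool := (transduce orT false x y).1

/-- Whether two words are equal. -/
def weq (x y : List Bool) : Bool := (transduce eqT true x y).2

/-- A word plus a carry, on at least as many bits as the second word has. -/
def winc (c : Bool) (x y : List Bool) : List Bool := (transduce incT c x y).1

/-- Run against the always empty stack `nil`, the projection copies a word. -/
theorem transduce_fstT (q : Bool) (x : List Bool) : transduce fstT q x [] = (x, q) := by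
  induction x with
  | nil => simp [transduce]
  | cons b x ih => simp [transduce, fstT, ih]

theorem transduce_zeroT (q : Bool) (x : List Bool) :
    (transduce zeroT q x []).1 = List.replicate x.length false := by
  induction x with
  | nil => simp [transduce]
  | cons b x ih => simp [transduce, zeroT, ih, List.replicate_succ]

theorem length_wsub (x y : List Bool) : (wsub x y).length = max x.length y.length :=
  length_transduce ..

theorem length_wor (x y : List Bool) : (wor x y).length = max x.length y.length :=
  length_transduce ..

theorem length_winc (c : Bool) (x y : List Bool) :
    (winc c x y).length = max x.length y.length :=
  length_transduce ..

/-! ### Candidates and the memory of the machine -/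

/-- A candidate: the remaining budget, the covered voters, and the selected items. -/
structure Cand where
  rem : List Bool
  cov : List Bool
  sel : List Bool

/-- The contents of the stacks of words, with three tables of candidates. -/
structure Mem where
  inp : List (List Bool) := []
  bnd : List (List Bool) := []
  voters : List (List Bool) := []
  cost : List (List Bool) := []
  col : List (List Bool) := []
  L : List Cand := []
  M : List Cand := []
  R : List Cand := []
  bcnt : List (List Bool) := []
  bsel : List (List Bool) := []
  aux : List (List Bool) := []
  tmp : List (List Bool) := []

/-- The stacks of words as a function. -/
def Mem.ω (m : Mem) : Tape → List (List Bool)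
  | .inp => m.inp
  | .bnd => m.bnd
  | .voters => m.voters
  | .cost => m.cost
  | .col => m.col
  | .lrem => m.L.map Cand.rem
  | .lcov => m.L.map Cand.cov
  | .lsel => m.L.map Cand.sel
  | .mrem => m.M.map Cand.rem
  | .mcov => m.M.map Cand.cov
  | .msel => m.M.map Cand.sel
  | .nrem => m.R.map Cand.rem
  | .ncov => m.R.map Cand.cov
  | .nsel => m.R.map Cand.sel
  | .bcnt => m.bcnt
  | .bsel => m.bsel
  | .aux => m.aux
  | .tmp => m.tmp
  | .nil => []

/-- The words of a candidate have length at most `N`. -/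
def Cand.Bounded (N : ℕ) (x : Cand) : Prop :=
  x.rem.length ≤ N ∧ x.cov.length ≤ N ∧ x.sel.length ≤ N

/-- All words have length at most `N`. -/
structure Mem.Bounded (N : ℕ) (m : Mem) : Prop where
  inp : ∀ w ∈ m.inp, w.length ≤ N
  bnd : ∀ w ∈ m.bnd, w.length ≤ N
  voters : ∀ w ∈ m.voters, w.length ≤ N
  cost : ∀ w ∈ m.cost, w.length ≤ N
  col : ∀ w ∈ m.col, w.length ≤ N
  L : ∀ x ∈ m.L, x.Bounded N
  M : ∀ x ∈ m.M, x.Bounded N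
  R : ∀ x ∈ m.R, x.Bounded N
  bcnt : ∀ w ∈ m.bcnt, w.length ≤ N
  bsel : ∀ w ∈ m.bsel, w.length ≤ N
  aux : ∀ w ∈ m.aux, w.length ≤ N
  tmp : ∀ w ∈ m.tmp, w.length ≤ N

/-- The state has the given stacks of words and no output. -/
def At (m : Mem) (s : WState) : Prop := s.ω = m.ω ∧ s.out = []

theorem Mem.Bounded.state {m : Mem} {s : WState} {N : ℕ} (hm : m.Bounded N) (h : s.ω = m.ω) :
    s.Bounded N := by
  obtain ⟨h1, h2, h3, h4, h5, h6, h7, h8, h9, h10, h11, h12⟩ := hm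
  unfold WState.Bounded
  rw [h]
  intro k
  cases k <;> simp only [Mem.ω, List.mem_map, forall_exists_index, and_imp,
    forall_apply_eq_imp_iff₂, List.not_mem_nil, IsEmpty.forall_iff, implies_true]
  all_goals first | assumption | exact fun x hx => (h6 x hx).1 | exact fun x hx => (h7 x hx).1 |
    exact fun x hx => (h8 x hx).1 | exact fun x hx => (h6 x hx).2.1 |
    exact fun x hx => (h7 x hx).2.1 | exact fun x hx => (h8 x hx).2.1 |
    exact fun x hx => (h6 x hx).2.2 | exact fun x hx => (h7 x hx).2.2 |
    exact fun x hx => (h8 x hx).2.2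

/-- Moves the word on top of `i` to `j`, with a header. -/
def move (i j : Tape) (pre : List Bool := []) : List Op :=
  [.zip i .nil j (fun _ => false) fstT pre, .drop i]

/-! ### Extending the candidates by an item -/

/-- The candidates that arise from a candidate and an item with the given cost and column. -/
def ext (c T : List Bool) (x : Cand) : List Cand :=
  ⟨x.rem, x.cov, false :: x.sel⟩ ::
    if wlt x.rem c then [] else [⟨wsub x.rem c, wor x.cov T, true :: x.sel⟩]

/-- The candidate extended by the item is produced unconditionally. The borrow of the subtraction,
which tells that the item is too expensive, is saved in `e` because each later `zip` overwrites `q`.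
-/
def extHead : List Op :=
  [.zip .lrem .cost .mrem (fun _ => false) subT [],
    .flags fun f => { f with e := f.q },
    .zip .lcov .col .mcov (fun _ => false) orT [],
    .zip .lsel .nil .msel (fun _ => false) fstT [true]]

/-- The original candidate leaves the old table as the variant that skips the item; the header
`false` records this. -/
def extMove : List Op := move .lrem .mrem ++ move .lcov .mcov ++ move .lsel .msel [false]

def extBody : WProg :=
  .seq (block extHead)
    (.seq (.ite (fun r => r.1.e) (block [.drop .mrem, .drop .mcov, .drop .msel]) (block []))
      (block extMove))

theorem runs_extHead {m : Mem} {s : WState} {c T : List Bool} {x : Cand} {L : List Cand}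
    (hs : At m s) (hL : m.L = x :: L) (hc : m.cost = [c]) (hT : m.col = [T]) :
    At { m with M := ⟨wsub x.rem c, wor x.cov T, true :: x.sel⟩ :: m.M } (runs extHead s) ∧
      (runs extHead s).fl.e = wlt x.rem c := by
  obtain ⟨h1, h2⟩ := hs
  refine ⟨⟨?_, ?_⟩, ?_⟩
  · funext k
    simp only [runs, extHead, Op.run, h1]
    cases k <;> simp [Mem.ω, hL, hc, hT, transduce_fstT, wsub, wor]
  · simpa [runs, extHead, Op.run] using h2
  · simp [runs, extHead, Op.run, h1, Mem.ω, hL, hc, wlt]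

theorem runs_extMove {m : Mem} {s : WState} {x : Cand} {L : List Cand}
    (hs : At m s) (hL : m.L = x :: L) :
    At { m with L := L, M := ⟨x.rem, x.cov, false :: x.sel⟩ :: m.M } (runs extMove s) := by
  obtain ⟨h1, h2⟩ := hs
  refine ⟨?_, ?_⟩
  · funext k
    simp only [runs, extMove, move, List.cons_append, List.nil_append, Op.run, h1]
    cases k <;> simp [Mem.ω, hL, transduce_fstT]
  · simpa [runs, extMove, move, Op.run] using h2

theorem runs_dropM {m : Mem} {s : WState} (hs : At m s) :
    At { m with M := m.M.tail } (runs [.drop .mrem, .drop .mcov, .drop .msel] s) := by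
  obtain ⟨h1, h2⟩ := hs
  refine ⟨?_, ?_⟩
  · funext k
    simp only [runs, Op.run, h1]
    cases k <;> simp [Mem.ω, List.map_tail]
  · simpa [runs, Op.run] using h2

/-- A bound for the time of a short block. -/
def blockTime (N : ℕ) : ℕ := 2000 * (N + 1)

instance (o : Op) : Decidable o.Ok := by
  cases o <;> simp only [Op.Ok] <;> infer_instance

/-- Eight operations cost at most 9 * (22 * (N + 8) + 17) = 198 * N + 1737 steps. Only the word
stacks are prescribed, so states with a nonempty output are admitted. -/
theorem triple_block_of_eq {m : Mem} {P Q : WState → Prop} {os : List Op} {N : ℕ}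
    (hm : m.Bounded N) (hP : ∀ s, P s → s.ω = m.ω) (hos : ∀ o ∈ os, o.Ok) (hlen : os.length ≤ 8)
    (h : ∀ s, P s → Q (runs os s)) : Triple P (block os) Q (blockTime N) := by
  refine (Triple.block hos (fun s hs => hm.state (hP s hs)) h).mono ?_
  calc (os.length + 1) * (22 * (N + os.length) + 17) ≤ (8 + 1) * (22 * (N + 8) + 17) := by gcongr
    _ ≤ blockTime N := by unfold blockTime; omega

theorem triple_block {m : Mem} {P Q : WState → Prop} {os : List Op} {N : ℕ}
    (hm : m.Bounded N) (hP : ∀ s, P s → At m s) (hos : ∀ o ∈ os, o.Ok) (hlen : os.length ≤ 8)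
    (h : ∀ s, P s → Q (runs os s)) : Triple P (block os) Q (blockTime N) :=
  triple_block_of_eq hm (fun s hs => (hP s hs).1) hos hlen h

theorem Triple.conseq {P P' Q Q' : WState → Prop} {p : WProg} {t : ℕ} (h : Triple P p Q t)
    (hP : ∀ s, P' s → P s) (hQ : ∀ s, Q s → Q' s) : Triple P' p Q' t := fun s hs =>
  let ⟨s', h1, h2⟩ := h s (hP s hs)
  ⟨s', hQ s' h1, h2⟩

theorem triple_extBody {m : Mem} {c T : List Bool} {x : Cand} {L : List Cand} {N : ℕ}
    (hm : m.Bounded N) (hL : m.L = x :: L) (hc : m.cost = [c]) (hT : m.col = [T])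
    (hx : x.sel.length < N) :
    Triple (At m) extBody (At { m with L := L, M := ext c T x ++ m.M }) (3 * blockTime N + 1) := by
  have hxb := hm.L x (by simp [hL])
  have hcb := hm.cost c (by simp [hc])
  have hTb := hm.col T (by simp [hT])
  set y : Cand := ⟨wsub x.rem c, wor x.cov T, true :: x.sel⟩ with hy
  have hyb : y.Bounded N := ⟨by simp [hy, length_wsub, hxb.1, hcb],
    by simp [hy, length_wor, hxb.2.1, hTb], by simp [hy]; omega⟩
  have hm1 : ({ m with M := y :: m.M } : Mem).Bounded N :=
    { hm with
      M := fun z hz => by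
        rcases List.mem_cons.1 hz with rfl | hz
        exacts [hyb, hm.M z hz] }
  set M' := (if wlt x.rem c then [] else [y]) ++ m.M with hM'
  have hm2 : ({ m with M := M' } : Mem).Bounded N :=
    { hm with
      M := fun z hz => by
        rcases List.mem_append.1 hz with hz | hz
        · split at hz
          · simp at hz
          · exact (List.mem_singleton.1 hz) ▸ hyb
        · exact hm.M z hz }
  have h1 : Triple (At m) (block extHead)
      (fun s => At { m with M := y :: m.M } s ∧ s.fl.e = wlt x.rem c) (blockTime N) :=
    triple_block hm (fun s hs => hs) (by decide) (by decide)
      fun s hs => runs_extHead hs hL hc hT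
  have h2 : Triple (fun s => At { m with M := y :: m.M } s ∧ s.fl.e = wlt x.rem c)
      (.ite (fun r => r.1.e) (block [.drop .mrem, .drop .mcov, .drop .msel]) (block []))
      (At { m with M := M' }) (blockTime N + 1) := by
    refine Triple.ite (b := Flags.e) ?_ ?_
    · refine triple_block hm1 (fun s hs => hs.1.1) (by decide) (by decide) ?_
      rintro s ⟨⟨hs, he⟩, he'⟩
      have := runs_dropM hs
      simp only [List.tail_cons] at this
      simpa [hM', ← he, he'] using this
    · refine triple_block hm1 (fun s hs => hs.1.1) (by decide) (by decide) ?_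
      rintro s ⟨⟨hs, he⟩, he'⟩
      simpa [hM', ← he, he', runs] using hs
  have h3 : Triple (At { m with M := M' }) (block extMove)
      (At { m with L := L, M := ext c T x ++ m.M }) (blockTime N) :=
    triple_block hm2 (fun s hs => hs) (by decide) (by decide) fun s hs => runs_extMove hs hL
  exact (h1.seq (h2.seq h3)).mono (by omega)

/-- The rule for loops whose state is described by the stacks of words. -/
theorem triple_forEach {I : ℕ → Mem → Prop} {p : WProg} {t : ℕ} {i : Tape}
    (hne : ∀ n m, I n m → (m.ω i = [] ↔ n = 0))
    (h : ∀ n m, I (n + 1) m → ∃ m', I n m' ∧ Triple (At m) p (At m') t) {n : ℕ} {m m₁ : Mem}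
    (hm : I n m) (hm₁ : ∀ m', I 0 m' → m' = m₁) :
    Triple (At m) (forEach i p) (At m₁) (n * (t + 2) + 2) := by
  refine (Triple.forEach (P := fun n s => ∃ m, I n m ∧ At m s) ?_ ?_ ?_ n).conseq
    (fun s hs => ⟨m, hm, hs⟩) ?_
  · rintro n s ⟨m, h1, h2⟩
    rw [h2.1]
    exact hne n m h1
  · rintro n s b ⟨m, h1, h2⟩
    exact ⟨m, h1, h2⟩
  · rintro n s ⟨m, h1, h2⟩
    obtain ⟨m', h3, h4⟩ := h n m h1
    obtain ⟨s', h5, h6⟩ := h4 s h2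
    exact ⟨s', ⟨m', h3, h5⟩, h6⟩
  · rintro s ⟨m', h1, h2⟩
    rw [← hm₁ m' h1]
    exact h2

/-- All candidates that arise from a table and an item, on top of others. -/
def extAll (c T : List Bool) (L M : List Cand) : List Cand :=
  L.foldl (fun M x => ext c T x ++ M) M

theorem ext_bounded {c T : List Bool} {x y : Cand} {N : ℕ} (hx : x.Bounded N) (hc : c.length ≤ N)
    (hT : T.length ≤ N) (hs : x.sel.length < N) (hy : y ∈ ext c T x) : y.Bounded N := by
  rcases List.mem_cons.1 hy with rfl | hy
  · exact ⟨hx.1, hx.2.1, by simp only [List.length_cons]; omega⟩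
  · split at hy
    · simp at hy
    · rw [List.mem_singleton.1 hy]
      exact ⟨by simp [length_wsub, hx.1, hc], by simp [length_wor, hx.2.1, hT],
        by simp only [List.length_cons]; omega⟩

theorem triple_extAll {m : Mem} {c T : List Bool} {M : List Cand} {N : ℕ} (hm : m.Bounded N)
    (hc : m.cost = [c]) (hT : m.col = [T]) (hL : ∀ x ∈ m.L, x.sel.length < N)
    (hM : extAll c T m.L m.M = M) :
    Triple (At m) (forEach .lrem extBody) (At { m with L := [], M := M })
      (m.L.length * (3 * blockTime N + 3) + 2) := by
  subst hM
  have hcb := hm.cost c (by simp [hc])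
  have hTb := hm.col T (by simp [hT])
  -- The invariant says that finishing the fold from the current memory gives the desired result; on
  -- exit the remaining fold is over the empty list. The later loops over tables and items use the
  -- same pattern.
  refine triple_forEach (I := fun n m' => m'.L.length = n ∧ m'.Bounded N ∧
    (∀ x ∈ m'.L, x.sel.length < N) ∧ m' = { m with L := m'.L, M := m'.M } ∧
    extAll c T m'.L m'.M = extAll c T m.L m.M) ?_ ?_ ⟨rfl, hm, hL, rfl, rfl⟩ ?_
  · rintro n m' ⟨h1, -⟩
    simp [Mem.ω, ← h1]
  · rintro n m' ⟨h1, h2, h3, h4, h5⟩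
    obtain ⟨x, L, hxL⟩ := List.exists_cons_of_length_eq_add_one h1
    refine ⟨{ m' with L := L, M := ext c T x ++ m'.M }, ⟨by simpa [hxL] using h1, ?_,
      fun y hy => h3 y (by simp [hxL, hy]), ?_, by rw [← h5, hxL]; rfl⟩,
      triple_extBody h2 hxL (by rw [h4]; exact hc) (by rw [h4]; exact hT) (h3 x (by simp [hxL]))⟩
    · exact { h2 with
        L := fun y hy => h2.L y (by simp [hxL, hy])
        M := fun y hy => by
          rcases List.mem_append.1 hy with hy | hy
          · exact ext_bounded (h2.L x (by simp [hxL])) hcb hTb (h3 x (by simp [hxL])) hy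
          · exact h2.M y hy }
    · rw [h4]
  · rintro m' ⟨h1, h2, h3, h4, h5⟩
    rw [List.length_eq_zero_iff] at h1
    rw [h1] at h4 h5
    rw [h4, ← h5]
    rfl

/-! ### Inserting a candidate into a table -/

/-- The symbols are compared as options, so a word that ends early differs from a longer one: this
is equality of words, not of numbers. -/
theorem weq_eq (x y : List Bool) : weq x y = decide (x = y) := by
  have key : ∀ q, (transduce eqT q x y).2 = (q && decide (x = y)) := by
    intro q
    fun_induction transduce eqT q x y with
    | case1 q => simp
    | case2 q a x r ih => simpa [eqT, r] using ih
    | case3 q a y r ih => simpa [eqT, r] using ih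
    | case4 q a x b y r ih =>
      simp only [eqT] at ih
      simp only [r, eqT, ih]
      by_cases h : a = b <;> simp [h]
  simpa [weq] using key true

/-- Whether `y` stays in the table when `x` is inserted. -/
def keep (x y : Cand) : Bool := !(weq y.cov x.cov && wlt y.rem x.rem)

/-- Whether `y` makes `x` superfluous. -/
def dominates (x y : Cand) : Bool := weq y.cov x.cov && !wlt y.rem x.rem

/-- Inserting a candidate into a table, where only the best candidate for each set of covered
voters is kept. -/
def insertCand (L : List Cand) (x : Cand) : List Cand :=
  if L.any (dominates x) then L.filter (keep x) else x :: L.filter (keep x)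

/-- Both comparisons need only the final state of a transducer, so the words written to `aux` are
thrown away. Equality of the covers ends up in `e`, the comparison of the remaining budgets in `q`.
-/
def insHead : List Op :=
  [.zip .lcov .mcov .aux (fun _ => true) eqT [], .drop .aux, .flags fun f => { f with e := f.q },
    .zip .lrem .mrem .aux (fun _ => false) subT [], .drop .aux]

/-- Reached only if `e` and `q` are not both set. Then `e` alone says that the entry dominates the
new candidate, and `d` accumulates whether any entry does. -/
def insKeep : List Op :=
  .flags (fun f => { f with d := f.d || f.e }) ::
    (move .lrem .nrem ++ move .lcov .ncov ++ move .lsel .nsel)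

def dropL : List Op := [.drop .lrem, .drop .lcov, .drop .lsel]

def dropM : List Op := [.drop .mrem, .drop .mcov, .drop .msel]

def moveRL : List Op := move .nrem .lrem ++ move .ncov .lcov ++ move .nsel .lsel

def moveML : List Op := move .mrem .lrem ++ move .mcov .lcov ++ move .msel .lsel

def insBody : WProg :=
  .seq (block insHead) (.ite (fun r => r.1.e && r.1.q) (block dropL) (block insKeep))

/-- Surviving entries pass through the third table and back, which reverses them twice. Only then
does `d` decide whether the new candidate is dropped or added. -/
def insProg : WProg :=
  .seq (block [.flags fun f => { f with d := false }])
    (.seq (forEach .lrem insBody)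
      (.seq (forEach .nrem (block moveRL))
        (.ite (fun r => r.1.d) (block dropM) (block moveML))))

theorem runs_insHead {m : Mem} {s : WState} {x y : Cand} {L M : List Cand}
    (hs : At m s) (hL : m.L = y :: L) (hM : m.M = x :: M) :
    At m (runs insHead s) ∧ (runs insHead s).fl.e = weq y.cov x.cov ∧
      (runs insHead s).fl.q = wlt y.rem x.rem ∧ (runs insHead s).fl.d = s.fl.d := by
  obtain ⟨h1, h2⟩ := hs
  refine ⟨⟨?_, ?_⟩, ?_, ?_, ?_⟩
  · funext k
    simp only [runs, insHead, Op.run, h1]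
    cases k <;> simp [Mem.ω]
  · simpa [runs, insHead, Op.run] using h2
  · simp [runs, insHead, Op.run, h1, Mem.ω, hL, hM, weq]
  · simp [runs, insHead, Op.run, h1, Mem.ω, hL, hM, wlt]
  · simp [runs, insHead, Op.run]

theorem runs_insKeep {m : Mem} {s : WState} {y : Cand} {L : List Cand}
    (hs : At m s) (hL : m.L = y :: L) :
    At { m with L := L, R := y :: m.R } (runs insKeep s) ∧
      (runs insKeep s).fl.d = (s.fl.d || s.fl.e) := by
  obtain ⟨h1, h2⟩ := hs
  refine ⟨⟨?_, ?_⟩, ?_⟩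
  · funext k
    simp only [runs, insKeep, move, List.cons_append, List.nil_append, Op.run, h1]
    cases k <;> simp [Mem.ω, hL, transduce_fstT]
  · simpa [runs, insKeep, move, Op.run] using h2
  · simp [runs, insKeep, move, Op.run]

theorem runs_dropL {m : Mem} {s : WState} {y : Cand} {L : List Cand}
    (hs : At m s) (hL : m.L = y :: L) :
    At { m with L := L } (runs dropL s) ∧ (runs dropL s).fl.d = s.fl.d := by
  obtain ⟨h1, h2⟩ := hs
  refine ⟨⟨?_, ?_⟩, ?_⟩
  · funext k
    simp only [runs, dropL, Op.run, h1]
    cases k <;> simp [Mem.ω, hL]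
  · simpa [runs, dropL, Op.run] using h2
  · simp [runs, dropL, Op.run]

theorem runs_moveRL {m : Mem} {s : WState} {y : Cand} {R : List Cand}
    (hs : At m s) (hR : m.R = y :: R) :
    At { m with L := y :: m.L, R := R } (runs moveRL s) ∧ (runs moveRL s).fl.d = s.fl.d := by
  obtain ⟨h1, h2⟩ := hs
  refine ⟨⟨?_, ?_⟩, ?_⟩
  · funext k
    simp only [runs, moveRL, move, List.cons_append, List.nil_append, Op.run, h1]
    cases k <;> simp [Mem.ω, hR, transduce_fstT]
  · simpa [runs, moveRL, move, Op.run] using h2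
  · simp [runs, moveRL, move, Op.run]

theorem runs_moveML {m : Mem} {s : WState} {y : Cand} {M : List Cand}
    (hs : At m s) (hM : m.M = y :: M) :
    At { m with L := y :: m.L, M := M } (runs moveML s) := by
  obtain ⟨h1, h2⟩ := hs
  refine ⟨?_, ?_⟩
  · funext k
    simp only [runs, moveML, move, List.cons_append, List.nil_append, Op.run, h1]
    cases k <;> simp [Mem.ω, hM, transduce_fstT]
  · simpa [runs, moveML, move, Op.run] using h2

theorem triple_insBody {m : Mem} {x y : Cand} {L M : List Cand} {N : ℕ} (d : Bool)
    (hm : m.Bounded N) (hL : m.L = y :: L) (hM : m.M = x :: M) :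
    Triple (fun s => At m s ∧ s.fl.d = d) insBody
      (fun s => At { m with L := L, R := if keep x y then y :: m.R else m.R } s ∧
        s.fl.d = (d || dominates x y)) (2 * blockTime N + 1) := by
  have h1 : Triple (fun s => At m s ∧ s.fl.d = d) (block insHead)
      (fun s => At m s ∧ s.fl.e = weq y.cov x.cov ∧ s.fl.q = wlt y.rem x.rem ∧ s.fl.d = d)
      (blockTime N) := by
    refine triple_block hm (fun s hs => hs.1) (by decide) (by decide) ?_
    rintro s ⟨hs, rfl⟩
    exact runs_insHead hs hL hM
  refine (h1.seq (t' := blockTime N + 1) ?_).mono (by omega)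
  refine Triple.ite (b := fun f => f.e && f.q) ?_ ?_
  · refine triple_block hm (fun s hs => hs.1.1) (by decide) (by decide) ?_
    rintro s ⟨⟨hs, he, hq, hd⟩, h⟩
    rw [he, hq] at h
    have hk : keep x y = false := by simp [keep, h]
    have hd' : dominates x y = false := by
      simp only [Bool.and_eq_true] at h
      simp [dominates, h.2]
    have := runs_dropL hs hL
    simpa [hk, hd', hd] using this
  · refine triple_block hm (fun s hs => hs.1.1) (by decide) (by decide) ?_
    rintro s ⟨⟨hs, he, hq, hd⟩, h⟩
    rw [he, hq] at h
    have hk : keep x y = true := by simp [keep, h]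
    have hd' : dominates x y = weq y.cov x.cov := by
      unfold dominates
      revert h
      cases weq y.cov x.cov <;> simp
    have := runs_insKeep hs hL
    simpa [hk, hd', hd, he] using this

/-- The flag `d` carries information from round to round, so the invariant speaks of the state and
not of the memory alone. -/
theorem triple_insLoop {m : Mem} {x : Cand} {M : List Cand} {N : ℕ}
    (hm : m.Bounded N) (hR : m.R = []) (hM : m.M = x :: M) :
    Triple (fun s => At m s ∧ s.fl.d = false) (forEach .lrem insBody)
      (fun s => At { m with L := [], R := (m.L.filter (keep x)).reverse } s ∧
        s.fl.d = m.L.any (dominates x)) (m.L.length * (2 * blockTime N + 3) + 2) := by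
  refine (Triple.forEach (P := fun n s => ∃ m', At m' s ∧ m'.L.length = n ∧ m'.Bounded N ∧
    m' = { m with L := m'.L, R := m'.R } ∧
    (m'.L.filter (keep x)).reverse ++ m'.R = (m.L.filter (keep x)).reverse ∧
    (s.fl.d || m'.L.any (dominates x)) = m.L.any (dominates x)) (t := 2 * blockTime N + 1)
    ?_ ?_ ?_ m.L.length).conseq ?_ ?_
  · rintro n s ⟨m', h1, h2, -⟩
    simp [h1.1, Mem.ω, ← h2]
  · rintro n s b ⟨m', h1, h2⟩
    exact ⟨m', h1, h2⟩
  · rintro n s ⟨m', h1, h2, h3, h4, h5, h6⟩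
    obtain ⟨y, L, hyL⟩ := List.exists_cons_of_length_eq_add_one h2
    obtain ⟨s', ⟨h7, h8⟩, h9⟩ := triple_insBody (M := M) s.fl.d h3 hyL
      (by rw [h4]; exact hM) s ⟨h1, rfl⟩
    refine ⟨s', ⟨_, h7, by simpa [hyL] using h2, ?_, ?_, ?_, ?_⟩, h9⟩
    · exact { h3 with
        L := fun z hz => h3.L z (by simp [hyL, hz])
        R := fun z hz => by
          dsimp only at hz
          split at hz
          · rcases List.mem_cons.1 hz with rfl | hz
            exacts [h3.L z (by simp [hyL]), h3.R z hz]
          · exact h3.R z hz }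
    · rw [h4]
    · rw [← h5, hyL]
      by_cases h : keep x y <;> simp [h]
    · rw [← h6, hyL, h8]
      simp [Bool.or_assoc]
  · rintro s ⟨hs, hd⟩
    exact ⟨m, hs, rfl, hm, rfl, by simp [hR], by simp [hd]⟩
  · rintro s ⟨m', h1, h2, h3, h4, h5, h6⟩
    rw [List.length_eq_zero_iff] at h2
    rw [h2] at h4 h5 h6
    simp only [List.filter_nil, List.reverse_nil, List.nil_append, List.any_nil,
      Bool.or_false] at h5 h6
    rw [h5] at h4
    rw [h4] at h1
    exact ⟨h1, h6⟩

theorem triple_insBack {m : Mem} {N : ℕ} (hm : m.Bounded N) (d : Bool) :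
    Triple (fun s => At m s ∧ s.fl.d = d) (forEach .nrem (block moveRL))
      (fun s => At { m with L := m.R.reverse ++ m.L, R := [] } s ∧ s.fl.d = d)
      (m.R.length * (blockTime N + 2) + 2) := by
  refine (Triple.forEach (P := fun n s => ∃ m', At m' s ∧ m'.R.length = n ∧ m'.Bounded N ∧
    m' = { m with L := m'.L, R := m'.R } ∧ m'.R.reverse ++ m'.L = m.R.reverse ++ m.L ∧
    s.fl.d = d) (t := blockTime N) ?_ ?_ ?_ m.R.length).conseq ?_ ?_
  · rintro n s ⟨m', h1, h2, -⟩
    simp [h1.1, Mem.ω, ← h2]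
  · rintro n s b ⟨m', h1, h2⟩
    exact ⟨m', h1, h2⟩
  · rintro n s ⟨m', h1, h2, h3, h4, h5, h6⟩
    obtain ⟨y, R, hyR⟩ := List.exists_cons_of_length_eq_add_one h2
    have hb : Triple (fun s => At m' s ∧ s.fl.d = d) (block moveRL)
        (fun s => At { m' with L := y :: m'.L, R := R } s ∧ s.fl.d = d) (blockTime N) := by
      refine triple_block h3 (fun s hs => hs.1) (by decide) (by decide) ?_
      rintro s ⟨hs, rfl⟩
      exact runs_moveRL hs hyR
    obtain ⟨s', ⟨h7, h8⟩, h9⟩ := hb s ⟨h1, h6⟩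
    refine ⟨s', ⟨_, h7, by simpa [hyR] using h2, ?_, ?_, ?_, h8⟩, h9⟩
    · exact { h3 with
        R := fun z hz => h3.R z (by simp [hyR, hz])
        L := fun z hz => by
          rcases List.mem_cons.1 hz with rfl | hz
          exacts [h3.R z (by simp [hyR]), h3.L z hz] }
    · rw [h4]
    · rw [← h5, hyR]
      simp
  · rintro s ⟨hs, hd⟩
    exact ⟨m, hs, rfl, hm, rfl, rfl, hd⟩
  · rintro s ⟨m', h1, h2, h3, h4, h5, h6⟩
    rw [List.length_eq_zero_iff] at h2
    rw [h2] at h4 h5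
    simp only [List.reverse_nil, List.nil_append] at h5
    rw [h5] at h4
    rw [h4] at h1
    exact ⟨h1, h6⟩

theorem mem_insertCand {L : List Cand} {x y : Cand} (h : y ∈ insertCand L x) :
    y = x ∨ y ∈ L := by
  unfold insertCand at h
  split at h
  · exact .inr (List.mem_filter.1 h).1
  · rcases List.mem_cons.1 h with h | h
    exacts [.inl h, .inr (List.mem_filter.1 h).1]

theorem triple_insProg {m : Mem} {x : Cand} {M : List Cand} {N E : ℕ}
    (hm : m.Bounded N) (hR : m.R = []) (hM : m.M = x :: M) (hE : m.L.length ≤ E) :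
    Triple (At m) insProg (At { m with L := insertCand m.L x, M := M })
      ((E + 1) * (3 * blockTime N + 10)) := by
  have h1 : Triple (At m) (block [.flags fun f => { f with d := false }])
      (fun s => At m s ∧ s.fl.d = false) (blockTime N) :=
    triple_block hm (fun s hs => hs) (by decide) (by decide) fun s hs => ⟨hs, rfl⟩
  have h2 := triple_insLoop hm hR hM
  have hm2 : ({ m with L := [], R := (m.L.filter (keep x)).reverse } : Mem).Bounded N :=
    { hm with
      L := fun y hy => by simp at hy
      R := fun y hy => hm.L y (List.mem_filter.1 (List.mem_reverse.1 hy)).1 }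
  have h3 := triple_insBack hm2 (m.L.any (dominates x))
  simp only [List.reverse_reverse, List.append_nil, List.length_reverse] at h3
  have hm3 : ({ m with L := m.L.filter (keep x) } : Mem).Bounded N :=
    { hm with L := fun y hy => hm.L y (List.mem_filter.1 hy).1 }
  rw [show ({ m with L := m.L.filter (keep x), R := [] } : Mem) =
    { m with L := m.L.filter (keep x) } by rw [← hR]] at h3
  have h4 : Triple (fun s => At { m with L := m.L.filter (keep x) } s ∧
      s.fl.d = m.L.any (dominates x)) (.ite (fun r => r.1.d) (block dropM) (block moveML))
      (At { m with L := insertCand m.L x, M := M }) (blockTime N + 1) := by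
    refine Triple.ite (b := Flags.d) ?_ ?_
    · refine triple_block hm3 (fun s hs => hs.1.1) (by decide) (by decide) ?_
      rintro s ⟨⟨hs, hd⟩, h⟩
      rw [hd] at h
      have := runs_dropM hs
      simpa [insertCand, h, hM, dropM] using this
    · refine triple_block hm3 (fun s hs => hs.1.1) (by decide) (by decide) ?_
      rintro s ⟨⟨hs, hd⟩, h⟩
      rw [hd] at h
      have := runs_moveML hs hM
      simpa [insertCand, h] using this
  refine (h1.seq (h2.seq (h3.seq h4))).mono ?_
  have hF := List.length_filter_le (keep x) m.L
  calc _ ≤ blockTime N + (E * (2 * blockTime N + 3) + 2 + (E * (blockTime N + 2) + 2 +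
        (blockTime N + 1))) := by gcongr; omega
    _ ≤ _ := by nlinarith

/-! ### The size of tables -/

/-- A table: candidates with different sets of covered voters. -/
structure IsTable (n : ℕ) (L : List Cand) : Prop where
  nodup : (L.map Cand.cov).Nodup
  cov : ∀ x ∈ L, x.cov.length = n

/-- The covers are distinct bit vectors of length `n`. This is the origin of the exponential factor.
-/
theorem IsTable.length_le {n : ℕ} {L : List Cand} (h : IsTable n L) : L.length ≤ 2 ^ n := by
  classical
  rw [← List.length_map (f := Cand.cov), ← List.toFinset_card_of_nodup h.nodup]
  have h1 : (L.map Cand.cov).toFinset ⊆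
      (Finset.univ : Finset (List.Vector Bool n)).image List.Vector.toList := by
    intro w hw
    obtain ⟨x, hx, rfl⟩ := List.mem_map.1 (List.mem_toFinset.1 hw)
    exact Finset.mem_image.2 ⟨⟨x.cov, h.cov x hx⟩, Finset.mem_univ _, rfl⟩
  refine (Finset.card_le_card h1).trans (Finset.card_image_le.trans ?_)
  simp [card_vector]

/-- For an entry with the same cover as `x`, `keep` and `dominates` are the same test. So if nothing
dominates `x`, no surviving entry shares its cover. -/
theorem IsTable.insertCand {n : ℕ} {L : List Cand} (h : IsTable n L) {x : Cand}
    (hx : x.cov.length = n) : IsTable n (insertCand L x) := by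
  have hf : ((L.filter (keep x)).map Cand.cov).Nodup :=
    h.nodup.sublist (List.filter_sublist.map _)
  refine ⟨?_, fun y hy => ?_⟩
  · unfold StackProgram.insertCand
    split
    · exact hf
    · rename_i hd
      rw [List.map_cons, List.nodup_cons]
      refine ⟨fun hmem => ?_, hf⟩
      obtain ⟨y, hy, hyx⟩ := List.mem_map.1 hmem
      obtain ⟨hyL, hk⟩ := List.mem_filter.1 hy
      refine hd (List.any_eq_true.2 ⟨y, hyL, ?_⟩)
      simp only [keep, dominates, weq_eq, hyx, decide_true, Bool.true_and] at hk ⊢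
      exact hk
  · rcases mem_insertCand hy with rfl | hy
    exacts [hx, h.cov y hy]

/-- The growing list is a table in every round, so each insertion scans at most `2 ^ n` entries. -/
theorem triple_prune {m m₁ : Mem} {N n : ℕ} (hm : m.Bounded N) (hR : m.R = [])
    (hL : IsTable n m.L) (hM : ∀ x ∈ m.M, x.cov.length = n)
    (hm₁ : { m with L := m.M.foldl insertCand m.L, M := [] } = m₁) :
    Triple (At m) (forEach .mrem insProg) (At m₁)
      (m.M.length * ((2 ^ n + 1) * (3 * blockTime N + 10) + 2) + 2) := by
  subst hm₁
  refine triple_forEach (I := fun k m' => m'.M.length = k ∧ m'.Bounded N ∧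
    IsTable n m'.L ∧ (∀ x ∈ m'.M, x.cov.length = n) ∧ m' = { m with L := m'.L, M := m'.M } ∧
    m'.M.foldl insertCand m'.L = m.M.foldl insertCand m.L) ?_ ?_ ⟨rfl, hm, hL, hM, rfl, rfl⟩ ?_
  · rintro n m' ⟨h1, -⟩
    simp [Mem.ω, ← h1]
  · rintro k m' ⟨h1, h2, h3, h4, h5, h6⟩
    obtain ⟨x, M, hxM⟩ := List.exists_cons_of_length_eq_add_one h1
    refine ⟨_, ⟨by simpa [hxM] using h1, ?_, h3.insertCand (h4 x (by simp [hxM])),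
      fun y hy => h4 y (by simp [hxM, hy]), ?_, by rw [← h6, hxM]; rfl⟩,
      triple_insProg h2 (by rw [h5]; exact hR) hxM h3.length_le⟩
    · exact { h2 with
        M := fun y hy => h2.M y (by simp [hxM, hy])
        L := fun y hy => by
          rcases mem_insertCand hy with rfl | hy
          exacts [h2.M y (by simp [hxM]), h2.L y hy] }
    · rw [h5]
  · rintro m' ⟨h1, h2, h3, h4, h5, h6⟩
    rw [List.length_eq_zero_iff] at h1
    rw [h1] at h5 h6
    rw [h5, ← h6]
    rfl

/-! ### Processing all items -/

/-- The table after processing an item. -/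
def stepItem (L : List Cand) (it : List Bool × List Bool) : List Cand :=
  (extAll it.1 it.2 L []).foldl insertCand []

def itemHead : List Op := move .inp .cost ++ move .inp .col

def itemBody : WProg :=
  .seq (block itemHead)
    (.seq (forEach .lrem extBody)
      (.seq (block [.drop .cost, .drop .col]) (forEach .mrem insProg)))

theorem runs_itemHead {m : Mem} {s : WState} {c T : List Bool} {I : List (List Bool)}
    (hs : At m s) (hI : m.inp = c :: T :: I) :
    At { m with inp := I, cost := c :: m.cost, col := T :: m.col } (runs itemHead s) := by
  obtain ⟨h1, h2⟩ := hs
  refine ⟨?_, ?_⟩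
  · funext k
    simp only [runs, itemHead, move, List.cons_append, List.nil_append, Op.run, h1]
    cases k <;> simp [Mem.ω, hI, transduce_fstT]
  · simpa [runs, itemHead, move, Op.run] using h2

theorem runs_dropItem {m : Mem} {s : WState} (hs : At m s) :
    At { m with cost := m.cost.tail, col := m.col.tail } (runs [.drop .cost, .drop .col] s) := by
  obtain ⟨h1, h2⟩ := hs
  refine ⟨?_, ?_⟩
  · funext k
    simp only [runs, Op.run, h1]
    cases k <;> simp [Mem.ω]
  · simpa [runs, Op.run] using h2

theorem mem_extAll {c T : List Bool} {L M : List Cand} {y : Cand} :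
    y ∈ extAll c T L M ↔ (∃ x ∈ L, y ∈ ext c T x) ∨ y ∈ M := by
  induction L generalizing M with
  | nil => simp [extAll]
  | cons x L ih =>
    rw [extAll, List.foldl_cons]
    refine ih.trans ?_
    simp only [List.mem_append, List.mem_cons, exists_eq_or_imp]
    rw [← or_assoc]
    exact or_congr_left or_comm

theorem length_extAll_le (c T : List Bool) (L M : List Cand) :
    (extAll c T L M).length ≤ 2 * L.length + M.length := by
  induction L generalizing M with
  | nil => simp [extAll]
  | cons x L ih =>
    rw [extAll, List.foldl_cons]
    refine (ih _).trans ?_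
    have : (ext c T x).length ≤ 2 := by
      unfold ext
      split <;> simp
    simp only [List.length_append, List.length_cons]
    omega

theorem mem_foldl_insertCand {M L : List Cand} {y : Cand} (h : y ∈ M.foldl insertCand L) :
    y ∈ M ∨ y ∈ L := by
  induction M generalizing L with
  | nil => exact .inr h
  | cons x M ih =>
    rcases ih h with h | h
    · exact .inl (List.mem_cons_of_mem _ h)
    · rcases mem_insertCand h with rfl | h
      exacts [.inl (List.mem_cons_self ..), .inr h]

theorem IsTable.foldl {n : ℕ} {M L : List Cand} (hL : IsTable n L)
    (hM : ∀ x ∈ M, x.cov.length = n) : IsTable n (M.foldl StackProgram.insertCand L) := by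
  induction M generalizing L with
  | nil => exact hL
  | cons x M ih =>
    exact ih (hL.insertCand (hM x (by simp))) fun y hy => hM y (by simp [hy])

theorem length_cov_ext {n : ℕ} {c T : List Bool} {x y : Cand} (hx : x.cov.length = n)
    (hT : T.length = n) (hy : y ∈ ext c T x) : y.cov.length = n := by
  rcases List.mem_cons.1 hy with rfl | hy
  · exact hx
  · split at hy
    · simp at hy
    · rw [List.mem_singleton.1 hy]
      simp [length_wor, hx, hT]

theorem IsTable.stepItem {n : ℕ} {L : List Cand} {it : List Bool × List Bool}
    (hL : IsTable n L) (hT : it.2.length = n) : IsTable n (stepItem L it) := by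
  refine IsTable.foldl ⟨List.nodup_nil, by simp⟩ fun y hy => ?_
  rcases mem_extAll.1 hy with ⟨x, hx, hy⟩ | hy
  · exact length_cov_ext (hL.cov x hx) hT hy
  · simp at hy

theorem length_sel_ext {c T : List Bool} {x y : Cand} (hy : y ∈ ext c T x) :
    y.sel.length = x.sel.length + 1 := by
  rcases List.mem_cons.1 hy with rfl | hy
  · rfl
  · split at hy
    · simp at hy
    · rw [List.mem_singleton.1 hy]
      rfl

/-- A bound for the time to process an item. -/
def itemTime (n N : ℕ) : ℕ := 100 * (2 ^ n + 1) ^ 2 * blockTime N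

theorem triple_itemBody {m : Mem} {it : List Bool × List Bool} {I : List (List Bool)} {N n : ℕ}
    (hm : m.Bounded N) (hI : m.inp = it.1 :: it.2 :: I) (hc : m.cost = []) (hT : m.col = [])
    (hM : m.M = []) (hR : m.R = []) (hL : IsTable n m.L) (hsel : ∀ x ∈ m.L, x.sel.length < N)
    (hn : it.2.length = n) :
    Triple (At m) itemBody (At { m with inp := I, L := stepItem m.L it }) (itemTime n N) ∧
      ({ m with inp := I, L := stepItem m.L it } : Mem).Bounded N := by
  have hcb := hm.inp it.1 (by simp [hI])
  have hTb := hm.inp it.2 (by simp [hI])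
  have hIb : ∀ w ∈ I, w.length ≤ N := fun w hw => hm.inp w (by simp [hI, hw])
  have hm1 : ({ m with inp := I, cost := [it.1], col := [it.2] } : Mem).Bounded N :=
    { hm with
      inp := hIb
      cost := by simpa using hcb
      col := by simpa using hTb }
  have h1 : Triple (At m) (block itemHead)
      (At { m with inp := I, cost := [it.1], col := [it.2] }) (blockTime N) := by
    refine triple_block hm (fun s hs => hs) (by decide) (by decide) fun s hs => ?_
    simpa [hc, hT] using runs_itemHead hs hI
  have h2 := triple_extAll (M := extAll it.1 it.2 m.L []) hm1 rfl rfl hsel (by simp only [hM])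
  have hMb : ∀ y ∈ extAll it.1 it.2 m.L [], y.Bounded N := fun y hy => by
    rcases mem_extAll.1 hy with ⟨x, hx, hy⟩ | hy
    · exact ext_bounded (hm.L x hx) hcb hTb (hsel x hx) hy
    · simp at hy
  have hm3 : ({ m with inp := I, L := [], M := extAll it.1 it.2 m.L [] } : Mem).Bounded N :=
    { hm with
      inp := hIb
      L := by simp
      M := hMb }
  have hm2 : ({ m with
      inp := I, cost := [it.1], col := [it.2], L := [],
      M := extAll it.1 it.2 m.L [] } : Mem).Bounded N :=
    { hm3 with
      cost := by simpa using hcb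
      col := by simpa using hTb }
  have h3 : Triple (At { m with
      inp := I, cost := [it.1], col := [it.2], L := [],
      M := extAll it.1 it.2 m.L [] }) (block [.drop .cost, .drop .col])
      (At { m with inp := I, L := [], M := extAll it.1 it.2 m.L [] }) (blockTime N) := by
    refine triple_block hm2 (fun s hs => hs) (by decide) (by decide) fun s hs => ?_
    simpa [hc, hT] using runs_dropItem hs
  have h4 := triple_prune (m₁ := { m with inp := I, L := stepItem m.L it }) (n := n) hm3 hR
    ⟨List.nodup_nil, by simp⟩ (fun y hy => by
      rcases mem_extAll.1 hy with ⟨x, hx, hy⟩ | hy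
      · exact length_cov_ext (hL.cov x hx) hn hy
      · simp at hy) (by simp [hM, stepItem])
  refine ⟨(h1.seq (h2.seq (h3.seq h4))).mono ?_, ?_⟩
  · have hE := hL.length_le
    have hME := length_extAll_le it.1 it.2 m.L []
    have hB : 1 ≤ blockTime N := by unfold blockTime; omega
    simp only [List.length_nil, Nat.add_zero] at hME
    have hME' : (extAll it.1 it.2 m.L []).length ≤ 2 * 2 ^ n := by omega
    unfold itemTime
    generalize 2 ^ n = E at *
    generalize blockTime N = B at *
    -- At most `E` candidates are extended and at most `2 * E` inserted, each insertion costing a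
    -- multiple of `(E + 1) * B`. Additive constants are absorbed using `1 ≤ B`.
    calc _ ≤ B + (E * (3 * B + 3 * B) + 2 * B + (B + (2 * E * ((E + 1) * (3 * B + 10 * B) + 2 * B)
          + 2 * B))) := by gcongr <;> omega
      _ = (6 + 6 * E + 2 * E * (13 * E + 15)) * B := by ring
      _ ≤ 100 * (E + 1) ^ 2 * B := by
        gcongr
        nlinarith
  · exact { hm with
      inp := hIb
      L := fun y hy => by
        rcases mem_foldl_insertCand hy with hy | hy
        · exact hMb y hy
        · simp at hy }

/-- The words of a list of items. -/
def itemWords (items : List (List Bool × List Bool)) : List (List Bool) :=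
  items.flatMap fun it => [it.1, it.2]

theorem length_sel_stepItem {L : List Cand} {it : List Bool × List Bool} {k : ℕ}
    (hL : ∀ x ∈ L, x.sel.length = k) : ∀ x ∈ stepItem L it, x.sel.length = k + 1 := by
  intro y hy
  rcases mem_foldl_insertCand hy with hy | hy
  · rcases mem_extAll.1 hy with ⟨x, hx, hy⟩ | hy
    · rw [length_sel_ext hy, hL x hx]
    · simp at hy
  · simp at hy

theorem triple_items {m : Mem} {items : List (List Bool × List Bool)} {N n : ℕ}
    (hm : m.Bounded N) (hI : m.inp = itemWords items) (hc : m.cost = []) (hT : m.col = [])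
    (hM : m.M = []) (hR : m.R = []) (hL : IsTable n m.L) (hsel : ∀ x ∈ m.L, x.sel.length = 0)
    (hN : items.length ≤ N) (hn : ∀ it ∈ items, it.2.length = n) :
    Triple (At m) (forEach .inp itemBody)
      (At { m with inp := [], L := items.foldl stepItem m.L })
      (items.length * (itemTime n N + 2) + 2) := by
  -- With `j` items processed and `k` left, all selections have length `j`, and `j + k ≤ N` leaves
  -- room for one more bit while an item remains.
  refine triple_forEach (I := fun k m' => ∃ its : List (List Bool × List Bool), its.length = k ∧
    m'.inp = itemWords its ∧ m'.Bounded N ∧ IsTable n m'.L ∧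
    (∃ j, j + k ≤ N ∧ ∀ x ∈ m'.L, x.sel.length = j) ∧ (∀ it ∈ its, it.2.length = n) ∧
    m' = { m with inp := m'.inp, L := m'.L } ∧
    its.foldl stepItem m'.L = items.foldl stepItem m.L) ?_ ?_
    ⟨items, rfl, hI, hm, hL, ⟨0, by omega, hsel⟩, hn, rfl, rfl⟩ ?_
  · rintro k m' ⟨its, h1, h2, -⟩
    simp only [Mem.ω, h2, ← h1]
    cases its <;> simp [itemWords]
  · rintro k m' ⟨its, h1, h2, h3, h4, ⟨j, hj, h5⟩, h6, h7, h8⟩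
    obtain ⟨it, its', rfl⟩ := List.exists_cons_of_length_eq_add_one h1
    obtain ⟨h9, h10⟩ := triple_itemBody (I := itemWords its') h3 (by rw [h2]; rfl)
      (by rw [h7]; exact hc) (by rw [h7]; exact hT) (by rw [h7]; exact hM)
      (by rw [h7]; exact hR) h4 (fun x hx => by rw [h5 x hx]; omega) (h6 it (by simp))
    exact ⟨_, ⟨its', by simpa using h1, rfl, h10, h4.stepItem (h6 it (by simp)),
      ⟨j + 1, by omega, length_sel_stepItem h5⟩, fun i hi => h6 i (by simp [hi]), by rw [h7],
      h8⟩, h9⟩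
  · rintro m' ⟨its, h1, h2, h3, h4, h5, h6, h7, h8⟩
    rw [List.length_eq_zero_iff] at h1
    subst h1
    rw [h7, h2, ← h8]
    rfl

/-! ### Choosing a candidate that covers the most voters -/

/-- The number of bits set in a word, in binary, where the word `V` provides the width. -/
def wcount (V v : List Bool) : List Bool := v.foldl (fun a b => winc b a V) []

/-- The better of a choice, given by its number of covered voters and its selected items, and a
candidate. -/
def better (V : List Bool) (b : List Bool × List Bool) (x : Cand) : List Bool × List Bool :=
  if wlt (wcount V x.cov) b.1 then b else (wcount V x.cov, x.sel)

/-- The best choice from a table. -/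
def best (V : List Bool) (L : List Cand) : List Bool × List Bool := L.foldl (better V) ([], [])

def countHead : List Op := [.new .aux, .uncons .lcov]

/-- The current bit of the cover sits in `e` and enters the increment as its initial carry; the
voter word only supplies the width of the counter. The cover is consumed, which is harmless since
the candidate is discarded after the comparison. -/
def countStep : List Op :=
  [.zip .aux .voters .tmp (fun f => f.e) incT [], .drop .aux] ++ move .tmp .aux ++ [.uncons .lcov]

def compareBest : List Op := [.zip .aux .bcnt .tmp (fun _ => false) subT [], .drop .tmp]

def skipCand : List Op := .drop .aux :: dropL

def takeCand : List Op :=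
  [.drop .bcnt, .drop .bsel] ++ move .aux .bcnt ++ move .lsel .bsel ++ [.drop .lrem, .drop .lcov]

def bestBody : WProg :=
  .seq (block countHead) (.seq (whileH (block countStep)) (.seq (block compareBest)
    (.ite (fun r => r.1.q) (block skipCand) (block takeCand))))

theorem runs_countHead {m : Mem} {s : WState} {x : Cand} {L : List Cand}
    (hs : At m s) (hL : m.L = x :: L) :
    At { m with L := ⟨x.rem, x.cov.tail, x.sel⟩ :: L, aux := [] :: m.aux } (runs countHead s) ∧
      (runs countHead s).fl.h = x.cov.head?.isSome ∧
      (runs countHead s).fl.e = x.cov.headD false := by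
  obtain ⟨h1, h2⟩ := hs
  refine ⟨⟨?_, ?_⟩, ?_, ?_⟩
  · funext k
    simp only [runs, countHead, Op.run, h1]
    cases k <;> simp [Mem.ω, hL]
  · simpa [runs, countHead, Op.run] using h2
  · simp [runs, countHead, Op.run, h1, Mem.ω, hL]
  · simp [runs, countHead, Op.run, h1, Mem.ω, hL]

theorem runs_countStep {m : Mem} {s : WState} {x : Cand} {L : List Cand} {a V : List Bool}
    (hs : At m s) (hL : m.L = x :: L) (ha : m.aux = [a]) (hV : m.voters = [V]) :
    At { m with L := ⟨x.rem, x.cov.tail, x.sel⟩ :: L, aux := [winc s.fl.e a V] }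
        (runs countStep s) ∧
      (runs countStep s).fl.h = x.cov.head?.isSome ∧
      (runs countStep s).fl.e = x.cov.headD false := by
  obtain ⟨h1, h2⟩ := hs
  refine ⟨⟨?_, ?_⟩, ?_, ?_⟩
  · funext k
    simp only [runs, countStep, move, List.cons_append, List.nil_append, Op.run, h1]
    cases k <;> simp [Mem.ω, hL, ha, hV, transduce_fstT, winc]
  · simpa [runs, countStep, move, Op.run] using h2
  · simp [runs, countStep, move, Op.run, h1, Mem.ω, hL]
  · simp [runs, countStep, move, Op.run, h1, Mem.ω, hL]

theorem runs_compareBest {m : Mem} {s : WState} {a b : List Bool} {A B : List (List Bool)}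
    (hs : At m s) (ha : m.aux = a :: A) (hb : m.bcnt = b :: B) :
    At m (runs compareBest s) ∧ (runs compareBest s).fl.q = wlt a b := by
  obtain ⟨h1, h2⟩ := hs
  refine ⟨⟨?_, ?_⟩, ?_⟩
  · funext k
    simp only [runs, compareBest, Op.run, h1]
    cases k <;> simp [Mem.ω]
  · simpa [runs, compareBest, Op.run] using h2
  · simp [runs, compareBest, Op.run, h1, Mem.ω, ha, hb, wlt]

theorem runs_skipCand {m : Mem} {s : WState} (hs : At m s) :
    At { m with L := m.L.tail, aux := m.aux.tail } (runs skipCand s) := by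
  obtain ⟨h1, h2⟩ := hs
  refine ⟨?_, ?_⟩
  · funext k
    simp only [runs, skipCand, dropL, Op.run, h1]
    cases k <;> simp [Mem.ω, List.map_tail]
  · simpa [runs, skipCand, dropL, Op.run] using h2

theorem runs_takeCand {m : Mem} {s : WState} {x : Cand} {L : List Cand} {a : List Bool}
    {A : List (List Bool)} (hs : At m s) (hL : m.L = x :: L) (ha : m.aux = a :: A) :
    At { m with L := L, aux := A, bcnt := a :: m.bcnt.tail, bsel := x.sel :: m.bsel.tail }
      (runs takeCand s) := by
  obtain ⟨h1, h2⟩ := hs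
  refine ⟨?_, ?_⟩
  · funext k
    simp only [runs, takeCand, move, List.cons_append, List.nil_append, Op.run, h1]
    cases k <;> simp [Mem.ω, hL, ha, transduce_fstT]
  · simpa [runs, takeCand, move, Op.run] using h2

theorem triple_count {m : Mem} {x : Cand} {L : List Cand} {V : List Bool} {N : ℕ}
    (hm : m.Bounded N) (hL : m.L = x :: L) (haux : m.aux = []) (hV : m.voters = [V]) :
    Triple (At m) (.seq (block countHead) (whileH (block countStep)))
      (At { m with L := ⟨x.rem, [], x.sel⟩ :: L, aux := [wcount V x.cov] })
      (blockTime N + (x.cov.length * (blockTime N + 1) + 1)) ∧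
    (wcount V x.cov).length ≤ N := by
  have hx := hm.L x (by simp [hL])
  have hVb := hm.voters V (by simp [hV])
  have hLb : ∀ y ∈ L, y.Bounded N := fun y hy => hm.L y (by simp [hL, hy])
  have hlen : ∀ v a : List Bool, a.length ≤ N →
      (v.foldl (fun a b => winc b a V) a).length ≤ N := by
    intro v
    induction v with
    | nil => exact fun a ha => ha
    | cons b v ih => exact fun a ha => ih _ (by rw [length_winc]; omega)
  -- Here `v` is the uncounted part of the cover: its head is in `e`, its tail on the stack, and `h`
  -- tells whether it is nonempty.
  set I : ℕ → WState → Prop := fun n s => ∃ v a : List Bool, v.length = n ∧ a.length ≤ N ∧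
    v.length ≤ N ∧ At { m with L := ⟨x.rem, v.tail, x.sel⟩ :: L, aux := [a] } s ∧
    s.fl.h = decide (n ≠ 0) ∧ s.fl.e = v.headD false ∧
    v.foldl (fun a b => winc b a V) a = wcount V x.cov with hI
  have hb : ∀ v a : List Bool, v.length ≤ N → a.length ≤ N →
      ({ m with L := ⟨x.rem, v.tail, x.sel⟩ :: L, aux := [a] } : Mem).Bounded N :=
    fun v a hv ha => { hm with
      L := fun y hy => by
        rcases List.mem_cons.1 hy with rfl | hy
        · exact ⟨hx.1, by simp only [List.length_tail]; omega, hx.2.2⟩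
        · exact hLb y hy
      aux := by simpa using ha }
  refine ⟨?_, hlen _ _ (by simp)⟩
  have h1 : Triple (At m) (block countHead) (I x.cov.length) (blockTime N) := by
    refine triple_block hm (fun s hs => hs) (by decide) (by decide) fun s hs => ?_
    obtain ⟨h2, h3, h4⟩ := runs_countHead hs hL
    rw [haux] at h2
    refine ⟨x.cov, [], rfl, by simp, hx.2.1, h2, ?_, h4, rfl⟩
    rw [h3]
    cases x.cov <;> simp
  have h2 : Triple (I x.cov.length) (whileH (block countStep)) (I 0)
      (x.cov.length * (blockTime N + 1) + 1) := by
    refine Triple.whileH ?_ ?_ _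
    · rintro n s ⟨v, a, -, -, -, -, h, -⟩
      exact h
    · rintro n s ⟨v, a, h1, h2, h3, h4, h5, h6, h7⟩
      obtain ⟨b, v, rfl⟩ := List.exists_cons_of_length_eq_add_one h1
      have hbl : Triple (fun s => At { m with L := ⟨x.rem, v, x.sel⟩ :: L, aux := [a] } s ∧
          s.fl.e = b) (block countStep) (I n) (blockTime N) := by
        refine triple_block (hb (b :: v) a h3 h2) (fun s hs => hs.1) (by decide) (by decide) ?_
        rintro s ⟨hs, rfl⟩
        obtain ⟨h8, h9, h10⟩ := runs_countStep hs rfl rfl hV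
        refine ⟨v, _, by simpa using h1, ?_, ?_, h8, ?_, h10, h7⟩
        · rw [length_winc]
          omega
        · simp only [List.length_cons] at h3
          omega
        · rw [h9]
          simp only [List.length_cons, Nat.add_right_cancel_iff] at h1
          rw [← h1]
          cases v <;> simp
      exact hbl s ⟨h4, h6⟩
  refine (h1.seq h2).conseq (fun s hs => hs) ?_
  rintro s ⟨v, a, h1, -, -, h4, -, -, h7⟩
  rw [List.length_eq_zero_iff] at h1
  subst h1
  simp only [List.foldl_nil] at h7
  rw [← h7]
  exact h4

/-- A bound for the time to compare a candidate with the best one so far. -/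
def betterTime (N : ℕ) : ℕ := (N + 4) * (blockTime N + 1)

theorem triple_bestBody {m : Mem} {x : Cand} {L : List Cand} {V : List Bool}
    {b : List Bool × List Bool} {N : ℕ}
    (hm : m.Bounded N) (hL : m.L = x :: L) (haux : m.aux = []) (hV : m.voters = [V])
    (hb : m.bcnt = [b.1]) (hb' : m.bsel = [b.2]) :
    Triple (At m) bestBody
      (At { m with L := L, bcnt := [(better V b x).1], bsel := [(better V b x).2] })
      (betterTime N) ∧ (better V b x).1.length ≤ N ∧ (better V b x).2.length ≤ N := by
  obtain ⟨h1, hlen⟩ := triple_count hm hL haux hV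
  have hx := hm.L x (by simp [hL])
  have hm1 : ({ m with L := ⟨x.rem, [], x.sel⟩ :: L, aux := [wcount V x.cov] } : Mem).Bounded N :=
    { hm with
      L := fun y hy => by
        rcases List.mem_cons.1 hy with rfl | hy
        · exact ⟨hx.1, Nat.zero_le _, hx.2.2⟩
        · exact hm.L y (by simp [hL, hy])
      aux := by simpa using hlen }
  have h2 : Triple (At { m with L := ⟨x.rem, [], x.sel⟩ :: L, aux := [wcount V x.cov] })
      (block compareBest)
      (fun s => At { m with L := ⟨x.rem, [], x.sel⟩ :: L, aux := [wcount V x.cov] } s ∧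
        s.fl.q = wlt (wcount V x.cov) b.1) (blockTime N) :=
    triple_block hm1 (fun s hs => hs) (by decide) (by decide) fun s hs =>
      runs_compareBest hs rfl hb
  have h3 : Triple (fun s => At { m with L := ⟨x.rem, [], x.sel⟩ :: L, aux := [wcount V x.cov] } s ∧
        s.fl.q = wlt (wcount V x.cov) b.1)
      (.ite (fun r => r.1.q) (block skipCand) (block takeCand))
      (At { m with L := L, bcnt := [(better V b x).1], bsel := [(better V b x).2] })
      (blockTime N + 1) := by
    refine Triple.ite (b := Flags.q) ?_ ?_
    · refine triple_block hm1 (fun s hs => hs.1.1) (by decide) (by decide) ?_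
      rintro s ⟨⟨hs, hq⟩, h⟩
      rw [hq] at h
      have := runs_skipCand hs
      simpa [better, h, ← hb, ← hb', haux] using this
    · refine triple_block hm1 (fun s hs => hs.1.1) (by decide) (by decide) ?_
      rintro s ⟨⟨hs, hq⟩, h⟩
      rw [hq] at h
      have := runs_takeCand hs rfl rfl
      simpa [better, h, hb, hb', haux] using this
  refine ⟨?_, ?_, ?_⟩
  · intro s hs
    obtain ⟨s1, h4, h5⟩ := h1 s hs
    obtain ⟨s2, h6, h7⟩ := (h2.seq h3) s1 h4
    refine ⟨s2, h6, ?_⟩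
    obtain ⟨t, ht, h5⟩ := h5
    obtain ⟨t', ht', h7⟩ := h7
    -- `bestBody` is nested to the right, while `triple_count` treats its first two parts as one
    -- program; the execution is cut open and reassociated.
    cases h5 with
    | @seq _ _ _ c _ t1 t2 h8 h9 =>
      refine ⟨t1 + (t2 + t'), ?_, h8.seq (h9.seq h7)⟩
      have : x.cov.length * (blockTime N + 1) ≤ N * (blockTime N + 1) :=
        Nat.mul_le_mul_right _ hx.2.1
      unfold betterTime
      rw [Nat.add_mul]
      omega
  · unfold better
    split
    exacts [hm.bcnt _ (by simp [hb]), hlen]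
  · unfold better
    split
    exacts [hm.bsel _ (by simp [hb']), hx.2.2]

theorem triple_best {m m₁ : Mem} {V : List Bool} {N n : ℕ}
    (hm : m.Bounded N) (haux : m.aux = []) (hV : m.voters = [V])
    (hb : m.bcnt = [[]]) (hb' : m.bsel = [[]]) (hL : m.L.length ≤ 2 ^ n)
    (hm₁ : { m with L := [], bcnt := [(best V m.L).1], bsel := [(best V m.L).2] } = m₁) :
    Triple (At m) (forEach .lrem bestBody) (At m₁) (2 ^ n * (betterTime N + 2) + 2) := by
  subst hm₁
  refine Triple.mono (triple_forEach (I := fun k m' => ∃ b : List Bool × List Bool,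
    m'.L.length = k ∧ m'.Bounded N ∧
    m' = { m with L := m'.L, bcnt := [b.1], bsel := [b.2] } ∧
    m'.L.foldl (better V) b = best V m.L) ?_ ?_
    ⟨([], []), rfl, hm, by cases m; simp_all, rfl⟩ ?_) (Nat.add_le_add_right
      (Nat.mul_le_mul_right _ hL) 2)
  · rintro n m' ⟨b, h1, -⟩
    simp [Mem.ω, ← h1]
  · rintro k m' ⟨b, h1, h2, h3, h4⟩
    obtain ⟨x, L, hxL⟩ := List.exists_cons_of_length_eq_add_one h1
    obtain ⟨h5, h6, h7⟩ := triple_bestBody h2 hxL (by rw [h3]; exact haux)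
      (by rw [h3]; exact hV) (b := b) (by rw [h3]) (by rw [h3])
    refine ⟨_, ⟨better V b x, by simpa [hxL] using h1, ?_, by rw [h3], by
      rw [← h4, hxL]; rfl⟩, h5⟩
    exact { h2 with
      L := fun y hy => h2.L y (by simp [hxL, hy])
      bcnt := by simpa using h6
      bsel := by simpa using h7 }
  · rintro m' ⟨b, h1, h2, h3, h4⟩
    rw [List.length_eq_zero_iff] at h1
    rw [h1] at h3 h4
    rw [h3, ← h4]
    rfl

/-! ### The common part of the two machines -/

/-- The zero transducer turns the voter word, which is kept, into the empty cover of the right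
length. -/
def initOps : List Op :=
  move .inp .voters ++ move .inp .lrem ++
    [.zip .voters .nil .lcov (fun _ => false) zeroT [], .new .lsel]

def coreProg : WProg :=
  .seq (block initOps) (.seq (forEach .inp itemBody)
    (.seq (block [.new .bcnt, .new .bsel]) (forEach .lrem bestBody)))

/-- The initial table. -/
def initTable (V l : List Bool) : List Cand := [⟨l, List.replicate V.length false, []⟩]

/-- The choice that the machines compute. -/
def choice (V l : List Bool) (items : List (List Bool × List Bool)) : List Bool × List Bool :=
  best V (items.foldl stepItem (initTable V l))

theorem runs_initOps {m : Mem} {s : WState} {V l : List Bool} {I : List (List Bool)}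
    (hs : At m s) (hI : m.inp = V :: l :: I) :
    At { m with inp := I, voters := V :: m.voters, L := initTable V l ++ m.L }
      (runs initOps s) := by
  obtain ⟨h1, h2⟩ := hs
  refine ⟨?_, ?_⟩
  · funext k
    simp only [runs, initOps, move, List.cons_append, List.nil_append, Op.run, h1]
    cases k <;> simp [Mem.ω, hI, transduce_fstT, transduce_zeroT, initTable]
  · simpa [runs, initOps, move, Op.run] using h2

theorem runs_newBest {m : Mem} {s : WState} (hs : At m s) :
    At { m with bcnt := [] :: m.bcnt, bsel := [] :: m.bsel }
      (runs [.new .bcnt, .new .bsel] s) := by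
  obtain ⟨h1, h2⟩ := hs
  refine ⟨?_, ?_⟩
  · funext k
    simp only [runs, Op.run, h1]
    cases k <;> simp [Mem.ω]
  · simpa [runs, Op.run] using h2

theorem stepItem_bounded {L : List Cand} {it : List Bool × List Bool} {N : ℕ}
    (hL : ∀ x ∈ L, x.Bounded N) (hsel : ∀ x ∈ L, x.sel.length < N) (hc : it.1.length ≤ N)
    (hT : it.2.length ≤ N) : ∀ x ∈ stepItem L it, x.Bounded N := by
  intro y hy
  rcases mem_foldl_insertCand hy with hy | hy
  · rcases mem_extAll.1 hy with ⟨x, hx, hy⟩ | hy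
    · exact ext_bounded (hL x hx) hc hT (hsel x hx) hy
    · simp at hy
  · simp at hy

theorem IsTable.foldl_stepItem {n : ℕ} {items : List (List Bool × List Bool)} {L : List Cand}
    (hL : IsTable n L) (hn : ∀ it ∈ items, it.2.length = n) :
    IsTable n (items.foldl StackProgram.stepItem L) := by
  induction items generalizing L with
  | nil => exact hL
  | cons it items ih => exact ih (hL.stepItem (hn it (by simp))) fun i hi => hn i (by simp [hi])

theorem foldl_stepItem_bounded {items : List (List Bool × List Bool)} {L : List Cand} {N k : ℕ}
    (hL : ∀ x ∈ L, x.Bounded N) (hsel : ∀ x ∈ L, x.sel.length = k) (hk : k + items.length ≤ N)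
    (hI : ∀ it ∈ items, it.1.length ≤ N ∧ it.2.length ≤ N) :
    ∀ x ∈ items.foldl stepItem L, x.Bounded N := by
  induction items generalizing L k with
  | nil => exact hL
  | cons it items ih =>
    simp only [List.length_cons] at hk
    have hit := hI it (by simp)
    exact ih (stepItem_bounded hL (fun x hx => by rw [hsel x hx]; omega) hit.1 hit.2)
      (length_sel_stepItem hsel) (by omega) fun i hi => hI i (by simp [hi])

/-- A bound for the time of the common part. -/
def coreTime (n N : ℕ) : ℕ :=
  2 * blockTime N + N * (itemTime n N + 2) + 2 ^ n * (betterTime N + 2) + 4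

theorem length_le_of_mem_itemWords {n N : ℕ} {items : List (List Bool × List Bool)}
    (hn : n ≤ N) (hI : ∀ it ∈ items, it.1.length ≤ N ∧ it.2.length = n) :
    ∀ w ∈ itemWords items, w.length ≤ N := by
  intro w hw
  obtain ⟨it, hit, hw⟩ := List.mem_flatMap.1 hw
  have := hI it hit
  simp only [List.mem_cons, List.not_mem_nil, or_false] at hw
  rcases hw with rfl | rfl <;> omega

/-- The contents `B` of the stack `bnd` pass through untouched, so the same program serves the
search, with `B` empty, and the decision, with the bound stored there. -/
theorem triple_core {V l : List Bool} {items : List (List Bool × List Bool)}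
    {B : List (List Bool)} {N : ℕ} (hN : items.length ≤ N) (hV : V.length ≤ N) (hl : l.length ≤ N)
    (hI : ∀ it ∈ items, it.1.length ≤ N ∧ it.2.length = V.length) (hB : ∀ w ∈ B, w.length ≤ N) :
    Triple (At { inp := V :: l :: itemWords items, bnd := B }) coreProg
      (At { bnd := B, voters := [V], bcnt := [(choice V l items).1],
            bsel := [(choice V l items).2] }) (coreTime V.length N) := by
  have hIw := length_le_of_mem_itemWords hV hI
  have h0 : ({ inp := V :: l :: itemWords items, bnd := B } : Mem).Bounded N := by
    constructor <;> simp <;> first | exact hB | exact ⟨hV, hl, hIw⟩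
  have hLb : ∀ x ∈ initTable V l, x.Bounded N := by
    simpa [initTable, Cand.Bounded] using ⟨hl, hV⟩
  have hLT : IsTable V.length (initTable V l) := by
    constructor <;> simp [initTable]
  have h0' : ({ inp := itemWords items, bnd := B, voters := [V], L := initTable V l } :
      Mem).Bounded N := by
    constructor <;> simp <;> assumption
  have h1 : Triple (At { inp := V :: l :: itemWords items, bnd := B }) (block initOps)
      (At { inp := itemWords items, bnd := B, voters := [V], L := initTable V l })
      (blockTime N) :=
    triple_block h0 (fun s hs => hs) (by decide) (by decide) fun s hs => runs_initOps hs rfl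
  have h2 := triple_items (items := items) h0' rfl rfl rfl rfl rfl hLT (by simp [initTable]) hN
    fun it hit => (hI it hit).2
  have hFT := hLT.foldl_stepItem fun it hit => (hI it hit).2
  have hFb := foldl_stepItem_bounded hLb (k := 0) (by simp [initTable])
    (items := items) (by omega) fun it hit => ⟨(hI it hit).1, (hI it hit).2.trans_le hV⟩
  have h3' : ({ bnd := B, voters := [V], L := items.foldl stepItem (initTable V l) } :
      Mem).Bounded N := by
    constructor <;> simp <;> assumption
  have h3 : Triple
      (At { bnd := B, voters := [V], L := items.foldl stepItem (initTable V l) })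
      (block [.new .bcnt, .new .bsel])
      (At { bnd := B, voters := [V], L := items.foldl stepItem (initTable V l),
            bcnt := [[]], bsel := [[]] }) (blockTime N) :=
    triple_block h3' (fun s hs => hs) (by decide) (by decide) fun s hs => runs_newBest hs
  have h4' : Mem.Bounded N
      { bnd := B, voters := [V], L := items.foldl stepItem (initTable V l),
        bcnt := [[]], bsel := [[]] } := by
    constructor <;> simp <;> assumption
  have h4 := triple_best h4' rfl rfl rfl rfl hFT.length_le rfl
  refine (h1.seq (h2.seq (h3.seq h4))).mono ?_
  have : items.length * (itemTime V.length N + 2) ≤ N * (itemTime V.length N + 2) :=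
    Nat.mul_le_mul_right _ hN
  unfold coreTime
  omega

/-! ### Output -/

/-- Selections list the latest item first. Emitting them bit by bit onto the output stack reverses
them into the order of the items. Everything else is cleared because the halting configuration
requires it. -/
def searchProg : WProg :=
  .seq coreProg
    (.seq (block [.drop .voters, .drop .bcnt, .uncons .bsel])
      (.seq (whileH (block [.emit fun f => f.e, .uncons .bsel]))
        (block [.drop .bsel, .flags fun _ => ⟨false, false, false, false⟩])))

/-- The borrow of count minus bound is set exactly when the bound is missed, so its negation is the
answer. -/
def decideProg : WProg :=
  .seq (block (move .inp .bnd))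
    (.seq coreProg
      (block [.zip .bcnt .bnd .tmp (fun _ => false) subT [], .drop .tmp, .drop .bcnt, .drop .bsel,
        .drop .bnd, .drop .voters, .emit fun f => !f.q,
        .flags fun _ => ⟨false, false, false, false⟩]))

/-- All stacks but the output are empty, and the flags are reset. -/
def Done (out : List Bool) (s : WState) : Prop :=
  s = ⟨⟨false, false, false, false⟩, fun _ => [], out⟩

theorem triple_emit {w : List Bool} {N : ℕ} (hw : w.length ≤ N) :
    Triple (fun s => s.ω = ({ bsel := [w.tail] } : Mem).ω ∧ s.out = [] ∧
        s.fl.h = decide (w.length ≠ 0) ∧ s.fl.e = w.headD false)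
      (whileH (block [.emit fun f => f.e, .uncons .bsel]))
      (fun s => s.ω = ({ bsel := [[]] } : Mem).ω ∧ s.out = w.reverse)
      (w.length * (blockTime N + 1) + 1) := by
  have hb : ∀ v : List Bool, v.length ≤ N → ({ bsel := [v.tail] } : Mem).Bounded N := by
    intro v hv
    constructor <;> simp
    omega
  refine (Triple.whileH (P := fun n s => ∃ v : List Bool, v.length = n ∧ v.length ≤ N ∧
    s.ω = ({ bsel := [v.tail] } : Mem).ω ∧ v.reverse ++ s.out = w.reverse ∧
    s.fl.h = decide (n ≠ 0) ∧ s.fl.e = v.headD false) ?_ ?_ w.length).conseq ?_ ?_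
  · rintro n s ⟨v, -, -, -, -, h, -⟩
    exact h
  · rintro n s ⟨v, h1, h2, h3, h4, h5, h6⟩
    obtain ⟨b, v, rfl⟩ := List.exists_cons_of_length_eq_add_one h1
    -- Flags and output enter the invariant, so the block is run from one fixed state.
    refine triple_block_of_eq (P := fun s' => s' = s) (hb (b :: v) h2)
      (fun s' hs' => by rw [hs', h3]) (by simp [Op.Ok]) (by decide) ?_ s rfl
    rintro _ rfl
    simp only [List.length_cons, Nat.add_right_cancel_iff] at h1 h2
    refine ⟨v, h1, by omega, ?_, ?_, ?_, ?_⟩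
    · funext k
      simp only [runs, Op.run, h3]
      cases k <;> simp [Mem.ω]
    · rw [← h4, runs, runs, runs]
      simp [Op.run, h6]
    · rw [← h1]
      cases v <;> simp [runs, Op.run, h3, Mem.ω]
    · simp [runs, Op.run, h3, Mem.ω]
  · rintro s ⟨h1, h2, h3, h4⟩
    exact ⟨w, rfl, hw, h1, by simp [h2], h3, h4⟩
  · rintro s ⟨v, h1, h2, h3, h4, -⟩
    rw [List.length_eq_zero_iff] at h1
    subst h1
    exact ⟨h3, by simpa using h4⟩

/-- A bound for the time of the machines after reading the input. -/
def mainTime (n N : ℕ) : ℕ := coreTime n N + (N + 4) * (blockTime N + 1)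

/-- Needed to time the output phase, since `triple_core` does not state that the words it leaves are
short. -/
theorem choice_bounded {V l : List Bool} {items : List (List Bool × List Bool)}
    {N : ℕ} (hN : items.length ≤ N) (hV : V.length ≤ N) (hl : l.length ≤ N)
    (hI : ∀ it ∈ items, it.1.length ≤ N ∧ it.2.length = V.length) :
    (choice V l items).1.length ≤ N ∧ (choice V l items).2.length ≤ N := by
  have hLb : ∀ x ∈ initTable V l, x.Bounded N := by
    simpa [initTable, Cand.Bounded] using ⟨hl, hV⟩
  have hFb := foldl_stepItem_bounded hLb (k := 0) (by simp [initTable])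
    (items := items) (by omega) fun it hit => ⟨(hI it hit).1, (hI it hit).2.trans_le hV⟩
  have hc : ∀ v a : List Bool, a.length ≤ N →
      (v.foldl (fun a b => winc b a V) a).length ≤ N := by
    intro v
    induction v with
    | nil => exact fun a ha => ha
    | cons b v ih => exact fun a ha => ih _ (by rw [length_winc]; omega)
  have key : ∀ (L : List Cand) (b : List Bool × List Bool), (∀ x ∈ L, x.Bounded N) →
      b.1.length ≤ N ∧ b.2.length ≤ N →
      (L.foldl (better V) b).1.length ≤ N ∧ (L.foldl (better V) b).2.length ≤ N := by
    intro L
    induction L with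
    | nil => exact fun b _ hb => hb
    | cons x L ih =>
      intro b hL hb
      refine ih _ (fun y hy => hL y (by simp [hy])) ?_
      unfold better
      split
      exacts [hb, ⟨hc _ _ (by simp), (hL x (by simp)).2.2⟩]
  exact key _ _ hFb (by simp)

theorem triple_searchProg {V l : List Bool} {items : List (List Bool × List Bool)}
    {N : ℕ} (hN : items.length ≤ N) (hV : V.length ≤ N) (hl : l.length ≤ N)
    (hI : ∀ it ∈ items, it.1.length ≤ N ∧ it.2.length = V.length) :
    Triple (At { inp := V :: l :: itemWords items }) searchProg
      (Done (choice V l items).2.reverse) (mainTime V.length N) := by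
  have h1 := triple_core (B := []) hN hV hl hI (by simp)
  obtain ⟨hb1, hb2⟩ := choice_bounded hN hV hl hI
  generalize choice V l items = b at *
  have hm : ({ voters := [V], bcnt := [b.1], bsel := [b.2] } : Mem).Bounded N := by
    constructor <;> simp <;> assumption
  have h2 : Triple (At { voters := [V], bcnt := [b.1], bsel := [b.2] })
      (block [.drop .voters, .drop .bcnt, .uncons .bsel])
      (fun s => s.ω = ({ bsel := [b.2.tail] } : Mem).ω ∧ s.out = [] ∧
        s.fl.h = decide (b.2.length ≠ 0) ∧ s.fl.e = b.2.headD false) (blockTime N) := by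
    refine triple_block hm (fun s hs => hs) (by decide) (by decide) ?_
    rintro s ⟨hs, ho⟩
    refine ⟨?_, ?_, ?_, ?_⟩
    · funext k
      simp only [runs, Op.run, hs]
      cases k <;> simp [Mem.ω]
    · simpa [runs, Op.run] using ho
    · rcases hb : b.2 with _ | ⟨x, w⟩ <;> simp [runs, Op.run, hs, Mem.ω, hb]
    · simp [runs, Op.run, hs, Mem.ω]
  have h3 := triple_emit hb2
  have hm4 : ({ bsel := [[]] } : Mem).Bounded N := by
    constructor <;> simp
  have h4 : Triple (fun s => s.ω = ({ bsel := [[]] } : Mem).ω ∧ s.out = b.2.reverse)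
      (block [.drop .bsel, .flags fun _ => ⟨false, false, false, false⟩])
      (Done b.2.reverse) (blockTime N) := by
    refine triple_block_of_eq hm4 (fun s hs => hs.1) (by simp [Op.Ok]) (by decide) ?_
    rintro s ⟨hs, ho⟩
    simp only [Done, runs, Op.run, hs, ho, WState.mk.injEq, true_and, and_true]
    funext k
    cases k <;> simp [Mem.ω]
  refine (h1.seq (h2.seq (h3.seq h4))).mono ?_
  have : b.2.length * (blockTime N + 1) ≤ N * (blockTime N + 1) := Nat.mul_le_mul_right _ hb2
  unfold mainTime
  rw [Nat.add_mul]
  omega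

theorem triple_decideProg {V l r : List Bool} {items : List (List Bool × List Bool)}
    {N : ℕ} (hN : items.length ≤ N) (hV : V.length ≤ N) (hl : l.length ≤ N) (hr : r.length ≤ N)
    (hI : ∀ it ∈ items, it.1.length ≤ N ∧ it.2.length = V.length) :
    Triple (At { inp := r :: V :: l :: itemWords items }) decideProg
      (Done [!wlt (choice V l items).1 r]) (mainTime V.length N) := by
  have h1 := triple_core (B := [r]) hN hV hl hI (by simpa using hr)
  obtain ⟨hb1, hb2⟩ := choice_bounded hN hV hl hI
  generalize choice V l items = b at *
  have hIw := length_le_of_mem_itemWords hV hI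
  have hm0 : ({ inp := r :: V :: l :: itemWords items } : Mem).Bounded N := by
    constructor <;> simp
    exact ⟨hr, hV, hl, hIw⟩
  have h0 : Triple (At { inp := r :: V :: l :: itemWords items }) (block (move .inp .bnd))
      (At { inp := V :: l :: itemWords items, bnd := [r] }) (blockTime N) := by
    refine triple_block hm0 (fun s hs => hs) (by decide) (by decide) ?_
    rintro s ⟨hs, ho⟩
    refine ⟨?_, ?_⟩
    · funext k
      simp only [runs, move, Op.run, hs]
      cases k <;> simp [Mem.ω, transduce_fstT]
    · simpa [runs, move, Op.run] using ho
  have hm : ({ bnd := [r], voters := [V], bcnt := [b.1], bsel := [b.2] } : Mem).Bounded N := by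
    constructor <;> simp <;> assumption
  have h2 : Triple (At { bnd := [r], voters := [V], bcnt := [b.1], bsel := [b.2] })
      (block [.zip .bcnt .bnd .tmp (fun _ => false) subT [], .drop .tmp, .drop .bcnt, .drop .bsel,
        .drop .bnd, .drop .voters, .emit fun f => !f.q,
        .flags fun _ => ⟨false, false, false, false⟩])
      (Done [!wlt b.1 r]) (blockTime N) := by
    refine triple_block hm (fun s hs => hs) (by simp [Op.Ok]) (by decide) ?_
    rintro s ⟨hs, ho⟩
    simp only [Done, runs, Op.run, hs, ho, WState.mk.injEq, true_and]
    refine ⟨?_, ?_⟩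
    · funext k
      cases k <;> simp [Mem.ω]
    · simp [Mem.ω, wlt]
  refine (h0.seq (h1.seq h2)).mono ?_
  unfold mainTime
  rw [Nat.add_mul]
  omega

/-! ### Reading the input -/

/-- The bit that a symbol of the input alphabet stands for. -/
def bitOf : Computability.Γ' → Option Bool
  | .bit b => some b
  | _ => none

/-- Separators are read as `none`, the end marker of words. The second register records whether
there was a symbol at all, which the first cannot tell. -/
def popInput : WProg := popRaw fun r o => (r.1, o.bind bitOf, o.map fun _ => true)

def popTmp : WProg := popWord .tmp fun r o => (r.1, o.join, o.map fun _ => true)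

/-- Moves the input to a stack of words. -/
def readInput : WProg :=
  .seq popInput
    (.seq (.loop (fun r => r.2.2.isSome) (.seq (pushWord .tmp fun r => r.2.1) popInput))
      (.seq popTmp
        (.loop (fun r => r.2.2.isSome) (.seq (pushWord .inp fun r => r.2.1) popTmp))))

section ReadInput

variable {out : List Bool} {g : Fin 3 → List Bool} {f : Tape → List (Option Bool)} {fl : Flags}

theorem execIn_popInput (u : List Computability.Γ') (a b : Option Bool) :
    ExecIn popInput ((fl, a, b), stackFn u out g f)
      ((fl, u.head?.bind bitOf, u.head?.map fun _ => true), stackFn u.tail out g f) 1 :=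
  execIn_popRaw (fl, a, b) fun r o => (r.1, o.bind bitOf, o.map fun _ => true)

theorem execIn_popTmp {v : List (Option Bool)} (hv : f .tmp = v) (a b : Option Bool) :
    ExecIn popTmp ((fl, a, b), stackFn [] out g f)
      ((fl, v.head?.join, v.head?.map fun _ => true),
        stackFn [] out g (update f .tmp v.tail)) 1 := by
  subst hv
  exact execIn_popWord (fl, a, b) .tmp fun r o => (r.1, o.join, o.map fun _ => true)

theorem execIn_readLoop (u : List Computability.Γ') (f : Tape → List (Option Bool)) :
    ExecIn (.loop (fun r => r.2.2.isSome) (.seq (pushWord .tmp fun r => r.2.1) popInput))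
      ((fl, u.head?.bind bitOf, u.head?.map fun _ => true), stackFn u.tail out g f)
      ((fl, none, none),
        stackFn [] out g (update f .tmp ((u.map bitOf).reverse ++ f .tmp)))
      (3 * u.length + 1) := by
  induction u generalizing f with
  | nil => simpa using ExecIn.loop_false (Γ := Alpha) rfl
  | cons x u ih =>
    have h1 := execIn_pushWord (raw := u) (out := out) (g := g) (f := f)
      (fl, bitOf x, some true) .tmp fun r => r.2.1
    have h2 := execIn_popInput (fl := fl) (out := out) (g := g)
      (f := update f .tmp (bitOf x :: f .tmp)) u (bitOf x) (some true)
    have h3 := ih (update f .tmp (bitOf x :: f .tmp))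
    have h := (h1.seq h2).loop_true (b := fun r : Regs => r.2.2.isSome) rfl h3
    simp only [update_idem, update_self] at h
    simpa using h.mono (by omega)

theorem execIn_writeLoop (v : List (Option Bool)) (f : Tape → List (Option Bool)) :
    ExecIn (.loop (fun r => r.2.2.isSome) (.seq (pushWord .inp fun r => r.2.1) popTmp))
      ((fl, v.head?.join, v.head?.map fun _ => true), stackFn [] out g (update f .tmp v.tail))
      ((fl, none, none),
        stackFn [] out g (update (update f .inp (v.reverse ++ f .inp)) .tmp []))
      (3 * v.length + 1) := by
  induction v generalizing f with
  | nil => simpa using ExecIn.loop_false (Γ := Alpha) rfl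
  | cons x v ih =>
    have h1 := execIn_pushWord (raw := []) (out := out) (g := g) (f := update f .tmp v)
      (fl, x, some true) .inp fun r => r.2.1
    have e : update (update f .tmp v) .inp (x :: update f .tmp v .inp) =
        update (update f .inp (x :: f .inp)) .tmp v := by
      rw [update_of_ne (by decide), update_comm (by decide)]
    rw [e] at h1
    have h2 := execIn_popTmp (fl := fl) (out := out) (g := g)
      (f := update (update f .inp (x :: f .inp)) .tmp v) (update_self ..) x (some true)
    rw [update_idem] at h2
    have h3 := ih (update f .inp (x :: f .inp))
    have h := (h1.seq h2).loop_true (b := fun r : Regs => r.2.2.isSome) rfl h3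
    simp only [update_idem, update_self] at h
    simpa using h.mono (by omega)

/-- Two transfers, via `tmp`, so that the second undoes the reversal of the first; each takes 3
steps per symbol. -/
theorem execIn_readInput (u : List Computability.Γ') :
    ExecIn readInput ((fl, none, none), stackFn u out g fun _ => [])
      ((fl, none, none), stackFn [] out g (update (fun _ => []) .inp (u.map bitOf)))
      (6 * u.length + 4) := by
  have h1 := execIn_popInput (fl := fl) (out := out) (g := g) (f := fun _ => []) u none none
  have h2 := execIn_readLoop (fl := fl) (out := out) (g := g) u fun _ => []
  rw [List.append_nil] at h2
  have h3 := execIn_popTmp (fl := fl) (out := out) (g := g)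
    (f := update (fun _ => []) .tmp (u.map bitOf).reverse) (update_self ..) none none
  rw [update_idem] at h3
  have h4 := execIn_writeLoop (fl := fl) (out := out) (g := g) (u.map bitOf).reverse fun _ => []
  have e : update (update (fun _ : Tape => ([] : List (Option Bool))) .inp
      ((u.map bitOf).reverse.reverse ++ [])) .tmp [] =
      update (fun _ => []) .inp (u.map bitOf) := by
    rw [List.reverse_reverse, List.append_nil, update_comm (by decide)]
    congr 1
    exact update_eq_self (f := fun _ : Tape => ([] : List (Option Bool))) Tape.tmp
  rw [e] at h4
  refine (h1.seq (h2.seq (h3.seq h4))).mono ?_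
  simp only [List.length_reverse, List.length_map]
  omega

end ReadInput

/-- The initial registers. -/
def initRegs : Regs := (⟨false, false, false, false⟩, none, none)

/-- The machine that reads its input and runs a program. -/
noncomputable def machine (p : WProg) : TM2ComputableAux Computability.Γ' Bool where
  tm := (Prog.seq readInput p).toFinTM2 .raw .out initRegs
  inputAlphabet := Equiv.refl _
  outputAlphabet := Equiv.refl _

/-- The constant 5 is 4 for reading the input and 1 for halting. -/
theorem machine_outputs {p : WProg} {u : List Computability.Γ'} {ws : List (List Bool)}
    {w : List Bool} {t T : ℕ} (hp : Triple (At { inp := ws }) p (Done w) t)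
    (hu : u.map bitOf = enc ws) (hT : 6 * u.length + 5 + t ≤ T) :
    Nonempty (TM2OutputsInTime (machine p).tm (u.map (machine p).inputAlphabet.symm)
      (some (w.map (machine p).outputAlphabet.symm)) T) := by
  have h1 := execIn_readInput (fl := ⟨false, false, false, false⟩) (out := []) (g := tri [] [] []) u
  obtain ⟨s, rfl, h2⟩ := hp ⟨⟨false, false, false, false⟩, ({ inp := ws } : Mem).ω, []⟩ ⟨rfl, rfl⟩
  have e : update (fun _ => []) .inp (u.map bitOf) = fun k => enc (({ inp := ws } : Mem).ω k) := by
    rw [hu]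
    funext k
    cases k <;> rfl
  rw [e] at h1
  have h := (h1.seq h2).mono (show _ ≤ T - 1 by omega)
  have hfin := h.outputs (i := .raw) (o := .out) (s := initRegs) (u := u) (v := w) ?_ ?_
  · rw [Nat.sub_add_cancel (by omega)] at hfin
    have e1 : u.map (machine p).inputAlphabet.symm = u := List.map_id u
    have e2 : w.map (machine p).outputAlphabet.symm = w := List.map_id w
    rw [e1, e2]
    exact hfin
  · have : ∀ {c c' : ((Prog.seq readInput p).toFinTM2 .raw .out initRegs).Cfg},
        c.l = c'.l → c.var = c'.var → c.stk = c'.stk → c = c' := by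
      rintro ⟨⟩ ⟨⟩ rfl rfl rfl
      rfl
    refine this rfl rfl ?_
    funext k
    cases k with
    | scratch t => fin_cases t <;> rfl
    | _ => rfl
  · have : ∀ {c c' : ((Prog.seq readInput p).toFinTM2 .raw .out initRegs).Cfg},
        c.l = c'.l → c.var = c'.var → c.stk = c'.stk → c = c' := by
      rintro ⟨⟩ ⟨⟩ rfl rfl rfl
      rfl
    refine this rfl rfl ?_
    funext k
    cases k with
    | scratch t => fin_cases t <;> rfl
    | _ => rfl

/-! ### Binary numbers -/

/-- The value of a binary number, the least significant bit first. -/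
def val : List Bool → ℕ
  | [] => 0
  | b :: x => b.toNat + 2 * val x

theorem val_lt (x : List Bool) : val x < 2 ^ x.length := by
  induction x with
  | nil => simp [val]
  | cons b x ih =>
    have := b.toNat_le
    simp only [val, List.length_cons, pow_succ]
    omega

theorem val_encodePosNum (n : PosNum) : val (Computability.encodePosNum n) = n := by
  induction n with
  | one => rfl
  | bit1 n ih =>
    simp only [Computability.encodePosNum, val, ih, PosNum.cast_bit1, Bool.toNat_true]
    omega
  | bit0 n ih =>
    simp only [Computability.encodePosNum, val, ih, PosNum.cast_bit0, Bool.toNat_false]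
    omega

theorem val_encodeNat (k : ℕ) : val (Computability.encodeNat k) = k := by
  conv_rhs => rw [← Num.to_of_nat k]
  unfold Computability.encodeNat
  cases (k : Num) with
  | zero => rfl
  | pos n => exact val_encodePosNum n

/-- The schoolbook identity: the incoming borrow has weight 1, the outgoing one the weight of the
position after the last. It is checked bit by bit. -/
theorem val_subT (q : Bool) (x y : List Bool) :
    val (transduce subT q x y).1 + val y + q.toNat =
      val x + (transduce subT q x y).2.toNat * 2 ^ max x.length y.length := by
  fun_induction transduce subT q x y with
  | case1 q => simp [val]
  | case2 q a x r ih =>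
    simp only [val, List.length_cons, List.length_nil, Nat.max_zero, pow_succ] at ih ⊢
    cases q <;> cases a <;> simp [r, subT] at ih ⊢ <;> grind
  | case3 q a x r ih =>
    simp only [val, List.length_cons, List.length_nil, Nat.zero_max, pow_succ] at ih ⊢
    cases q <;> cases a <;> simp [r, subT] at ih ⊢ <;> grind
  | case4 q a x b y r ih =>
    simp only [val, List.length_cons, Nat.succ_max_succ, pow_succ] at ih ⊢
    cases q <;> cases a <;> cases b <;> simp [r, subT] at ih ⊢ <;> grind

/-- In `val_subT` the difference, `val x` and `val y` are all below 2 to the common length, which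
forces the outgoing borrow. -/
theorem wlt_eq (x y : List Bool) : wlt x y = decide (val x < val y) := by
  have h := val_subT false x y
  have h1 := val_lt (transduce subT false x y).1
  have h2 := val_lt x
  have h3 := val_lt y
  rw [length_transduce] at h1
  have h4 : 2 ^ y.length ≤ 2 ^ max x.length y.length := Nat.pow_le_pow_right (by omega) (by omega)
  unfold wlt
  cases hq : (transduce subT false x y).2 <;> simp [hq] at h ⊢ <;> omega

theorem val_wsub {x y : List Bool} (h : val y ≤ val x) : val (wsub x y) + val y = val x := by
  have h1 := val_subT false x y
  have h2 : (transduce subT false x y).2 = false := by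
    change wlt x y = false
    rw [wlt_eq]
    simpa using h
  rw [h2] at h1
  simpa [wsub] using h1

theorem val_incT (q : Bool) (x y : List Bool) :
    val (transduce incT q x y).1 + (transduce incT q x y).2.toNat * 2 ^ max x.length y.length =
      val x + q.toNat := by
  fun_induction transduce incT q x y with
  | case1 q => simp [val]
  | case2 q a x r ih =>
    simp only [val, List.length_cons, List.length_nil, Nat.max_zero, pow_succ] at ih ⊢
    cases q <;> cases a <;> simp [r, incT] at ih ⊢ <;> grind
  | case3 q a x r ih =>
    simp only [val, List.length_cons, List.length_nil, Nat.zero_max, pow_succ] at ih ⊢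
    cases q <;> cases a <;> simp [r, incT] at ih ⊢ <;> grind
  | case4 q a x b y r ih =>
    simp only [val, List.length_cons, Nat.succ_max_succ, pow_succ] at ih ⊢
    cases q <;> cases a <;> cases b <;> simp [r, incT] at ih ⊢ <;> grind

/-- The number of bits set in a word. -/
def popcount (v : List Bool) : ℕ := (v.map Bool.toNat).sum

theorem popcount_le (v : List Bool) : popcount v ≤ v.length := by
  induction v with
  | nil => rfl
  | cons b v ih =>
    have := b.toNat_le
    simp only [popcount, List.map_cons, List.sum_cons, List.length_cons] at ih ⊢
    omega

/-- The total fits into the width of `V`, so no increment carries out of the last position. -/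
theorem val_foldl_winc (V v a : List Bool) (ha : a.length ≤ V.length)
    (h : val a + popcount v < 2 ^ V.length) :
    val (v.foldl (fun a b => winc b a V) a) = val a + popcount v := by
  induction v generalizing a with
  | nil => rfl
  | cons b v ih =>
    have h1 := val_incT b a V
    rw [max_eq_right ha] at h1
    simp only [popcount, List.map_cons, List.sum_cons] at h ih ⊢
    have h2 : (transduce incT b a V).2 = false := by
      cases hq : (transduce incT b a V).2
      · rfl
      · rw [hq] at h1
        simp only [Bool.toNat_true, one_mul] at h1
        omega
    rw [h2] at h1
    simp only [Bool.toNat_false, zero_mul, add_zero] at h1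
    have h3 : val (winc b a V) = val a + b.toNat := h1
    rw [List.foldl_cons, ih _ (by rw [length_winc]; omega) (by omega), h3, add_assoc]

theorem val_wcount {V v : List Bool} (h : v.length = V.length) :
    val (wcount V v) = popcount v := by
  have h1 := popcount_le v
  -- A counter of `n` bits suffices for `n` voters since `n < 2 ^ n`.
  have h2 := Nat.lt_two_pow_self (n := V.length)
  have := val_foldl_winc V v [] (by simp) (by simp only [val]; omega)
  simpa [val, wcount] using this

/-! ### Correctness of the table -/

/-- The cost of the selected items. -/
def costOf : List (List Bool × List Bool) → List Bool → ℕ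
  | it :: P, b :: s => (if b then val it.1 else 0) + costOf P s
  | _, _ => 0

/-- The voters that are covered by the selected items. -/
def coverOf (n : ℕ) : List (List Bool × List Bool) → List Bool → List Bool
  | it :: P, b :: s => if b then wor (coverOf n P s) it.2 else coverOf n P s
  | _, _ => List.replicate n false

/-- The table has only attainable candidates, and for each feasible selection from the items `P`
a candidate that is at least as good. -/
structure Represents (n ℓ : ℕ) (P : List (List Bool × List Bool)) (L : List Cand) : Prop where
  length : ∀ x ∈ L, x.sel.length = P.length
  cost : ∀ x ∈ L, val x.rem + costOf P x.sel = ℓ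
  cover : ∀ x ∈ L, x.cov = coverOf n P x.sel
  complete : ∀ s, s.length = P.length → costOf P s ≤ ℓ →
    ∃ x ∈ L, x.cov = coverOf n P s ∧ ℓ ≤ val x.rem + costOf P s

/-- If `x` is not added, some entry dominates it, and an entry that dominates `x` also passes the
filter `keep x`. -/
theorem exists_mem_insertCand (L : List Cand) (x : Cand) :
    ∃ z ∈ insertCand L x, z.cov = x.cov ∧ val x.rem ≤ val z.rem := by
  unfold insertCand
  split
  · rename_i h
    obtain ⟨z, hz, hd⟩ := List.any_eq_true.1 h
    simp only [dominates, weq_eq, wlt_eq, Bool.and_eq_true, decide_eq_true_eq, Bool.not_eq_true',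
      decide_eq_false_iff_not, not_lt] at hd
    refine ⟨z, List.mem_filter.2 ⟨hz, ?_⟩, hd.1, hd.2⟩
    simp [keep, wlt_eq, hd.2]
  · exact ⟨x, List.mem_cons_self .., rfl, le_rfl⟩

/-- An entry is removed only if `x` has the same cover and more budget left, and then whatever
stands in for `x` also stands in for `y`. -/
theorem exists_mem_insertCand_of_mem {L : List Cand} {y : Cand} (hy : y ∈ L) (x : Cand) :
    ∃ z ∈ insertCand L x, z.cov = y.cov ∧ val y.rem ≤ val z.rem := by
  by_cases h : keep x y = true
  · refine ⟨y, ?_, rfl, le_rfl⟩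
    have := List.mem_filter.2 ⟨hy, h⟩
    unfold insertCand
    split
    exacts [this, List.mem_cons_of_mem _ this]
  · simp only [keep, weq_eq, wlt_eq, Bool.not_eq_true, Bool.not_eq_false', Bool.and_eq_true,
      decide_eq_true_eq] at h
    obtain ⟨z, hz, h1, h2⟩ := exists_mem_insertCand L x
    exact ⟨z, hz, h1.trans h.1.symm, by omega⟩

theorem exists_mem_foldl_insertCand {M L : List Cand} {y : Cand} (hy : y ∈ M ∨ y ∈ L) :
    ∃ z ∈ M.foldl insertCand L, z.cov = y.cov ∧ val y.rem ≤ val z.rem := by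
  induction M generalizing L y with
  | nil => exact ⟨y, by simpa using hy, rfl, le_rfl⟩
  | cons x M ih =>
    rw [List.mem_cons, or_assoc, or_left_comm] at hy
    rcases hy with hy | hy
    · exact ih (.inl hy)
    · have : ∃ z ∈ insertCand L x, z.cov = y.cov ∧ val y.rem ≤ val z.rem := by
        rcases hy with rfl | hy
        exacts [exists_mem_insertCand L y, exists_mem_insertCand_of_mem hy x]
      obtain ⟨z, hz, h1, h2⟩ := this
      obtain ⟨z', hz', h3, h4⟩ := ih (.inr hz)
      exact ⟨z', hz', h3.trans h1, h2.trans h4⟩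

/-- The exchange argument. A selection from `it :: P` is a decision on `it` and a selection from
`P`, and the latter has a stand-in with the same cover and at least as much budget left. The same
decision on `it` is then affordable for the stand-in and leads to the same cover; pruning preserves
such a candidate by `exists_mem_foldl_insertCand`. The newest item heads the list, in step with the
selection words. -/
theorem Represents.stepItem {n ℓ : ℕ} {P : List (List Bool × List Bool)} {L : List Cand}
    (h : Represents n ℓ P L) (it : List Bool × List Bool) :
    Represents n ℓ (it :: P) (stepItem L it) := by
  have key : ∀ y ∈ StackProgram.stepItem L it, y.sel.length = P.length + 1 ∧
      val y.rem + costOf (it :: P) y.sel = ℓ ∧ y.cov = coverOf n (it :: P) y.sel := by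
    intro y hy
    rcases mem_foldl_insertCand hy with hy | hy
    · rcases mem_extAll.1 hy with ⟨x, hx, hy⟩ | hy
      · have h1 := h.cost x hx
        refine ⟨by rw [length_sel_ext hy, h.length x hx], ?_⟩
        rcases List.mem_cons.1 hy with rfl | hy
        · simpa [costOf, coverOf, h1] using h.cover x hx
        · split at hy
          · simp at hy
          · rename_i hlt
            rw [wlt_eq] at hlt
            have h2 := val_wsub (x := x.rem) (y := it.1) (by simpa using hlt)
            rw [List.mem_singleton.1 hy]
            refine ⟨?_, ?_⟩
            · simp only [costOf, if_true]
              omega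
            · simp [coverOf, h.cover x hx]
      · simp at hy
    · simp at hy
  refine ⟨fun y hy => (key y hy).1, fun y hy => (key y hy).2.1, fun y hy => (key y hy).2.2, ?_⟩
  intro s hs hc
  obtain ⟨b, s, rfl⟩ := List.exists_cons_of_length_eq_add_one hs
  have hc' : costOf P s ≤ ℓ := le_trans (by simp [costOf]) hc
  obtain ⟨x, hx, h1, h2⟩ := h.complete s (by simpa using hs) hc'
  have : ∃ y ∈ ext it.1 it.2 x, y.cov = coverOf n (it :: P) (b :: s) ∧
      ℓ ≤ val y.rem + costOf (it :: P) (b :: s) := by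
    cases b with
    | false => exact ⟨_, List.mem_cons_self .., by simpa [coverOf] using h1, by simpa [costOf]⟩
    | true =>
      simp only [costOf, if_true] at hc ⊢
      -- The stand-in has at least `ℓ - costOf P s` left, which pays for `it` by feasibility.
      have hle : val it.1 ≤ val x.rem := by omega
      have h3 := val_wsub hle
      refine ⟨⟨wsub x.rem it.1, wor x.cov it.2, true :: x.sel⟩, ?_, by simp [coverOf, h1], ?_⟩
      · simp [ext, wlt_eq, hle]
      · simp only
        omega
  obtain ⟨y, hy, h3, h4⟩ := this
  obtain ⟨z, hz, h5, h6⟩ := exists_mem_foldl_insertCand (L := []) (M := extAll it.1 it.2 L [])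
    (.inl (mem_extAll.2 (.inl ⟨x, hx, hy⟩)))
  exact ⟨z, hz, h5.trans h3, by omega⟩

theorem Represents.foldl_stepItem {n ℓ : ℕ} {P items : List (List Bool × List Bool)}
    {L : List Cand} (h : Represents n ℓ P L) :
    Represents n ℓ (items.reverse ++ P) (items.foldl StackProgram.stepItem L) := by
  induction items generalizing P L with
  | nil => exact h
  | cons it items ih => simpa using ih (h.stepItem it)

theorem represents_initTable (V l : List Bool) :
    Represents V.length (val l) [] (initTable V l) := by
  constructor <;> simp [initTable, costOf, coverOf]

theorem foldl_better (V : List Bool) (L : List Cand) (b : List Bool × List Bool) :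
    (L.foldl (better V) b = b ∨ ∃ x ∈ L, L.foldl (better V) b = (wcount V x.cov, x.sel)) ∧
      val b.1 ≤ val (L.foldl (better V) b).1 ∧
      ∀ x ∈ L, val (wcount V x.cov) ≤ val (L.foldl (better V) b).1 := by
  induction L generalizing b with
  | nil => simp
  | cons x L ih =>
    obtain ⟨h1, h2, h3⟩ := ih (better V b x)
    have h4 : (better V b x = b ∨ better V b x = (wcount V x.cov, x.sel)) ∧
        val b.1 ≤ val (better V b x).1 ∧ val (wcount V x.cov) ≤ val (better V b x).1 := by
      unfold better
      rw [wlt_eq]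
      split
      · rename_i h
        exact ⟨.inl rfl, le_rfl, by simpa using (of_decide_eq_true h).le⟩
      · rename_i h
        exact ⟨.inr rfl, by simpa using h, le_rfl⟩
    refine ⟨?_, h4.2.1.trans h2, ?_⟩
    · rcases h1 with h1 | ⟨y, hy, h1⟩
      · rcases h4.1 with h4 | h4
        · exact .inl (h1.trans h4)
        · exact .inr ⟨x, by simp, h1.trans h4⟩
      · exact .inr ⟨y, by simp [hy], h1⟩
    · intro y hy
      rcases List.mem_cons.1 hy with rfl | hy
      exacts [h4.2.2.trans h2, h3 y hy]

/-- The initial choice has count 0 and ties go to the newcomer, so the first candidate always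
replaces it and the result comes from the table. -/
theorem best_spec (V : List Bool) {L : List Cand} (hL : L ≠ []) :
    (∃ x ∈ L, best V L = (wcount V x.cov, x.sel)) ∧
      ∀ x ∈ L, val (wcount V x.cov) ≤ val (best V L).1 := by
  obtain ⟨x, L, rfl⟩ := List.exists_cons_of_ne_nil hL
  have hb : better V ([], []) x = (wcount V x.cov, x.sel) := by
    simp [better, wlt_eq, val]
  obtain ⟨h1, h2, h3⟩ := foldl_better V L (better V ([], []) x)
  rw [best, List.foldl_cons]
  rw [hb] at h1 h2 h3 ⊢
  refine ⟨?_, fun y hy => ?_⟩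
  · rcases h1 with h1 | ⟨y, hy, h1⟩
    exacts [⟨x, by simp, h1⟩, ⟨y, by simp [hy], h1⟩]
  · rcases List.mem_cons.1 hy with rfl | hy
    exacts [h2, h3 y hy]

theorem costOf_replicate_false (P : List (List Bool × List Bool)) :
    costOf P (List.replicate P.length false) = 0 := by
  induction P with
  | nil => rfl
  | cons it P ih => simpa [costOf, List.replicate_succ] using ih

theorem choice_spec {V l : List Bool} {items : List (List Bool × List Bool)}
    (hI : ∀ it ∈ items, it.2.length = V.length) :
    (choice V l items).2.length = items.length ∧
      costOf items.reverse (choice V l items).2 ≤ val l ∧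
      val (choice V l items).1 =
        popcount (coverOf V.length items.reverse (choice V l items).2) ∧
      ∀ s : List Bool, s.length = items.length → costOf items.reverse s ≤ val l →
        popcount (coverOf V.length items.reverse s) ≤ val (choice V l items).1 := by
  have hR := (represents_initTable V l).foldl_stepItem (items := items)
  rw [List.append_nil] at hR
  have hT : IsTable V.length (items.foldl stepItem (initTable V l)) :=
    IsTable.foldl_stepItem (by constructor <;> simp [initTable]) hI
  unfold choice
  generalize items.foldl stepItem (initTable V l) = L at *
  -- Selecting nothing is always feasible and has a representative.
  have hL : L ≠ [] := by
    obtain ⟨x, hx, -⟩ := hR.complete (List.replicate items.reverse.length false) (by simp)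
      (by rw [costOf_replicate_false]; exact Nat.zero_le _)
    exact List.ne_nil_of_mem hx
  obtain ⟨⟨x, hx, hb⟩, hmax⟩ := best_spec V hL
  rw [hb] at hmax ⊢
  refine ⟨by simpa using hR.length x hx, ?_, ?_, ?_⟩
  · have := hR.cost x hx
    simp only
    omega
  · rw [val_wcount (hT.cov x hx), hR.cover x hx]
  · intro s hs hc
    obtain ⟨y, hy, h1, -⟩ := hR.complete s (by simpa using hs) hc
    rw [← h1, ← val_wcount (hT.cov y hy)]
    exact hmax y hy

/-! ### Scenarios -/

/-- The items of a scenario as pairs of words. -/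
def itemsOf (E : BudgetScenario) : List (List Bool × List Bool) :=
  E.columns.map fun x => (Computability.encodeNat x.1, x.2)

theorem itemsOf_eq (E : BudgetScenario) : itemsOf E = List.ofFn fun a =>
    (Computability.encodeNat (E.cost a), List.ofFn fun v => decide (a ∈ E.approval v)) := by
  simp [itemsOf, BudgetScenario.columns, List.map_ofFn, Function.comp_def]

theorem length_of_mem_itemsOf {E : BudgetScenario} {it : List Bool × List Bool}
    (h : it ∈ itemsOf E) : it.2.length = E.numVoters := by
  rw [itemsOf_eq, List.mem_ofFn] at h
  obtain ⟨a, rfl⟩ := h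
  simp

/-- The sum of the costs of the selected items does not depend on the direction. -/
theorem costOf_eq_sum (P : List (List Bool × List Bool)) (s : List Bool) :
    costOf P s = ((P.zip s).map fun p => if p.2 then val p.1.1 else 0).sum := by
  induction P generalizing s with
  | nil => cases s <;> simp [costOf]
  | cons it P ih =>
    rcases s with - | ⟨b, s⟩
    · simp [costOf]
    · cases b <;> simp [costOf, ih]

theorem wor_ofFn {n : ℕ} (f : Fin n → Bool) {T : List Bool} (hT : T.length = n) :
    wor (List.ofFn f) T = List.ofFn fun v => f v || T.getD v false := by
  have key : ∀ x y : List Bool, x.length = y.length →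
      (transduce orT false x y).1 = List.zipWith (· || ·) x y := by
    intro x
    induction x with
    | nil => intro y h; simp_all [transduce, eq_comm]
    | cons a x ih =>
      intro y h
      cases y with
      | nil => simp at h
      | cons b y => simp [transduce, orT, ih y (by simpa using h)]
  rw [wor, key _ _ (by simp [hT])]
  refine List.ext_getElem (by simp [hT]) fun i h1 h2 => ?_
  simp only [List.length_ofFn] at h2
  simp [List.getElem?_eq_getElem (hT.symm ▸ h2 : i < T.length)]

theorem coverOf_eq_ofFn {n : ℕ} {P : List (List Bool × List Bool)} (s : List Bool)
    (hP : ∀ it ∈ P, it.2.length = n) :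
    coverOf n P s =
      List.ofFn fun v : Fin n => (P.zip s).any fun p => p.2 && p.1.2.getD v false := by
  induction P generalizing s with
  | nil => cases s <;> simp [coverOf, List.ofFn_const]
  | cons it P ih =>
    have hP' := fun it h => hP it (List.mem_cons_of_mem _ h)
    rcases s with - | ⟨b, s⟩
    · simp [coverOf, List.ofFn_const]
    · cases b
      · simp [coverOf, ih _ hP']
      · rw [coverOf, ih _ hP', wor_ofFn _ (hP it (by simp))]
        simp [Bool.or_comm]

theorem zip_reverse_itemsOf (E : BudgetScenario) (B : Finset (Fin E.numItems)) :
    (itemsOf E).reverse.zip (budgetString B).reverse = (List.ofFn fun a =>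
      ((Computability.encodeNat (E.cost a), List.ofFn fun v => decide (a ∈ E.approval v)),
        decide (a ∈ B))).reverse := by
  rw [List.zip, ← List.reverse_zipWith (by simp [itemsOf_eq, budgetString]), itemsOf_eq,
    budgetString]
  congr 1
  refine List.ext_getElem (by simp) fun i h1 h2 => ?_
  simp

theorem costOf_budgetString (E : BudgetScenario) (B : Finset (Fin E.numItems)) :
    costOf (itemsOf E).reverse (budgetString B).reverse = ∑ a ∈ B, E.cost a := by
  rw [costOf_eq_sum, zip_reverse_itemsOf, List.map_reverse, List.sum_reverse, List.map_ofFn,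
    List.sum_ofFn]
  simp [val_encodeNat, Finset.sum_ite_mem]

theorem popcount_coverOf_budgetString (E : BudgetScenario) (B : Finset (Fin E.numItems)) :
    popcount (coverOf E.numVoters (itemsOf E).reverse (budgetString B).reverse) =
      E.totalSat coverSat B := by
  rw [coverOf_eq_ofFn _ fun it h => length_of_mem_itemsOf (List.mem_reverse.1 h),
    zip_reverse_itemsOf, popcount, List.map_ofFn, List.sum_ofFn, BudgetScenario.totalSat]
  refine Finset.sum_congr rfl fun v _ => ?_
  have : ((List.ofFn fun a => ((Computability.encodeNat (E.cost a),
      List.ofFn fun v => decide (a ∈ E.approval v)), decide (a ∈ B))).reverse.any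
        fun p => p.2 && p.1.2.getD v false) = decide (0 < (E.approval v ∩ B).card) := by
    rw [Bool.eq_iff_iff, decide_eq_true_iff, Finset.card_pos, List.any_reverse, List.any_eq_true]
    constructor
    · rintro ⟨p, hp, h⟩
      obtain ⟨a, rfl⟩ := (List.mem_ofFn' ..).1 hp
      simp at h
      exact ⟨a, Finset.mem_inter.2 ⟨h.2, h.1⟩⟩
    · rintro ⟨a, ha⟩
      refine ⟨_, (List.mem_ofFn' ..).2 ⟨a, rfl⟩, ?_⟩
      have := Finset.mem_inter.1 ha
      simp [this.1, this.2]
  simp only [Function.comp_apply, this, coverSat]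
  split <;> simp_all

theorem exists_budgetString {m : ℕ} {s : List Bool} (hs : s.length = m) :
    ∃ B : Finset (Fin m), budgetString B = s := by
  subst hs
  refine ⟨Finset.univ.filter fun a => s[a] = true, ?_⟩
  simp [budgetString]

/-- The word that marks the voters. -/
def voterWord (E : BudgetScenario) : List Bool := List.replicate E.numVoters true

/-- What the machines compute for a scenario. -/
def choiceOf (E : BudgetScenario) : List Bool × List Bool :=
  choice (voterWord E) (Computability.encodeNat E.limit) (itemsOf E)

theorem choiceOf_spec (E : BudgetScenario) : ∃ B, E.IsMaxWinning coverSat B ∧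
    (choiceOf E).2.reverse = budgetString B ∧ val (choiceOf E).1 = E.totalSat coverSat B := by
  obtain ⟨h1, h2, h3, h4⟩ := choice_spec (V := voterWord E)
    (l := Computability.encodeNat E.limit) (items := itemsOf E)
    fun it h => by simp [voterWord, length_of_mem_itemsOf h]
  have hlen : (itemsOf E).length = E.numItems := by simp [itemsOf_eq]
  obtain ⟨B, hB⟩ := exists_budgetString (m := E.numItems) (s := (choiceOf E).2.reverse)
    (by simp [choiceOf, h1, hlen])
  have hB' : (choiceOf E).2 = (budgetString B).reverse := by rw [hB, List.reverse_reverse]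
  have hV : (voterWord E).length = E.numVoters := by simp [voterWord]
  rw [val_encodeNat] at h2 h4
  change costOf _ (choiceOf E).2 ≤ _ at h2
  change val (choiceOf E).1 = popcount (coverOf _ _ (choiceOf E).2) at h3
  rw [hB', costOf_budgetString] at h2
  rw [hB', hV, popcount_coverOf_budgetString] at h3
  refine ⟨B, ⟨h2, fun B' hB' => ?_⟩, hB.symm, h3⟩
  have := h4 (budgetString B').reverse (by simp [budgetString, hlen])
    (by rw [costOf_budgetString]; exact hB')
  rw [hV, popcount_coverOf_budgetString] at this
  exact this.trans h3.le

/-! ### Encodings -/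

theorem map_bitOf_natBits (k : ℕ) :
    (natBits k).map bitOf = (Computability.encodeNat k).map some := by
  simp [natBits, Function.comp_def, bitOf]

/-- The brackets `bra` and `ket` become end markers, so each item yields its cost and its column as
two words. -/
theorem map_bitOf_items (l : List (ℕ × List Bool)) : (l.flatMap itemString).map bitOf =
    enc (itemWords (l.map fun x => (Computability.encodeNat x.1, x.2))) := by
  induction l with
  | nil => rfl
  | cons x l ih =>
    simp only [List.flatMap_cons, List.map_append, ih, itemString, map_bitOf_natBits]
    simp [itemWords, enc, Function.comp_def, bitOf]

theorem map_bitOf_scenarioString (E : BudgetScenario) : (scenarioString E).map bitOf =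
    enc (voterWord E :: Computability.encodeNat E.limit :: itemWords (itemsOf E)) := by
  rw [enc_cons, enc_cons, itemsOf, ← map_bitOf_items, ← map_bitOf_natBits]
  simp [scenarioString, voterWord, bitOf]

theorem map_bitOf_boundString (E : BudgetScenario) (r : ℕ) :
    (natBits r ++ Computability.Γ'.comma :: scenarioString E).map bitOf =
    enc (Computability.encodeNat r :: voterWord E :: Computability.encodeNat E.limit ::
      itemWords (itemsOf E)) := by
  rw [enc_cons, ← map_bitOf_natBits, ← map_bitOf_scenarioString]
  simp [bitOf]

theorem length_le_length_enc {ws : List (List Bool)} {w : List Bool} (h : w ∈ ws) :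
    w.length ≤ (enc ws).length := by
  induction ws with
  | nil => simp at h
  | cons x ws ih =>
    rw [enc_cons]
    simp only [List.length_append, List.length_map, List.length_cons]
    rcases List.mem_cons.1 h with rfl | h
    · omega
    · have := ih h
      omega

theorem length_le_length_enc_itemWords (items : List (List Bool × List Bool)) :
    items.length ≤ (enc (itemWords items)).length := by
  induction items with
  | nil => simp
  | cons it items ih =>
    rw [show itemWords (it :: items) = it.1 :: it.2 :: itemWords items from rfl, enc_cons, enc_cons]
    simp only [List.length_append, List.length_map, List.length_cons]
    omega

theorem finite_alpha (k : Stk) : Finite (Alpha k) := inferInstance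

/-! ### Time bounds -/

/-- The part of the time that depends on the number of voters. -/
def voterFactor (n : ℕ) : ℕ := (2 ^ n + 1) * (2 ^ n + 1)

theorem computable_voterFactor : Computable voterFactor := by
  have h : Primrec fun n : ℕ => 2 ^ n + 1 :=
    Primrec.succ.comp ((Primrec₂.unpaired'.1 Nat.Primrec.pow).comp (Primrec.const 2) Primrec.id)
  exact (Primrec.nat_mul.comp h h).to_comp

/-- The part of the time that depends on the length of the input. -/
noncomputable def timePoly : Polynomial ℕ :=
  2 * (2000 * (.X + 1)) + .X * (100 * (2000 * (.X + 1)) + 2) +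
    2 * ((.X + 4) * (2000 * (.X + 1) + 1)) + 6 * .X + 11

/-- Both 1 and `2 ^ n` are at most `(2 ^ n + 1) ^ 2`, so that square can be factored out of every
summand. -/
theorem time_le (n N : ℕ) : 6 * N + 5 + mainTime n N ≤ voterFactor n * timePoly.eval N := by
  have hp : timePoly.eval N = 2 * blockTime N + N * (100 * blockTime N + 2) +
      2 * ((N + 4) * (blockTime N + 1)) + 6 * N + 11 := by
    simp [timePoly, blockTime]
  rw [hp]
  unfold mainTime coreTime itemTime betterTime voterFactor
  rw [← sq]
  have h1 : 1 ≤ (2 ^ n + 1) ^ 2 := Nat.one_le_pow _ _ (Nat.succ_pos _)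
  have h2 : 2 ^ n ≤ (2 ^ n + 1) ^ 2 := by nlinarith [Nat.zero_le (2 ^ n)]
  generalize 2 ^ n = E at *
  generalize (E + 1) ^ 2 = F at *
  generalize blockTime N = B at *
  generalize hC : (N + 4) * (B + 1) = C
  calc 6 * N + 5 + (2 * B + N * (100 * F * B + 2) + E * (C + 2) + 4 + C)
      ≤ 6 * (F * N) + 5 * F + (2 * (F * B) + N * (100 * F * B + F * 2) + F * (C + 2) +
        4 * F + F * C) := by
        gcongr <;> nlinarith
    _ = F * (2 * B + N * (100 * B + 2) + 2 * C + 6 * N + 11) := by ring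

end StackProgram

/-! ### The search and the decision machine -/

open StackProgram

theorem mainTheorem11 :
    FPTSearch scenarioEncoding (fun E => E.numVoters)
        (fun E w => ∃ B, E.IsMaxWinning coverSat B ∧ w = budgetString B) ∧
      FPTDecision scenarioBoundEncoding (fun x => x.1.numVoters)
        (fun x => ∃ B, x.1.IsFeasible B ∧ x.2 ≤ x.1.totalSat coverSat B) := by
  have hfin : ∀ p k, Finite ((machine p).tm.Γ k) := fun p k =>
    finite_alpha k
  have hV : ∀ E, (voterWord E).length = E.numVoters := fun E => by simp [voterWord]
  refine ⟨⟨machine searchProg, voterFactor, timePoly, hfin _, computable_voterFactor, ?_⟩,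
    ⟨machine decideProg, voterFactor, timePoly, hfin _, computable_voterFactor, ?_⟩⟩
  · intro E
    obtain ⟨B, hB, h1, -⟩ := choiceOf_spec E
    refine ⟨budgetString B, ⟨B, hB, rfl⟩, ?_⟩
    have hu := map_bitOf_scenarioString E
    have hlen := congrArg List.length hu
    rw [List.length_map] at hlen
    have hw : ∀ w ∈ voterWord E :: Computability.encodeNat E.limit :: itemWords (itemsOf E),
        w.length ≤ (scenarioString E).length := fun w hw => hlen ▸ length_le_length_enc hw
    -- The input length serves as `N`: it bounds the length of every word and the number of items.
    have hp := triple_searchProg (V := voterWord E) (l := Computability.encodeNat E.limit)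
      (items := itemsOf E) (N := (scenarioString E).length)
      (by
        have := length_le_length_enc_itemWords (itemsOf E)
        rw [hlen, enc_cons, enc_cons]
        simp only [List.length_append, List.length_cons]
        omega)
      (hw _ (by simp)) (hw _ (by simp))
      fun it hit => ⟨hw _ (by
        simp only [List.mem_cons, itemWords, List.mem_flatMap]
        exact .inr (.inr ⟨it, hit, by simp⟩)), by rw [hV, length_of_mem_itemsOf hit]⟩
    rw [hV, show choice _ _ _ = choiceOf E from rfl, h1] at hp
    exact machine_outputs hp hu (time_le _ _)
  · rintro ⟨E, r⟩
    obtain ⟨B, hB, -, h1⟩ := choiceOf_spec E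
    refine ⟨_, ⟨!wlt (choiceOf E).1 (Computability.encodeNat r), rfl, ?_⟩, ?_⟩
    · rw [wlt_eq, val_encodeNat, h1]
      simp only [Bool.not_eq_true', decide_eq_false_iff_not, not_lt]
      -- Some feasible budget reaches `r` if and only if the winning one does.
      exact ⟨fun h => ⟨B, hB.1, h⟩, fun ⟨B', hB', h⟩ => h.trans (hB.2 B' hB')⟩
    · have hu := map_bitOf_boundString E r
      have hlen := congrArg List.length hu
      rw [List.length_map] at hlen
      set u := natBits r ++ Computability.Γ'.comma :: scenarioString E with hu'
      have hw : ∀ w ∈ Computability.encodeNat r :: voterWord E ::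
          Computability.encodeNat E.limit :: itemWords (itemsOf E),
          w.length ≤ u.length := fun w hw => hlen ▸ length_le_length_enc hw
      have hp := triple_decideProg (V := voterWord E) (l := Computability.encodeNat E.limit)
        (r := Computability.encodeNat r) (items := itemsOf E) (N := u.length)
        (by
          have := length_le_length_enc_itemWords (itemsOf E)
          rw [hlen, enc_cons, enc_cons, enc_cons]
          simp only [List.length_append, List.length_cons]
          omega)
        (hw _ (by simp)) (hw _ (by simp)) (hw _ (by simp))
        fun it hit => ⟨hw _ (by
          simp only [List.mem_cons, itemWords, List.mem_flatMap]
          exact .inr (.inr (.inr ⟨it, hit, by simp⟩))), by rw [hV, length_of_mem_itemsOf hit]⟩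
      rw [hV, show choice _ _ _ = choiceOf E from rfl] at hp
      exact machine_outputs hp hu (time_le _ _)
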